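/- **Setting.** Let $\eta\in\mathbb C$ be such that $q=e^{\eta}$ is not a root of unity, let $n\ge 1$, and let $\xi_1,\dots,\xi_n\in\mathbb C\setminus\{0\}$ satisfy $\xi_i^2\ne\xi_j^2$ and $\xi_i^2\ne q^{2}\xi_j^2$ for $i\ne j$. Let $V_j\cong\mathbb C^2$ ($1\le j\le n$), and let $\sigma^{\pm},\sigma^z$ be the Pauli matrices. Let $S^z=\frac12\sum_j\sigma^z_j$ be the total spin of the segment considered. *Transfer operator.* Let $$R(\zeta)=(q\zeta-q^{-1}\zeta^{-1})\begin{pmatrix}1&0&0&0\\0&\beta&\gamma&0\\0&\gamma&\beta&0\\0&0&0&1\end{pmatrix},\qquad \beta=\frac{(1-\zeta^2)q}{1-q^2\zeta^2},\quad \gamma=\frac{(1-q^2)\zeta}{1-q^2\zeta^2},$$ let $T_a(\zeta)=R_{a,n}(\zeta/\xi_n)\cdots R_{a,1}(\zeta/\xi_1)$ with $V_a\cong\mathbb C^2$, and set $\mathbf t_{[1,n]}(\zeta)(X)=\operatorname{tr}_a\big(T_a(\zeta)^{-1}XT_a(\zeta)\big)$ for $X\in\operatorname{End}(V_1\otimes\dots\otimes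 V_n)$. *$Q$-operator.* On $W^+=\bigoplus_{k\ge0}\mathbb C|k\rangle$ let $q^D|k\rangle=q^k|k\rangle$, $a|k\rangle=(1-q^{2k})|k-1\rangle$, $a^*|k\rangle=|k+1\rangle$. Let $$L^+(\zeta)=\mathrm i\,\zeta^{-1/2}q^{-1/4}\big(1-\zeta a^*\sigma^+-\zeta a\sigma^--\zeta^2q^{2D+2}\sigma^-\sigma^+\big)q^{\sigma^zD},$$ let $T^+_A(\zeta)=L^+_{A,n}(\zeta/\xi_n)\cdots L^+_{A,1}(\zeta/\xi_1)$, and set $$\mathbf Q_{[1,n]}(\zeta;\alpha)(X)=\operatorname{tr}_{W^+}\big(q^{2\alpha D}\,T^+_A(\zeta)^{-1}XT^+_A(\zeta)\big).$$ Here $q^{2\alpha D}|k\rangle=e^{2\alpha\eta k}|k\rangle$. The trace is the value at $z=e^{2\alpha\eta}$ of the rational function of $z$ with expansion $\sum_{k\ge0}z^k\langle k|\,\cdot\,|k\rangle$ at $z=0$ (analytic continuation in $\alpha$). *The operators $\mathbf H_j$.* Let $$\mathbf H_{[1,n]}(\zeta;\alpha)(X)=\operatorname{tr}_{a}\operatorname{tr}_{W^+}\big(q^{2\alpha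 D}(T^+_AT_a)^{-1}X\,T^+_AT_a\big)=\mathbf t_{[1,n]}(\zeta)\big(\mathbf Q_{[1,n]}(\zeta;\alpha)(X)\big),$$ $$\mathbf H_j(X)=\lim_{\alpha\to0}\ \operatorname{res}_{\zeta=\xi_j}\mathbf H_{[1,n]}(\zeta;\alpha)(X),\qquad 1\le j\le n.$$ On a subsegment, $\mathbf H_j$ is defined in the same way with the inhomogeneities of that subsegment. **Proposition.** The operators $\mathbf H_j$ are well defined on all of $\operatorname{End}(V_1\otimes\dots\otimes V_n)$: for all small $\alpha\neq0$, the monodromy matrices are invertible and the traces exist for $\zeta\ne\xi_j$ near $\xi_j$; $\mathbf H_{[1,n]}(\zeta;\alpha)(X)$ is meromorphic in $\zeta$ at $\xi_j$; and the limit $\alpha\to0$ of the residue exists. They satisfy the following reduction identities. 1. $\mathbf H_1(I_1X)=0$ for every $X\in\operatorname{End}(V_2\otimes\dots\otimes V_n)$ with $[S^z,X]=0$. 2. $\mathbf H_j(I_1X)=I_1\,\mathbf H_j(X)$ for $2\le j\le n$ and every $X\in\operatorname{End}(V_2\otimes\dots\otimes V_n)$ with $[S^z,X]=0$. 3. $\mathbf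 H_j(XI_n)=\mathbf H_j(X)\,I_n$ for $1\le j\le n-1$ and every $X\in\operatorname{End}(V_1\otimes\dots\otimes V_{n-1})$. 4. $\mathbf H_n(XI_n)=0$ for every $X\in\operatorname{End}(V_1\otimes\dots\otimes V_{n-1})$. -/

import Mathlib

open Filter Topology

noncomputable section

namespace XXZ

/-- Basis of `(ℂ²)^{⊗ n}`: at each site, `0` is spin up (`+`) and `1` is spin down (`-`). -/
abbrev Conf (n : ℕ) : Type := Fin n → Fin 2

/-- `End((ℂ²)^{⊗ n})`, operators on a chain segment with `n` sites. -/
abbrev SpinOp (n : ℕ) : Type := Matrix (Conf n) (Conf n) ℂ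

/-- `I ⊗ X`: the identity on a new first site, `X` on the other sites. -/
def leftId {n : ℕ} (X : SpinOp n) : SpinOp (n + 1) :=
  Matrix.of fun s t => if s 0 = t 0 then X (fun i => s i.succ) (fun i => t i.succ) else 0

/-- `X ⊗ I`: the identity on a new last site, `X` on the other sites. -/
def rightId {n : ℕ} (X : SpinOp n) : SpinOp (n + 1) :=
  Matrix.of fun s t =>
    if s (Fin.last n) = t (Fin.last n) then
      X (fun i => s i.castSucc) (fun i => t i.castSucc)
    else 0

/-- The `z`-component of the total spin, `½ ∑ σ^z_j`. -/
def totalSpin (n : ℕ) : SpinOp n :=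
  Matrix.diagonal fun s => ∑ i, if s i = 0 then (1 / 2 : ℂ) else -(1 / 2)

/-! ### Monodromy matrices

An operator on (auxiliary space) `⊗ (ℂ²)^{⊗ n}` is a matrix indexed by spin configurations whose
entries lie in the algebra `𝒜` of operators on the auxiliary space. -/

section Monodromy

variable {𝒜 : Type*} [Ring 𝒜] [Algebra ℂ 𝒜]

/-- An operator on (auxiliary space) `⊗ ℂ²` acting on the site `j` of the segment. -/
def atSite {n : ℕ} (j : Fin n) (L : Matrix (Fin 2) (Fin 2) 𝒜) : Matrix (Conf n) (Conf n) 𝒜 :=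
  Matrix.of fun s t => if ∀ i, i ≠ j → s i = t i then L (s j) (t j) else 0

/-- `T(ζ) = L_n(ζ/ξ_n) ⋯ L_1(ζ/ξ_1)`. -/
def monodromy {n : ℕ} (L : ℂ → Matrix (Fin 2) (Fin 2) 𝒜) (ξ : Fin n → ℂ) (ζ : ℂ) :
    Matrix (Conf n) (Conf n) 𝒜 :=
  (List.ofFn fun j => atSite j (L (ζ / ξ j))).reverse.prod

/-- The inverse adjoint action `X ↦ T⁻¹ (1 ⊗ X) T`. The inverse is that of the algebra
`𝒜 ⊗ End((ℂ²)^{⊗ n})`. -/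
def invAdjoint {n : ℕ} (T : Matrix (Conf n) (Conf n) 𝒜) (X : SpinOp n) :
    Matrix (Conf n) (Conf n) 𝒜 :=
  Ring.inverse T * X.map (algebraMap ℂ 𝒜) * T

end Monodromy

/-! ### Six-vertex model -/

/-- The six-vertex `R`-matrix. -/
def Rmat (q ζ : ℂ) : Matrix (Fin 2 × Fin 2) (Fin 2 × Fin 2) ℂ :=
  (q * ζ - q⁻¹ * ζ⁻¹) • Matrix.of fun x y =>
    if x = y then
      if x.1 = x.2 then 1 else (1 - ζ ^ 2) * q / (1 - q ^ 2 * ζ ^ 2)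
    else if x.1 = y.2 ∧ x.2 = y.1 then (1 - q ^ 2) * ζ / (1 - q ^ 2 * ζ ^ 2)
    else 0

/-- `L_{a,j}(ζ) = R_{a,j}(ζ)` (first tensor factor of `R`: auxiliary space, second: site). -/
def Lsix (q ζ : ℂ) : Matrix (Fin 2) (Fin 2) (Matrix (Fin 2) (Fin 2) ℂ) :=
  Matrix.of fun s t => Matrix.of fun a b => Rmat q ζ (a, s) (b, t)

/-- The transfer operator `t(ζ)(X) = tr_a (T_a(ζ)⁻¹ X T_a(ζ))`. -/
def tOp {n : ℕ} (q : ℂ) (ξ : Fin n → ℂ) (ζ : ℂ) (X : SpinOp n) : SpinOp n :=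
  (invAdjoint (monodromy (Lsix q) ξ ζ) X).map Matrix.trace

/-! ### The `q`-oscillator module `W⁺` -/

/-- `W⁺ = ⨁_{k ≥ 0} ℂ |k⟩`. -/
abbrev Fock : Type := ℕ →₀ ℂ

/-- `q^{m D} |k⟩ = q^{m k} |k⟩`. -/
def qD (q : ℂ) (m : ℤ) : Module.End ℂ Fock :=
  Finsupp.linearCombination ℂ fun k : ℕ => Finsupp.single k (q ^ (m * (k : ℤ)))

/-- `a^* |k⟩ = |k+1⟩`. -/
def creation : Module.End ℂ Fock :=
  Finsupp.linearCombination ℂ fun k : ℕ => Finsupp.single (k + 1) (1 : ℂ)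

/-- `a |k⟩ = (1 - q^{2k}) |k-1⟩`; in particular `a |0⟩ = 0`. -/
def annihilation (q : ℂ) : Module.End ℂ Fock :=
  Finsupp.linearCombination ℂ fun k : ℕ => Finsupp.single (k - 1) (1 - q ^ (2 * k))

/-- `L⁺(ζ) = i ζ^{-1/2} q^{-1/4}
(1 - ζ a^* σ⁺ - ζ a σ⁻ - ζ² q^{2D+2} σ⁻σ⁺) q^{σ^z D}`, acting on `W⁺ ⊗ ℂ²`. -/
def Lplus (q ζ : ℂ) : Matrix (Fin 2) (Fin 2) (Module.End ℂ Fock) :=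
  (Complex.I * ζ ^ (-(1 / 2) : ℂ) * q ^ (-(1 / 4) : ℂ)) •
    (!![1, -(ζ • creation);
        -(ζ • annihilation q), 1 - (ζ ^ 2 * q ^ 2) • qD q 2] *
      !![qD q 1, 0; 0, qD q (-1)])

/-- `v` is the value at `z` of the (unique) rational function whose expansion at `0` is
`∑_k f(k) z^k`, and `z` is not a pole of it. -/
def HasContinuedSum (f : ℕ → ℂ) (z v : ℂ) : Prop :=
  ∃ p r : Polynomial ℂ, r.eval z ≠ 0 ∧
    (r : PowerSeries ℂ) * PowerSeries.mk f = (p : PowerSeries ℂ) ∧ v = p.eval z / r.eval z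

theorem HasContinuedSum.unique {f : ℕ → ℂ} {z v w : ℂ} (hv : HasContinuedSum f z v)
    (hw : HasContinuedSum f z w) : v = w := by
  obtain ⟨p, r, hr, h, rfl⟩ := hv
  obtain ⟨p', r', hr', h', rfl⟩ := hw
  have key : p * r' = p' * r := by
    apply Polynomial.coe_injective ℂ
    rw [Polynomial.coe_mul, Polynomial.coe_mul, ← h, ← h']
    ring
  have := congrArg (Polynomial.eval z) key
  simp only [Polynomial.eval_mul] at this
  rw [div_eq_div_iff hr hr']
  exact this

open Classical in
/-- The analytic continuation of `∑_k f(k) z^k` (and `0` at a pole, or if there is none). -/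
def continuedSum (f : ℕ → ℂ) (z : ℂ) : ℂ :=
  if h : ∃ v, HasContinuedSum f z v then h.choose else 0

/-- The diagonal matrix elements `⟨k| x |k⟩`. -/
def diagElem (x : Module.End ℂ Fock) (k : ℕ) : ℂ := x (Finsupp.single k 1) k

/-- `tr⁺(q^{2αD} x) = ∑_k q^{2αk} ⟨k| x |k⟩`, continued analytically in `α`; here `q = e^η`. -/
def weightedTrace (η α : ℂ) (x : Module.End ℂ Fock) : ℂ :=
  continuedSum (diagElem x) (Complex.exp (2 * α * η))

/-- `Q(ζ;α)(X) = tr⁺_A (q^{2αD_A} T⁺_A(ζ)⁻¹ X T⁺_A(ζ))`. -/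
def QOp {n : ℕ} (η : ℂ) (ξ : Fin n → ℂ) (ζ α : ℂ) (X : SpinOp n) : SpinOp n :=
  (invAdjoint (monodromy (Lplus (Complex.exp η)) ξ ζ) X).map (weightedTrace η α)

/-! ### The operators `H` and `H_j` -/

/-- `H(ζ;α)(X) = tr_a tr⁺_A (q^{2αD_A} (T⁺_A T_a)⁻¹ X (T⁺_A T_a))`: the innermost conjugation is
the one by `T⁺_A(ζ)`. -/
def HOp {n : ℕ} (η : ℂ) (ξ : Fin n → ℂ) (ζ α : ℂ) (X : SpinOp n) : SpinOp n :=
  tOp (Complex.exp η) ξ ζ (QOp η ξ ζ α X)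

/-- The residue of `f` at an isolated singularity `c`. -/
def residueAt (f : ℂ → ℂ) (c : ℂ) : ℂ :=
  limUnder (𝓝[>] (0 : ℝ)) fun r =>
    (2 * (Real.pi : ℂ) * Complex.I)⁻¹ * ∮ ζ in C(c, r), f ζ

/-- The matrix elements of `res_{ζ = ξ_j} H(ζ;α)(X)`. -/
def resH {n : ℕ} (η : ℂ) (ξ : Fin n → ℂ) (j : Fin n) (X : SpinOp n) (α : ℂ) (s t : Conf n) : ℂ :=
  residueAt (fun ζ => HOp η ξ ζ α X s t) (ξ j)

/-- `H_j(X) = lim_{α → 0} res_{ζ = ξ_j} H(ζ;α)(X)`. -/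
def Hj {n : ℕ} (η : ℂ) (ξ : Fin n → ℂ) (j : Fin n) (X : SpinOp n) : SpinOp n :=
  Matrix.of fun s t => limUnder (𝓝[≠] (0 : ℂ)) fun α => resH η ξ j X α s t

/-- Everything that enters `H_j(X)` is well defined: for all small `α ≠ 0`, near `ζ = ξ_j` the
monodromy matrices are invertible and the continued traces over `W⁺` exist, `H(ζ;α)(X)` is
meromorphic at `ζ = ξ_j`, and its residue has a limit as `α → 0`. -/
def HjWellDefined {n : ℕ} (η : ℂ) (ξ : Fin n → ℂ) (j : Fin n) (X : SpinOp n) : Prop :=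
  (∀ᶠ α in 𝓝[≠] (0 : ℂ), ∀ᶠ ζ in 𝓝[≠] (ξ j),
      IsUnit (monodromy (Lsix (Complex.exp η)) ξ ζ) ∧
      IsUnit (monodromy (Lplus (Complex.exp η)) ξ ζ) ∧
      ∀ s t, ∃ v, HasContinuedSum
        (diagElem (invAdjoint (monodromy (Lplus (Complex.exp η)) ξ ζ) X s t))
        (Complex.exp (2 * α * η)) v) ∧
  (∀ᶠ α in 𝓝[≠] (0 : ℂ), ∀ s t, MeromorphicAt (fun ζ => HOp η ξ ζ α X s t) (ξ j)) ∧
  ∀ s t, ∃ ℓ, Tendsto (fun α => resH η ξ j X α s t) (𝓝[≠] (0 : ℂ)) (𝓝 ℓ)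

end XXZ

end

/-! The argument is fusion followed by a grading count. At one site, the product of `L⁺` and the
six-vertex matrix becomes block lower triangular in the two-dimensional auxiliary space after
conjugation by the unipotent matrix whose corner is g = q⁻¹ a^* q^{-2D} (`siteM_mul_siteR`). This
gauge is the same at every site and independent of ζ, so it conjugates the whole monodromy matrix.
Write f for the resulting conjugation of X (`fused`), a lower triangular 2×2 matrix of oscillator
operators. Undoing the gauge inside the twisted trace gives tr f₀₀ + tr f₁₁ + (q^{2α} - 1)
tr(q^{2αD} f₁₀ g), by `HOp_eq`.

The diagonal blocks f₀₀ and f₁₁ have no pole at ζ = ξ_j, because the singular scalars w - w⁻¹, with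
w = ζ/ξ_j, cancel between the monodromy and its inverse. In the last term the factor q^{2α} - 1
selects, as α → 0, the coefficient of (1 - q^{2α})⁻¹ in the trace. That coefficient is a functional
`tau`: it reads off the constant term of the diagonal matrix elements written in powers of q^k, and
it is cyclic (`tau_mul_comm`). Hence H_j(X) is minus the residue of tau(f₁₀ g) at ξ_j (`Hj_apply`).

For X ⊗ I, the factors of the last site meet across X and cancel, so f is that of the shorter chain;
no singular factor at ξ_n remains. For I ⊗ X, the factors of the first site stand outside, and
cyclicity of `tau` moves them around g. The resulting sums (`crossing_A_zero_zero` and its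
companions) consist of g itself, of terms regular at w² = 1, and of singular terms of positive
weight. When X conserves spin, f lies on the line (degree, exponent) = (d, -2d) by
`fused_mem_gradedMat`, and `tau` annihilates every product with a term of positive weight
(`tau_mul_eq_zero`). Up to analytic functions, what is left is I ⊗ the shorter chain
(`fusedTau_leftId`). -/

noncomputable section

namespace XXZ

set_option linter.unusedSimpArgs false

/-! ### Ordered products over the sites, their inverses, and conjugation. -/

section Products

variable {𝒜 : Type*} [Ring 𝒜] {n : ℕ}

/-- The operator with matrix elements `ℓ_n(s_n, t_n) ⋯ ℓ_1(s_1, t_1)`. -/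
def mono (ℓ : Fin n → Matrix (Fin 2) (Fin 2) 𝒜) : Matrix (Conf n) (Conf n) 𝒜 :=
  Matrix.of fun s t => (List.ofFn fun j => ℓ j (s j) (t j)).reverse.prod

/-- The operator with matrix elements `ℓ_1(s_1, t_1) ⋯ ℓ_n(s_n, t_n)`. -/
def comono (ℓ : Fin n → Matrix (Fin 2) (Fin 2) 𝒜) : Matrix (Conf n) (Conf n) 𝒜 :=
  Matrix.of fun s t => (List.ofFn fun j => ℓ j (s j) (t j)).prod

lemma mono_zero (ℓ : Fin 0 → Matrix (Fin 2) (Fin 2) 𝒜) : mono ℓ = 1 := by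
  ext s t
  obtain rfl := Subsingleton.elim s t
  simp [mono]

lemma comono_zero (ℓ : Fin 0 → Matrix (Fin 2) (Fin 2) 𝒜) : comono ℓ = 1 := by
  ext s t
  obtain rfl := Subsingleton.elim s t
  simp [comono]

lemma mono_succ (ℓ : Fin (n + 1) → Matrix (Fin 2) (Fin 2) 𝒜) (s t : Conf (n + 1)) :
    mono ℓ s t = mono (fun j => ℓ j.succ) (fun i => s i.succ) (fun i => t i.succ) *
      ℓ 0 (s 0) (t 0) := by
  simp [mono, List.ofFn_succ]

lemma comono_succ (ℓ : Fin (n + 1) → Matrix (Fin 2) (Fin 2) 𝒜) (s t : Conf (n + 1)) :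
    comono ℓ s t = ℓ 0 (s 0) (t 0) *
      comono (fun j => ℓ j.succ) (fun i => s i.succ) (fun i => t i.succ) := by
  simp [comono, List.ofFn_succ]

lemma mono_last (ℓ : Fin (n + 1) → Matrix (Fin 2) (Fin 2) 𝒜) (s t : Conf (n + 1)) :
    mono ℓ s t = ℓ (Fin.last n) (s (Fin.last n)) (t (Fin.last n)) *
      mono (fun j => ℓ j.castSucc) (fun i => s i.castSucc) (fun i => t i.castSucc) := by
  simp only [mono, Matrix.of_apply]
  rw [List.ofFn_succ_last]
  simp

lemma comono_last (ℓ : Fin (n + 1) → Matrix (Fin 2) (Fin 2) 𝒜) (s t : Conf (n + 1)) :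
    comono ℓ s t =
      comono (fun j => ℓ j.castSucc) (fun i => s i.castSucc) (fun i => t i.castSucc) *
      ℓ (Fin.last n) (s (Fin.last n)) (t (Fin.last n)) := by
  simp only [comono, Matrix.of_apply]
  rw [List.ofFn_succ_last]
  simp

lemma sum_conf_succ {M : Type*} [AddCommMonoid M] (f : Conf (n + 1) → M) :
    ∑ u, f u = ∑ c : Fin 2, ∑ u : Conf n, f (Fin.cons c u) := by
  rw [← Fintype.sum_prod_type']
  exact (Fintype.sum_equiv (Fin.consEquiv fun _ => Fin 2) _ _ fun x => rfl).symm

lemma sum_conf_last {M : Type*} [AddCommMonoid M] (f : Conf (n + 1) → M) :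
    ∑ u, f u = ∑ c : Fin 2, ∑ u : Conf n, f (Fin.snoc u c) := by
  rw [← Fintype.sum_prod_type']
  exact (Fintype.sum_equiv (Fin.snocEquiv fun _ => Fin 2) _ _ fun x => rfl).symm

lemma conf_ext_succ {s t : Conf (n + 1)} :
    s = t ↔ s 0 = t 0 ∧ (fun i : Fin n => s i.succ) = fun i => t i.succ := by
  constructor
  · rintro rfl; simp
  · rintro ⟨h0, h⟩
    ext i
    refine Fin.cases ?_ (fun i => ?_) i
    · rw [h0]
    · rw [congrFun h i]

lemma conf_ext_last {s t : Conf (n + 1)} :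
    s = t ↔ s (Fin.last n) = t (Fin.last n) ∧
      (fun i : Fin n => s i.castSucc) = fun i => t i.castSucc := by
  constructor
  · rintro rfl; simp
  · rintro ⟨h0, h⟩
    ext i
    refine Fin.lastCases ?_ (fun i => ?_) i
    · rw [h0]
    · rw [congrFun h i]

/-- The embedding `M ↦ I ⊗ M`, with the identity on a new first site. -/
def leftEmb : Matrix (Conf n) (Conf n) 𝒜 →* Matrix (Conf (n + 1)) (Conf (n + 1)) 𝒜 where
  toFun M := Matrix.of fun s t =>
    if s 0 = t 0 then M (fun i => s i.succ) (fun i => t i.succ) else 0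
  map_one' := by
    ext s t
    simp only [Matrix.of_apply, Matrix.one_apply, conf_ext_succ (s := s)]
    split_ifs <;> simp_all
  map_mul' M N := by
    ext s t
    rw [Matrix.mul_apply, sum_conf_succ]
    by_cases h : s 0 = t 0
    · simp [h, Matrix.mul_apply]
    · simp [h, Matrix.mul_apply]

lemma atSite_succ (j : Fin n) (L : Matrix (Fin 2) (Fin 2) 𝒜) :
    atSite j.succ L = leftEmb (atSite j L) := by
  ext s t
  simp only [atSite, leftEmb, MonoidHom.coe_mk, OneHom.coe_mk, Matrix.of_apply, ← ite_and]
  refine if_congr ?_ rfl rfl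
  rw [Fin.forall_fin_succ]
  simp [(Fin.succ_ne_zero j).symm]

lemma leftEmb_mul_atSite_zero (M : Matrix (Conf n) (Conf n) 𝒜) (L : Matrix (Fin 2) (Fin 2) 𝒜)
    (s t : Conf (n + 1)) :
    (leftEmb M * atSite 0 L : Matrix (Conf (n + 1)) (Conf (n + 1)) 𝒜) s t =
      M (fun i => s i.succ) (fun i => t i.succ) * L (s 0) (t 0) := by
  rw [Matrix.mul_apply, sum_conf_succ]
  rw [Finset.sum_eq_single (s 0), Finset.sum_eq_single (fun i : Fin n => t i.succ)]
  · simp only [atSite, leftEmb, MonoidHom.coe_mk, OneHom.coe_mk, Matrix.of_apply, Fin.cons_zero,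
      Fin.cons_succ]
    rw [if_pos trivial, if_pos]
    intro i hi
    obtain ⟨i, rfl⟩ := Fin.exists_succ_eq.2 hi
    simp
  · intro u _ hu
    simp only [atSite, Matrix.of_apply]
    rw [if_neg, mul_zero]
    intro h
    exact hu (funext fun i => by simpa using h i.succ (Fin.succ_ne_zero i))
  · simp
  · intro c _ hc
    refine Finset.sum_eq_zero fun u _ => ?_
    simp [leftEmb, hc.symm]
  · simp

/-- Each factor changes only the spin of its own site, so the sum over intermediate configurations
collapses to a single ordered product of entries. -/
lemma prod_atSite (ℓ : Fin n → Matrix (Fin 2) (Fin 2) 𝒜) :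
    (List.ofFn fun j => atSite j (ℓ j)).reverse.prod = mono ℓ := by
  induction n with
  | zero => simp [mono_zero]
  | succ n ih =>
    ext s t
    have h := ih fun j => ℓ j.succ
    rw [List.ofFn_succ, List.reverse_cons, List.prod_append, List.prod_singleton, mono_succ, ← h]
    rw [← leftEmb_mul_atSite_zero, map_list_prod (leftEmb (𝒜 := 𝒜) (n := n)), List.map_reverse,
      List.map_ofFn]
    simp only [atSite_succ]
    rfl

lemma monodromy_eq_mono [Algebra ℂ 𝒜] (L : ℂ → Matrix (Fin 2) (Fin 2) 𝒜) (ξ : Fin n → ℂ) (ζ : ℂ) :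
    monodromy L ξ ζ = mono fun j => L (ζ / ξ j) :=
  prod_atSite _

/-- The last site is outermost on both sides; the inner product is the identity by induction, and
then the two outer factors meet. Since the entries do not commute and the auxiliary space may be
infinite-dimensional, the other order needs its own proof, which peels off the first site. -/
lemma mono_mul_comono (ℓ ℓ' : Fin n → Matrix (Fin 2) (Fin 2) 𝒜) (h : ∀ j, ℓ j * ℓ' j = 1) :
    mono ℓ * comono ℓ' = 1 := by
  induction n with
  | zero => simp [mono_zero, comono_zero]
  | succ n ih =>
    ext s t
    rw [Matrix.mul_apply, sum_conf_last, Matrix.one_apply]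
    have h0 := congrFun (congrFun (h (Fin.last n)) (s (Fin.last n))) (t (Fin.last n))
    have h1 := congrFun (congrFun (ih (fun j => ℓ j.castSucc) (fun j => ℓ' j.castSucc)
      fun j => h _) (fun i => s i.castSucc)) (fun i => t i.castSucc)
    rw [Matrix.mul_apply, Matrix.one_apply] at h0 h1
    simp only [mono_last, comono_last, Fin.snoc_last, Fin.snoc_castSucc]
    calc _ = ∑ c : Fin 2, ℓ (Fin.last n) (s (Fin.last n)) c *
          (∑ u, mono (fun j => ℓ j.castSucc) (fun i => s i.castSucc) u *
            comono (fun j => ℓ' j.castSucc) u (fun i => t i.castSucc)) *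
          ℓ' (Fin.last n) c (t (Fin.last n)) := by
          simp only [Finset.mul_sum, Finset.sum_mul, mul_assoc]
      _ = _ := by
          rw [h1]
          simp only [conf_ext_last (s := s)]
          by_cases hh : (fun i : Fin n => s i.castSucc) = fun i => t i.castSucc
          · simp [hh, h0]
          · simp [hh]

lemma comono_mul_mono (ℓ ℓ' : Fin n → Matrix (Fin 2) (Fin 2) 𝒜) (h : ∀ j, ℓ' j * ℓ j = 1) :
    comono ℓ' * mono ℓ = 1 := by
  induction n with
  | zero => simp [mono_zero, comono_zero]
  | succ n ih =>
    ext s t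
    rw [Matrix.mul_apply, sum_conf_succ, Matrix.one_apply]
    have h0 := congrFun (congrFun (h 0) (s 0)) (t 0)
    have h1 := congrFun (congrFun (ih (fun j => ℓ j.succ) (fun j => ℓ' j.succ)
      fun j => h _) (fun i => s i.succ)) (fun i => t i.succ)
    rw [Matrix.mul_apply, Matrix.one_apply] at h0 h1
    simp only [mono_succ, comono_succ, Fin.cons_zero, Fin.cons_succ]
    calc _ = ∑ c : Fin 2, ℓ' 0 (s 0) c *
          (∑ u, comono (fun j => ℓ' j.succ) (fun i => s i.succ) u *
            mono (fun j => ℓ j.succ) u (fun i => t i.succ)) *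
          ℓ 0 c (t 0) := by
          simp only [Finset.mul_sum, Finset.sum_mul, mul_assoc]
      _ = _ := by
          rw [h1]
          simp only [conf_ext_succ (s := s)]
          by_cases hh : (fun i : Fin n => s i.succ) = fun i => t i.succ
          · simp [hh, h0]
          · simp [hh]

lemma mono_map {ℬ : Type*} [Ring ℬ] (φ : 𝒜 →+* ℬ) (ℓ : Fin n → Matrix (Fin 2) (Fin 2) 𝒜) :
    mono (fun j => (ℓ j).map φ) = (mono ℓ).map φ := by
  induction n with
  | zero => simp [mono_zero]
  | succ n ih => ext s t; simp [mono_succ, ih]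

/-- With two auxiliary spaces, factors acting on different ones commute, so T_A T_a can be regrouped
site by site. This is what makes fusion a one-site statement. -/
lemma mono_mul_of_commute (ℓ r : Fin n → Matrix (Fin 2) (Fin 2) 𝒜)
    (h : ∀ i j a b c d, Commute (ℓ i a b) (r j c d)) :
    mono (fun j => ℓ j * r j) = mono ℓ * mono r := by
  induction n with
  | zero => simp [mono_zero]
  | succ n ih =>
    ext s t
    have hc : ∀ i (r : Fin n → Matrix (Fin 2) (Fin 2) 𝒜) (s t : Conf n),
        (∀ j a b c d, Commute (ℓ i a b) (r j c d)) → ∀ a b, Commute (ℓ i a b) (mono r s t) := by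
      intro i r s t hr a b
      refine Commute.list_prod_right _ _ fun x hx => ?_
      obtain ⟨j, rfl⟩ := (List.mem_ofFn' _ _).1 (List.mem_reverse.1 hx)
      exact hr _ _ _ _ _
    rw [mono_succ, ih (fun j => ℓ j.succ) (fun j => r j.succ) (fun i j => h _ _), Matrix.mul_apply,
      Matrix.mul_apply, Matrix.mul_apply, sum_conf_succ, Finset.sum_mul_sum, Finset.sum_comm]
    refine Finset.sum_congr rfl fun c _ => Finset.sum_congr rfl fun u _ => ?_
    simp only [mono_succ, Fin.cons_zero, Fin.cons_succ]
    have := hc 0 (fun j => r j.succ) u (fun i => t i.succ) (fun j => h _ _) (s 0) c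
    rw [mul_assoc, mul_assoc, ← mul_assoc (mono (fun j => r j.succ) _ _), ← this.eq, mul_assoc]

/-- A gauge common to all sites telescopes: G' G = 1 between neighbours. -/
lemma mono_conj (G G' : 𝒜) (hG : G' * G = 1) (hG' : G * G' = 1)
    (ℓ : Fin n → Matrix (Fin 2) (Fin 2) 𝒜) :
    mono (fun j => (ℓ j).map fun x => G * x * G') = (mono ℓ).map fun x => G * x * G' := by
  induction n with
  | zero =>
    ext s t
    simp [mono_zero, Subsingleton.elim s t, hG']
  | succ n ih =>
    ext s t
    rw [mono_succ, ih fun j => ℓ j.succ, Matrix.map_apply, Matrix.map_apply, Matrix.map_apply,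
      mono_succ]
    simp only [mul_assoc]
    rw [← mul_assoc G' G, hG, one_mul]

lemma isUnit_mono (ℓ ℓ' : Fin n → Matrix (Fin 2) (Fin 2) 𝒜) (h : ∀ j, ℓ j * ℓ' j = 1)
    (h' : ∀ j, ℓ' j * ℓ j = 1) : IsUnit (mono ℓ) :=
  ⟨⟨mono ℓ, comono ℓ', mono_mul_comono ℓ ℓ' h, comono_mul_mono ℓ ℓ' h'⟩, rfl⟩

section Algebra

variable [Algebra ℂ 𝒜]

/-- The operator `X ↦ T⁻¹ X T`, with `T⁻¹` given by its site factors. -/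
def conjBy (ℓ ℓ' : Fin n → Matrix (Fin 2) (Fin 2) 𝒜) (X : SpinOp n) : Matrix (Conf n) (Conf n) 𝒜 :=
  comono ℓ' * X.map (algebraMap ℂ 𝒜) * mono ℓ

lemma conjBy_apply (ℓ ℓ' : Fin n → Matrix (Fin 2) (Fin 2) 𝒜) (X : SpinOp n) (s t : Conf n) :
    conjBy ℓ ℓ' X s t = ∑ u, ∑ v, X u v • (comono ℓ' s u * mono ℓ v t) := by
  simp only [conjBy, Matrix.mul_apply, Finset.sum_mul, Matrix.map_apply]
  rw [Finset.sum_comm]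
  refine Finset.sum_congr rfl fun u _ => Finset.sum_congr rfl fun v _ => ?_
  rw [← Algebra.commutes, ← Algebra.smul_def, smul_mul_assoc]

lemma invAdjoint_mono (ℓ ℓ' : Fin n → Matrix (Fin 2) (Fin 2) 𝒜) (h : ∀ j, ℓ j * ℓ' j = 1)
    (h' : ∀ j, ℓ' j * ℓ j = 1) (X : SpinOp n) :
    invAdjoint (mono ℓ) X = conjBy ℓ ℓ' X := by
  have : Ring.inverse (mono ℓ) = comono ℓ' :=
    Ring.inverse_unit ⟨mono ℓ, comono ℓ', mono_mul_comono ℓ ℓ' h, comono_mul_mono ℓ ℓ' h'⟩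
  rw [invAdjoint, this, conjBy]

lemma mono_smul (c : Fin n → ℂ) (ℓ : Fin n → Matrix (Fin 2) (Fin 2) 𝒜) :
    mono (fun j => c j • ℓ j) = (∏ j, c j) • mono ℓ := by
  induction n with
  | zero => simp [mono_zero]
  | succ n ih =>
    ext s t
    simp [mono_succ, ih, Fin.prod_univ_succ, smul_smul]

lemma comono_smul (c : Fin n → ℂ) (ℓ : Fin n → Matrix (Fin 2) (Fin 2) 𝒜) :
    comono (fun j => c j • ℓ j) = (∏ j, c j) • comono ℓ := by
  induction n with
  | zero => simp [comono_zero]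
  | succ n ih =>
    ext s t
    simp [comono_succ, ih, Fin.prod_univ_succ, smul_smul, mul_comm]

/-- This removes the prefactor of `L⁺` together with its branch of ζ^{-1/2}, and also the factors w
- w⁻¹ of the lower diagonal block. -/
lemma conjBy_smul (c : Fin n → ℂ) (hc : ∀ j, c j ≠ 0) (ℓ ℓ' : Fin n → Matrix (Fin 2) (Fin 2) 𝒜)
    (X : SpinOp n) :
    conjBy (fun j => c j • ℓ j) (fun j => (c j)⁻¹ • ℓ' j) X = conjBy ℓ ℓ' X := by
  have : ∏ j, c j ≠ 0 := Finset.prod_ne_zero_iff.2 fun j _ => hc j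
  rw [conjBy, mono_smul, comono_smul, Finset.prod_inv_distrib, smul_mul_assoc, mul_smul_comm,
    smul_mul_assoc, smul_smul, mul_inv_cancel₀ this, one_smul, conjBy]

/-- The first site is outermost in T⁻¹ and in T, so its factors enclose the conjugation on the
remaining sites and do not cancel. -/
lemma conjBy_leftId (ℓ ℓ' : Fin (n + 1) → Matrix (Fin 2) (Fin 2) 𝒜) (X : SpinOp n)
    (s t : Conf (n + 1)) :
    conjBy ℓ ℓ' (leftId X) s t = ∑ c, ℓ' 0 (s 0) c *
      conjBy (fun j => ℓ j.succ) (fun j => ℓ' j.succ) X (fun i => s i.succ) (fun i => t i.succ) *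
      ℓ 0 c (t 0) := by
  simp only [conjBy_apply]
  rw [sum_conf_succ]
  refine Finset.sum_congr rfl fun c _ => ?_
  rw [Finset.mul_sum, Finset.sum_mul]
  refine Finset.sum_congr rfl fun u _ => ?_
  rw [sum_conf_succ, Finset.sum_eq_single c]
  · rw [Finset.mul_sum, Finset.sum_mul]
    refine Finset.sum_congr rfl fun v _ => ?_
    simp [leftId, mono_succ, comono_succ, mul_assoc]
  · intro d _ hd
    simp [leftId, hd.symm]
  · simp

/-- The factors of the last site are adjacent to X ⊗ I on both sides, commute past X, and cancel. -/
lemma conjBy_rightId (ℓ ℓ' : Fin (n + 1) → Matrix (Fin 2) (Fin 2) 𝒜)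
    (h : ℓ' (Fin.last n) * ℓ (Fin.last n) = 1) (X : SpinOp n) (s t : Conf (n + 1)) :
    conjBy ℓ ℓ' (rightId X) s t = if s (Fin.last n) = t (Fin.last n) then
      conjBy (fun j => ℓ j.castSucc) (fun j => ℓ' j.castSucc) X (fun i => s i.castSucc)
        (fun i => t i.castSucc) else 0 := by
  simp only [conjBy_apply]
  rw [sum_conf_last, Finset.sum_comm]
  have h0 := congrFun (congrFun h (s (Fin.last n))) (t (Fin.last n))
  rw [Matrix.mul_apply, Matrix.one_apply] at h0
  trans ∑ u, ∑ v, X u v • (comono (fun j => ℓ' j.castSucc) (fun i => s i.castSucc) u *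
    (∑ c, ℓ' (Fin.last n) (s (Fin.last n)) c * ℓ (Fin.last n) c (t (Fin.last n))) *
    mono (fun j => ℓ j.castSucc) v (fun i => t i.castSucc))
  · refine Finset.sum_congr rfl fun u _ => ?_
    simp only [Finset.mul_sum, Finset.sum_mul, Finset.smul_sum]
    conv_rhs => rw [Finset.sum_comm]
    refine Finset.sum_congr rfl fun c _ => ?_
    rw [sum_conf_last, Finset.sum_eq_single c]
    · refine Finset.sum_congr rfl fun v _ => ?_
      simp [rightId, mono_last, comono_last, mul_assoc]
    · intro d _ hd
      simp [rightId, hd.symm]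
    · simp
  · rw [h0]
    split_ifs <;> simp

end Algebra

end Products

/-! ### The q-oscillator algebra on Fock space, graded by degree and by exponents of q^k. -/

section Oscillator

variable {q : ℂ}

@[simp]
lemma qD_single (m : ℤ) (k : ℕ) (c : ℂ) :
    qD q m (Finsupp.single k c) = Finsupp.single k (c * q ^ (m * (k : ℤ))) := by
  simp [qD]

@[simp]
lemma creation_single (k : ℕ) (c : ℂ) :
    creation (Finsupp.single k c) = Finsupp.single (k + 1) c := by
  simp [creation]

@[simp]
lemma annihilation_single (k : ℕ) (c : ℂ) :
    annihilation q (Finsupp.single k c) = Finsupp.single (k - 1) (c * (1 - q ^ (2 * k))) := by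
  rw [annihilation, Finsupp.linearCombination_single, Finsupp.smul_single, smul_eq_mul]

lemma qD_zero : qD q 0 = 1 := by
  ext k : 2
  simp

lemma qD_mul_qD (hq : q ≠ 0) (m m' : ℤ) : qD q m * qD q m' = qD q (m + m') := by
  ext k : 2
  simp [add_mul, zpow_add₀ hq, mul_comm]

lemma qD_mul_creation (hq : q ≠ 0) (m : ℤ) :
    qD q m * creation = q ^ m • (creation * qD q m) := by
  ext k : 2
  simp [mul_add, zpow_add₀ hq, mul_comm]

lemma qD_mul_annihilation (hq : q ≠ 0) (m : ℤ) :
    qD q m * annihilation q = q ^ (-m) • (annihilation q * qD q m) := by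
  ext k : 2
  rcases k with _ | k
  · simp
  · simp only [LinearMap.comp_apply, Finsupp.lsingle_apply, Module.End.mul_apply, qD_single,
      annihilation_single, LinearMap.smul_apply, Finsupp.smul_single, Nat.add_sub_cancel]
    congr 1
    push_cast
    rw [mul_add m, zpow_add₀ hq, zpow_neg, mul_one, smul_eq_mul]
    field_simp

lemma annihilation_mul_creation :
    annihilation q * creation = qD q 0 + (-q ^ 2) • qD q 2 := by
  ext k : 2
  simp only [LinearMap.comp_apply, Finsupp.lsingle_apply, Module.End.mul_apply, qD_single,
    annihilation_single, creation_single, LinearMap.smul_apply, Finsupp.smul_single,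
    Nat.add_sub_cancel, LinearMap.add_apply, ← Finsupp.single_add]
  congr 1
  rw [mul_add, pow_add, smul_eq_mul]
  norm_cast
  ring

lemma creation_mul_annihilation :
    creation * annihilation q = qD q 0 + (-1 : ℂ) • qD q 2 := by
  ext k : 2
  rcases k with _ | k
  · simp
  · simp only [LinearMap.comp_apply, Finsupp.lsingle_apply, Module.End.mul_apply, qD_single,
      annihilation_single, creation_single, Nat.add_sub_cancel, LinearMap.smul_apply,
      Finsupp.smul_single, LinearMap.add_apply, ← Finsupp.single_add]
    congr 1
    have h : q ^ ((2 : ℤ) * ((k + 1 : ℕ) : ℤ)) = q ^ (2 * (k + 1)) := by norm_cast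
    rw [h]
    simp
    ring

/-- Functions of `k` that are spanned by `q^{mk}` with `m ≥ p`. -/
def expSpan (q : ℂ) (p : ℤ) : Submodule ℂ (ℤ → ℂ) :=
  Submodule.span ℂ {f | ∃ m, p ≤ m ∧ f = fun k => q ^ (m * k)}

lemma exp_mem_expSpan {p m : ℤ} (h : p ≤ m) : (fun k => q ^ (m * k)) ∈ expSpan q p :=
  Submodule.subset_span ⟨m, h, rfl⟩

lemma expSpan_anti {p p' : ℤ} (h : p' ≤ p) : expSpan q p ≤ expSpan q p' :=
  Submodule.span_mono fun _ ⟨m, hm, hf⟩ => ⟨m, h.trans hm, hf⟩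

lemma expSpan_mul (hq : q ≠ 0) {p p' : ℤ} {f g : ℤ → ℂ} (hf : f ∈ expSpan q p)
    (hg : g ∈ expSpan q p') : f * g ∈ expSpan q (p + p') := by
  induction hf, hg using Submodule.span_induction₂ with
  | mem_mem f g hf hg =>
    obtain ⟨m, hm, rfl⟩ := hf
    obtain ⟨m', hm', rfl⟩ := hg
    refine Submodule.subset_span ⟨m + m', by omega, ?_⟩
    funext k
    simp [add_mul, zpow_add₀ hq]
  | zero_left g hg => simp
  | zero_right g hg => simp
  | add_left f f' g _ _ _ h h' => rw [add_mul]; exact add_mem h h'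
  | add_right f f' g _ _ _ h h' => rw [mul_add]; exact add_mem h h'
  | smul_left c f g _ _ h => rw [smul_mul_assoc]; exact Submodule.smul_mem _ _ h
  | smul_right c f g _ _ h => rw [mul_smul_comm]; exact Submodule.smul_mem _ _ h

lemma expSpan_shift (hq : q ≠ 0) {p : ℤ} {f : ℤ → ℂ} (hf : f ∈ expSpan q p) (d : ℤ) :
    (fun k => f (k + d)) ∈ expSpan q p := by
  induction hf using Submodule.span_induction with
  | mem f hf =>
    obtain ⟨m, hm, rfl⟩ := hf
    have := Submodule.smul_mem (expSpan q p) (q ^ (m * d)) (exp_mem_expSpan hm)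
    convert this using 1
    funext k
    simp [mul_add, zpow_add₀ hq, mul_comm]
  | zero => exact zero_mem _
  | add f g _ _ h h' => exact add_mem h h'
  | smul c f _ h => exact Submodule.smul_mem _ c h

/-- Operators `|k⟩ ↦ f(k) |k + d⟩`, where `f` is spanned by `q^{mk}` with `m ≥ p`. -/
def homOp (q : ℂ) (d p : ℤ) : Submodule ℂ (Module.End ℂ Fock) where
  carrier := {x | ∃ f ∈ expSpan q p, ∀ k : ℕ,
    (∀ l : ℕ, (l : ℤ) = k + d → x (Finsupp.single k 1) = f k • Finsupp.single l 1) ∧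
    ((k : ℤ) + d < 0 → f k = 0 ∧ x (Finsupp.single k 1) = 0)}
  zero_mem' := ⟨0, zero_mem _, by simp⟩
  add_mem' := by
    rintro x y ⟨f, hf, hx⟩ ⟨g, hg, hy⟩
    refine ⟨f + g, add_mem hf hg, fun k => ⟨fun l hl => ?_, fun hk => ?_⟩⟩
    · rw [LinearMap.add_apply, (hx k).1 l hl, (hy k).1 l hl, Pi.add_apply, add_smul]
    · simp [(hx k).2 hk, (hy k).2 hk]
  smul_mem' := by
    rintro c x ⟨f, hf, hx⟩
    refine ⟨c • f, Submodule.smul_mem _ _ hf, fun k => ⟨fun l hl => ?_, fun hk => ?_⟩⟩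
    · rw [LinearMap.smul_apply, (hx k).1 l hl, Pi.smul_apply, smul_assoc]
    · simp [(hx k).2 hk]

lemma homOp_anti {d p p' : ℤ} (h : p' ≤ p) : homOp q d p ≤ homOp q d p' :=
  fun _ ⟨f, hf, hx⟩ => ⟨f, expSpan_anti h hf, hx⟩

lemma homOp_mul (hq : q ≠ 0) {d p e r : ℤ} {x y : Module.End ℂ Fock} (hx : x ∈ homOp q d p)
    (hy : y ∈ homOp q e r) : x * y ∈ homOp q (d + e) (p + r) := by
  obtain ⟨f, hf, hx⟩ := hx
  obtain ⟨g, hg, hy⟩ := hy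
  refine ⟨_, expSpan_mul hq (expSpan_shift hq hf e) hg, fun k => ?_⟩
  -- Below the vacuum the coefficient of y vanishes, so the product formula still holds although k +
  -- e is not a state.
  rcases lt_or_ge ((k : ℤ) + e) 0 with h | h
  · obtain ⟨h1, h2⟩ := (hy k).2 h
    simp [h1, h2]
  · obtain ⟨l, hl⟩ := Int.eq_ofNat_of_zero_le h
    have h1 := (hy k).1 l hl.symm
    simp only [Module.End.mul_apply, h1, map_smul, Pi.mul_apply, hl]
    refine ⟨fun j hj => ?_, fun hj => ?_⟩
    · rw [(hx l).1 j (by simpa [← hl, add_assoc, add_comm] using hj), smul_smul, mul_comm]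
    · obtain ⟨h2, h3⟩ := (hx l).2 (by omega)
      simp only [h2, h3]
      simp

lemma qD_mem_homOp (m : ℤ) : qD q m ∈ homOp q 0 m := by
  refine ⟨_, exp_mem_expSpan le_rfl, fun k => ⟨fun l hl => ?_, fun hk => by omega⟩⟩
  obtain rfl : l = k := by omega
  simp

lemma one_mem_homOp : (1 : Module.End ℂ Fock) ∈ homOp q 0 0 := by
  rw [← qD_zero (q := q)]
  exact qD_mem_homOp 0

lemma creation_mem_homOp : creation ∈ homOp q 1 0 := by
  refine ⟨_, exp_mem_expSpan le_rfl, fun k => ⟨fun l hl => ?_, fun hk => by omega⟩⟩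
  obtain rfl : l = k + 1 := by omega
  simp

lemma annihilation_mem_homOp : annihilation q ∈ homOp q (-1) 0 := by
  refine ⟨(fun k => q ^ ((0 : ℤ) * k)) - fun k => q ^ ((2 : ℤ) * k),
    sub_mem (exp_mem_expSpan le_rfl) (exp_mem_expSpan (by norm_num)),
    fun k => ⟨fun l hl => ?_, fun hk => ?_⟩⟩
  · obtain rfl : k = l + 1 := by omega
    simp
    norm_cast
  · obtain rfl : k = 0 := by omega
    simp

lemma diagElem_of_mem_homOp_zero {p : ℤ} {x : Module.End ℂ Fock} (hx : x ∈ homOp q 0 p) :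
    ∃ f ∈ expSpan q p, diagElem x = fun k : ℕ => f k := by
  obtain ⟨f, hf, hx⟩ := hx
  refine ⟨f, hf, funext fun k => ?_⟩
  rw [diagElem, (hx k).1 k (by simp)]
  simp

lemma diagElem_of_mem_homOp_ne_zero {d p : ℤ} (hd : d ≠ 0) {x : Module.End ℂ Fock}
    (hx : x ∈ homOp q d p) : diagElem x = 0 := by
  obtain ⟨f, hf, hx⟩ := hx
  funext k
  rw [diagElem]
  rcases lt_or_ge ((k : ℤ) + d) 0 with h | h
  · simp [((hx k).2 h).2]
  · obtain ⟨l, hl⟩ := Int.eq_ofNat_of_zero_le h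
    have : l ≠ k := by omega
    rw [(hx k).1 l hl.symm]
    simp [this]

/-- Both orders have the same diagonal up to a shift of k. No boundary term appears at the vacuum,
because coefficients leading below it are required to vanish. -/
lemma diagElem_mul_swap (hq : q ≠ 0) {d p r : ℤ} {x y : Module.End ℂ Fock} (hx : x ∈ homOp q d p)
    (hy : y ∈ homOp q (-d) r) : ∃ f ∈ expSpan q (p + r),
      (diagElem (y * x) = fun k : ℕ => f k) ∧ diagElem (x * y) = fun k : ℕ => f (k + -d) := by
  obtain ⟨f, hf, hx⟩ := hx
  obtain ⟨g, hg, hy⟩ := hy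
  have key : ∀ {d : ℤ} {f g : ℤ → ℂ} {x y : Module.End ℂ Fock},
      (∀ k : ℕ, (∀ l : ℕ, (l : ℤ) = k + d → x (Finsupp.single k 1) = f k • Finsupp.single l 1) ∧
        ((k : ℤ) + d < 0 → f k = 0 ∧ x (Finsupp.single k 1) = 0)) →
      (∀ k : ℕ, (∀ l : ℕ, (l : ℤ) = k + -d → y (Finsupp.single k 1) = g k • Finsupp.single l 1) ∧
        ((k : ℤ) + -d < 0 → g k = 0 ∧ y (Finsupp.single k 1) = 0)) →
      ∀ k : ℕ, diagElem (y * x) k = f k * g (k + d) := by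
    intro d f g x y hx hy k
    rw [diagElem]
    rcases lt_or_ge ((k : ℤ) + d) 0 with h | h
    · simp [((hx k).2 h).2, ((hx k).2 h).1]
    · obtain ⟨l, hl⟩ := Int.eq_ofNat_of_zero_le h
      rw [Module.End.mul_apply, (hx k).1 l hl.symm, map_smul, (hy l).1 k (by omega), hl]
      simp
  refine ⟨_, expSpan_mul hq hf (expSpan_shift hq hg d), funext (key hx hy), funext fun k => ?_⟩
  rw [key (d := -d) hy (by simpa using hx)]
  simp [mul_comm]

/-- The algebra of the operators spanned by the homogeneous ones. -/
def bandOps (q : ℂ) : Submodule ℂ (Module.End ℂ Fock) := ⨆ i : ℤ × ℤ, homOp q i.1 i.2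

lemma mem_bandOps {d p : ℤ} {x : Module.End ℂ Fock} (hx : x ∈ homOp q d p) : x ∈ bandOps q :=
  Submodule.mem_iSup_of_mem (p := fun i : ℤ × ℤ => homOp q i.1 i.2) (d, p) hx

/-- Membership is carried along in the additive step, where linearity of the trace functional
requires both summands to be traceable. -/
lemma bandOps_induction {P : Module.End ℂ Fock → Prop} {x : Module.End ℂ Fock} (hx : x ∈ bandOps q)
    (mem : ∀ d p x, x ∈ homOp q d p → P x)
    (add : ∀ x y, x ∈ bandOps q → y ∈ bandOps q → P x → P y → P (x + y)) : P x := by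
  have : x ∈ bandOps q ∧ P x := by
    refine Submodule.iSup_induction (fun i : ℤ × ℤ => homOp q i.1 i.2)
      (motive := fun x => x ∈ bandOps q ∧ P x) hx
      (fun i x hx => ⟨mem_bandOps hx, mem _ _ _ hx⟩)
      ⟨zero_mem _, mem 0 0 0 (zero_mem _)⟩ ?_
    exact fun x y hx hy => ⟨add_mem hx.1 hy.1, add _ _ hx.1 hy.1 hx.2 hy.2⟩
  exact this.2

lemma bandOps_mul (hq : q ≠ 0) {x y : Module.End ℂ Fock} (hx : x ∈ bandOps q)
    (hy : y ∈ bandOps q) : x * y ∈ bandOps q := by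
  refine bandOps_induction (P := fun x => x * y ∈ bandOps q) hx (fun d p x hx => ?_)
    fun x x' _ _ h h' => ?_
  · refine bandOps_induction (P := fun y => x * y ∈ bandOps q) hy (fun e r y hy => mem_bandOps
    (homOp_mul hq hx hy))
      fun y y' _ _ h h' => ?_
    rw [mul_add]; exact add_mem h h'
  · rw [add_mul]; exact add_mem h h'

end Oscillator

/-! ### Rational continuation of generating functions. -/

section ContinuedSum

lemma HasContinuedSum.continuedSum_eq {f : ℕ → ℂ} {z v : ℂ} (h : HasContinuedSum f z v) :
    continuedSum f z = v := by
  have h' : ∃ v, HasContinuedSum f z v := ⟨v, h⟩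
  rw [continuedSum, dif_pos h']
  exact h'.choose_spec.unique h

lemma HasContinuedSum.zero (z : ℂ) : HasContinuedSum 0 z 0 :=
  ⟨0, 1, by simp, by ext; simp, by simp⟩

lemma HasContinuedSum.add {f g : ℕ → ℂ} {z v w : ℂ} (hf : HasContinuedSum f z v)
    (hg : HasContinuedSum g z w) : HasContinuedSum (f + g) z (v + w) := by
  obtain ⟨p, r, hr, h, rfl⟩ := hf
  obtain ⟨p', r', hr', h', rfl⟩ := hg
  refine ⟨p * r' + p' * r, r * r', by simp [hr, hr'], ?_, ?_⟩
  · have : PowerSeries.mk (f + g) = PowerSeries.mk f + PowerSeries.mk g := by ext; simp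
    rw [this, Polynomial.coe_add, Polynomial.coe_mul, Polynomial.coe_mul, Polynomial.coe_mul,
      ← h, ← h']
    ring
  · rw [div_add_div _ _ hr hr']
    simp [mul_comm]

lemma HasContinuedSum.smul {f : ℕ → ℂ} {z v : ℂ} (c : ℂ) (hf : HasContinuedSum f z v) :
    HasContinuedSum (c • f) z (c * v) := by
  obtain ⟨p, r, hr, h, rfl⟩ := hf
  refine ⟨Polynomial.C c * p, r, hr, ?_, by simp [mul_div_assoc]⟩
  have : PowerSeries.mk (c • f) = PowerSeries.C c * PowerSeries.mk f := by ext; simp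
  rw [this, Polynomial.coe_mul, ← h, Polynomial.coe_C]
  ring

/-- Shifting the sequence multiplies its generating function by the variable; this is the source of
the factor q^{2α} in twisted cyclicity. -/
lemma HasContinuedSum.of_succ {f g : ℕ → ℂ} {z v : ℂ} (h0 : f 0 = 0) (h : ∀ k, f (k + 1) = g k)
    (hg : HasContinuedSum g z v) : HasContinuedSum f z (z * v) := by
  obtain ⟨p, r, hr, hp, rfl⟩ := hg
  refine ⟨Polynomial.X * p, r, hr, ?_, by simp [mul_div_assoc]⟩
  have : PowerSeries.mk f = PowerSeries.X * PowerSeries.mk g := by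
    ext k
    rcases k with _ | k
    · simp [h0]
    · simp [h, PowerSeries.coeff_succ_X_mul]
  rw [this, Polynomial.coe_mul, ← hp, Polynomial.coe_X]
  ring

lemma hasContinuedSum_geometric (c u z : ℂ) (h : 1 - u * z ≠ 0) :
    HasContinuedSum (fun k => c * u ^ k) z (c / (1 - u * z)) := by
  refine ⟨Polynomial.C c, 1 - Polynomial.C u * Polynomial.X, by simpa using h, ?_, by simp⟩
  have : PowerSeries.mk (fun k => c * u ^ k) = PowerSeries.C c * PowerSeries.mk fun k => u ^ k := by
    ext; simp
  rw [this]
  ext k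
  rcases k with _ | k
  · simp [sub_mul, mul_assoc]
  · simp only [Polynomial.coe_sub, Polynomial.coe_one, Polynomial.coe_mul, Polynomial.coe_C,
      Polynomial.coe_X, sub_mul, one_mul, map_sub, mul_assoc, PowerSeries.coeff_C_mul,
      PowerSeries.coeff_succ_X_mul, PowerSeries.coeff_mk, PowerSeries.coeff_C]
    simp
    ring

end ContinuedSum

/-! ### The polar part of the twisted trace at α = 0, and twisted cyclicity. -/

section Tau

/-- The functions of `α` whose behaviour at `α → 0` is that of a continued sum with at most a
simple pole: `(1 - q^{2α}) ∑_k q^{2αk} F(k) → c`. -/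
def HasTau (η : ℂ) (F : ℕ → ℂ) (c : ℂ) : Prop :=
  (∀ᶠ α in 𝓝[≠] (0 : ℂ), ∃ v, HasContinuedSum F (Complex.exp (2 * α * η)) v) ∧
  Tendsto (fun α => (1 - Complex.exp (2 * α * η)) * continuedSum F (Complex.exp (2 * α * η)))
    (𝓝[≠] 0) (𝓝 c)

/-- The coefficient of `(1 - q^{2α})⁻¹` in the trace of `q^{2αD} x` at `α = 0`. -/
def tau (η : ℂ) (x : Module.End ℂ Fock) : ℂ :=
  limUnder (𝓝[≠] (0 : ℂ)) fun α => (1 - Complex.exp (2 * α * η)) * weightedTrace η α x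

variable {η : ℂ}

lemma HasTau.tau_eq {x : Module.End ℂ Fock} {c : ℂ} (h : HasTau η (diagElem x) c) :
    tau η x = c :=
  h.2.limUnder_eq

lemma HasTau.zero : HasTau η 0 0 := by
  refine ⟨Eventually.of_forall fun α => ⟨0, .zero _⟩, ?_⟩
  simp [(HasContinuedSum.zero _).continuedSum_eq]

lemma HasTau.add {F G : ℕ → ℂ} {c d : ℂ} (hF : HasTau η F c) (hG : HasTau η G d) :
    HasTau η (F + G) (c + d) := by
  refine ⟨?_, (hF.2.add hG.2).congr' ?_⟩
  · filter_upwards [hF.1, hG.1] with α ⟨v, hv⟩ ⟨w, hw⟩ using ⟨_, hv.add hw⟩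
  · filter_upwards [hF.1, hG.1] with α ⟨v, hv⟩ ⟨w, hw⟩
    rw [(hv.add hw).continuedSum_eq, hv.continuedSum_eq, hw.continuedSum_eq, mul_add]

lemma HasTau.smul {F : ℕ → ℂ} {c : ℂ} (a : ℂ) (hF : HasTau η F c) :
    HasTau η (a • F) (a * c) := by
  refine ⟨?_, (hF.2.const_mul a).congr' ?_⟩
  · filter_upwards [hF.1] with α ⟨v, hv⟩ using ⟨_, hv.smul a⟩
  · filter_upwards [hF.1] with α ⟨v, hv⟩
    rw [(hv.smul a).continuedSum_eq, hv.continuedSum_eq]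
    ring

/-- `q = e^η` is not a root of unity. -/
abbrev NotRootOfUnity (η : ℂ) : Prop := ∀ m : ℕ, 0 < m → Complex.exp η ^ m ≠ 1

lemma exp_zpow_ne_one (hη : NotRootOfUnity η) {m : ℤ} (hm : m ≠ 0) : Complex.exp η ^ m ≠ 1 := by
  rcases m with m | m
  · exact mod_cast hη m (by simp only [Int.ofNat_eq_natCast] at hm; omega)
  · rw [zpow_negSucc, ne_eq, inv_eq_one]
    exact hη _ (Nat.succ_pos m)

lemma eventually_exp_ne_one (hη : NotRootOfUnity η) :
    ∀ᶠ α in 𝓝[≠] (0 : ℂ), Complex.exp (2 * α * η) ≠ 1 := by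
  have h0 : η ≠ 0 := by
    rintro rfl
    exact hη 1 one_pos (by simp)
  have : HasDerivAt (fun α : ℂ => Complex.exp (2 * α * η)) (2 * η) 0 := by
    have h : HasDerivAt (fun α : ℂ => 2 * α * η) (2 * 1 * η) 0 :=
      ((hasDerivAt_id (0 : ℂ)).const_mul 2).mul_const η
    simpa using h.cexp
  exact this.eventually_ne (by simpa using h0)

lemma tendsto_exp_nhds_one :
    Tendsto (fun α : ℂ => Complex.exp (2 * α * η)) (𝓝[≠] 0) (𝓝 1) := by
  have : ContinuousAt (fun α : ℂ => Complex.exp (2 * α * η)) 0 := by fun_prop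
  simpa using this.tendsto.mono_left nhdsWithin_le_nhds

/-- The sum is geometric, q^{md} / (1 - q^m z). Because q is not a root of unity, it has a pole at z
= 1 only for m = 0, where its numerator is 1. The limit is therefore independent of the shift d. -/
lemma hasTau_exp (hη : NotRootOfUnity η) (m d : ℤ) :
    HasTau η (fun k : ℕ => Complex.exp η ^ (m * ((k : ℤ) + d))) (if m = 0 then 1 else 0) := by
  set q := Complex.exp η with hq
  have hq0 : q ≠ 0 := Complex.exp_ne_zero η
  have hF : (fun k : ℕ => q ^ (m * ((k : ℤ) + d))) = fun k : ℕ => q ^ (m * d) * (q ^ m) ^ k := by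
    funext k
    rw [mul_add, zpow_add₀ hq0, mul_comm, zpow_mul q m k, zpow_natCast]
  have hne : ∀ᶠ α in 𝓝[≠] (0 : ℂ), 1 - q ^ m * Complex.exp (2 * α * η) ≠ 0 := by
    by_cases hm : m = 0
    · filter_upwards [eventually_exp_ne_one hη] with α hα
      simpa [hm, sub_eq_zero] using hα.symm
    · have := (tendsto_exp_nhds_one (η := η)).const_mul (q ^ m) |>.const_sub 1
      refine this.eventually_ne ?_
      rw [mul_one, sub_ne_zero]
      exact (exp_zpow_ne_one hη hm).symm
  have hcs : ∀ᶠ α in 𝓝[≠] (0 : ℂ), HasContinuedSum (fun k : ℕ => q ^ (m * ((k : ℤ) + d)))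
      (Complex.exp (2 * α * η)) (q ^ (m * d) / (1 - q ^ m * Complex.exp (2 * α * η))) := by
    filter_upwards [hne] with α hα
    rw [hF]
    exact hasContinuedSum_geometric _ _ _ hα
  refine ⟨hcs.mono fun α h => ⟨_, h⟩, ?_⟩
  have hlim : Tendsto (fun α : ℂ => (1 - Complex.exp (2 * α * η)) *
      (q ^ (m * d) / (1 - q ^ m * Complex.exp (2 * α * η)))) (𝓝[≠] 0)
      (𝓝 (if m = 0 then 1 else 0)) := by
    split_ifs with hm
    · refine (tendsto_const_nhds (x := (1 : ℂ))).congr' ?_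
      filter_upwards [hne] with α hα
      rw [hm] at hα ⊢
      simp only [zpow_zero, one_mul, zero_mul] at hα ⊢
      rw [mul_one_div_cancel hα]
    · have h1 := (tendsto_exp_nhds_one (η := η)).const_sub 1
      have h2 := (tendsto_exp_nhds_one (η := η)).const_mul (q ^ m) |>.const_sub 1
      have h3 := h1.mul ((tendsto_const_nhds (x := q ^ (m * d))).div h2 (by
        rw [mul_one, sub_ne_zero]
        exact (exp_zpow_ne_one hη hm).symm))
      simpa using h3
  refine hlim.congr' ?_
  filter_upwards [hcs] with α hα
  rw [hα.continuedSum_eq]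

/-- One constant serves all shifts, which gives cyclicity of `tau`; it vanishes when only positive
exponents occur, which gives the selection rule by weight. -/
lemma exists_hasTau_of_mem_expSpan (hη : NotRootOfUnity η) {p : ℤ} {f : ℤ → ℂ}
    (hf : f ∈ expSpan (Complex.exp η) p) :
    ∃ c, (0 < p → c = 0) ∧ ∀ d : ℤ, HasTau η (fun k : ℕ => f (k + d)) c := by
  induction hf using Submodule.span_induction with
  | mem f hf =>
    obtain ⟨m, hm, rfl⟩ := hf
    exact ⟨_, fun hp => if_neg (by omega), fun d => hasTau_exp hη m d⟩
  | zero => exact ⟨0, fun _ => rfl, fun d => .zero⟩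
  | add f g _ _ h h' =>
    obtain ⟨c, hc, h⟩ := h
    obtain ⟨c', hc', h'⟩ := h'
    exact ⟨c + c', fun hp => by rw [hc hp, hc' hp, add_zero], fun d => (h d).add (h' d)⟩
  | smul a f _ h =>
    obtain ⟨c, hc, h⟩ := h
    exact ⟨a * c, fun hp => by rw [hc hp, mul_zero], fun d => (h d).smul a⟩

lemma hasTau_of_mem_bandOps (hη : NotRootOfUnity η) {x : Module.End ℂ Fock}
    (hx : x ∈ bandOps (Complex.exp η)) :
    HasTau η (diagElem x) (tau η x) := by
  suffices h : ∃ c, HasTau η (diagElem x) c by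
    obtain ⟨c, hc⟩ := h
    rwa [hc.tau_eq]
  refine bandOps_induction (P := fun x => ∃ c, HasTau η (diagElem x) c) hx
    (fun d p x hx => ?_) fun x y _ _ h h' => ?_
  · by_cases hd : d = 0
    · subst hd
      obtain ⟨f, hf, h⟩ := diagElem_of_mem_homOp_zero hx
      obtain ⟨c, -, hc⟩ := exists_hasTau_of_mem_expSpan hη hf
      refine ⟨c, ?_⟩
      rw [h]
      simpa using hc 0
    · rw [diagElem_of_mem_homOp_ne_zero hd hx]
      exact ⟨0, .zero⟩
  · obtain ⟨c, hc⟩ := h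
    obtain ⟨d, hd⟩ := h'
    exact ⟨c + d, hc.add hd⟩

lemma tau_add (hη : NotRootOfUnity η) {x y : Module.End ℂ Fock} (hx : x ∈ bandOps (Complex.exp η))
    (hy : y ∈ bandOps (Complex.exp η)) : tau η (x + y) = tau η x + tau η y :=
  HasTau.tau_eq ((hasTau_of_mem_bandOps hη hx).add (hasTau_of_mem_bandOps hη hy))

lemma tau_smul (hη : NotRootOfUnity η) (a : ℂ) {x : Module.End ℂ Fock}
    (hx : x ∈ bandOps (Complex.exp η)) :
    tau η (a • x) = a * tau η x :=
  HasTau.tau_eq ((hasTau_of_mem_bandOps hη hx).smul a)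

lemma tau_zero : tau η 0 = 0 :=
  HasTau.tau_eq HasTau.zero

lemma tau_sum (hη : NotRootOfUnity η) {ι : Type*} (s : Finset ι) (x : ι → Module.End ℂ Fock)
    (hx : ∀ i ∈ s, x i ∈ bandOps (Complex.exp η)) :
    tau η (∑ i ∈ s, x i) = ∑ i ∈ s, tau η (x i) := by
  classical
  induction s using Finset.induction_on with
  | empty => simp [tau_zero]
  | insert i s hi ih =>
    have h := fun j hj => hx j (Finset.mem_insert_of_mem hj)
    rw [Finset.sum_insert hi, Finset.sum_insert hi,
      tau_add hη (hx i (Finset.mem_insert_self _ _)) (Submodule.sum_mem _ h), ih h]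

/-- An operator of nonzero degree has zero diagonal; one of degree zero with positive exponents has
no constant term. -/
lemma tau_of_mem_homOp (hη : NotRootOfUnity η) {d p : ℤ} (h : d = 0 → 0 < p) {x : Module.End ℂ Fock}
    (hx : x ∈ homOp (Complex.exp η) d p) : tau η x = 0 := by
  apply HasTau.tau_eq
  by_cases hd : d = 0
  · subst hd
    obtain ⟨f, hf, hfx⟩ := diagElem_of_mem_homOp_zero hx
    obtain ⟨c, hc0, hc⟩ := exists_hasTau_of_mem_expSpan hη hf
    rw [hfx, ← hc0 (h rfl)]
    simpa using hc 0
  · rw [diagElem_of_mem_homOp_ne_zero hd hx]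
    exact .zero

/-- For homogeneous factors of opposite degrees the two diagonals differ by a shift of k, to which
`tau` is blind. For any other degrees both sides vanish. -/
lemma tau_mul_comm (hη : NotRootOfUnity η) {x y : Module.End ℂ Fock}
    (hx : x ∈ bandOps (Complex.exp η))
    (hy : y ∈ bandOps (Complex.exp η)) : tau η (x * y) = tau η (y * x) := by
  have hq := Complex.exp_ne_zero η
  refine bandOps_induction (P := fun x => tau η (x * y) = tau η (y * x)) hx (fun d p x hx => ?_)
    fun x x' hx hx' h h' => ?_
  · refine bandOps_induction (P := fun y => tau η (x * y) = tau η (y * x)) hy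
      (fun e r y hy => ?_) fun y y' hy hy' h h' => ?_
    · by_cases he : e = -d
      · subst he
        obtain ⟨f, hf, h1, h2⟩ := diagElem_mul_swap hq hx hy
        obtain ⟨c, -, hc⟩ := exists_hasTau_of_mem_expSpan hη hf
        rw [HasTau.tau_eq (c := c) (h2 ▸ hc _), HasTau.tau_eq (c := c)]
        rw [h1]
        simpa using hc 0
      · rw [tau_of_mem_homOp hη (by omega) (homOp_mul hq hx hy),
          tau_of_mem_homOp hη (by omega) (homOp_mul hq hy hx)]
    · have hx := mem_bandOps hx
      rw [mul_add, add_mul, tau_add hη (bandOps_mul hq hx hy) (bandOps_mul hq hx hy'),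
        tau_add hη (bandOps_mul hq hy hx) (bandOps_mul hq hy' hx), h, h']
  · rw [mul_add, add_mul, tau_add hη (bandOps_mul hq hx hy) (bandOps_mul hq hx' hy),
      tau_add hη (bandOps_mul hq hy hx) (bandOps_mul hq hy hx'), h, h']

/-- The trace of `q^{2αD} x` exists. -/
def Traceable (η α : ℂ) : Submodule ℂ (Module.End ℂ Fock) where
  carrier := {x | ∃ v, HasContinuedSum (diagElem x) (Complex.exp (2 * α * η)) v}
  zero_mem' := ⟨0, .zero _⟩
  add_mem' := fun ⟨_, hv⟩ ⟨_, hw⟩ => ⟨_, hv.add hw⟩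
  smul_mem' := fun c _ ⟨_, hv⟩ => ⟨_, hv.smul c⟩

lemma weightedTrace_add {α : ℂ} {x y : Module.End ℂ Fock} (hx : x ∈ Traceable η α)
    (hy : y ∈ Traceable η α) :
    weightedTrace η α (x + y) = weightedTrace η α x + weightedTrace η α y := by
  obtain ⟨v, hv⟩ := hx
  obtain ⟨w, hw⟩ := hy
  rw [weightedTrace, weightedTrace, weightedTrace, hv.continuedSum_eq, hw.continuedSum_eq]
  exact (hv.add hw).continuedSum_eq

lemma weightedTrace_smul {α : ℂ} (c : ℂ) {x : Module.End ℂ Fock} (hx : x ∈ Traceable η α) :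
    weightedTrace η α (c • x) = c * weightedTrace η α x := by
  obtain ⟨v, hv⟩ := hx
  rw [weightedTrace, weightedTrace, hv.continuedSum_eq]
  exact (hv.smul c).continuedSum_eq

lemma weightedTrace_sum {α : ℂ} {ι : Type*} (s : Finset ι) (x : ι → Module.End ℂ Fock)
    (hx : ∀ i ∈ s, x i ∈ Traceable η α) :
    weightedTrace η α (∑ i ∈ s, x i) = ∑ i ∈ s, weightedTrace η α (x i) := by
  classical
  induction s using Finset.induction_on with
  | empty => exact (HasContinuedSum.zero _).continuedSum_eq
  | insert i s hi ih =>
    have h := fun j hj => hx j (Finset.mem_insert_of_mem hj)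
    rw [Finset.sum_insert hi, Finset.sum_insert hi,
      weightedTrace_add (hx i (Finset.mem_insert_self _ _)) (Submodule.sum_mem _ h), ih h]

lemma eventually_traceable (hη : NotRootOfUnity η) {x : Module.End ℂ Fock}
    (hx : x ∈ bandOps (Complex.exp η)) :
    ∀ᶠ α in 𝓝[≠] (0 : ℂ), x ∈ Traceable η α :=
  (hasTau_of_mem_bandOps hη hx).1

lemma tendsto_weightedTrace (hη : NotRootOfUnity η) {x : Module.End ℂ Fock}
    (hx : x ∈ bandOps (Complex.exp η)) :
    Tendsto (fun α => (Complex.exp (2 * α * η) - 1) * weightedTrace η α x) (𝓝[≠] 0)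
      (𝓝 (-tau η x)) := by
  refine (hasTau_of_mem_bandOps hη hx).2.neg.congr fun α => ?_
  rw [weightedTrace]
  ring

/-- Twisted cyclicity: `q^{2αD} a^* = q^{2α} a^* q^{2αD}`. -/
lemma creation_qD_mul {α : ℂ} {q : ℂ} (m : ℤ) {x : Module.End ℂ Fock}
    (hx : x * (creation * qD q m) ∈ Traceable η α) :
    creation * qD q m * x ∈ Traceable η α ∧
    weightedTrace η α (creation * qD q m * x) =
      Complex.exp (2 * α * η) * weightedTrace η α (x * (creation * qD q m)) := by
  obtain ⟨v, hv⟩ := hx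
  -- Read on coefficients, left multiplication by a^* q^{mD} shifts the diagonal of the reversed
  -- product by one place.
  have hg : ∀ y : Fock, ∀ k, (creation * qD q m) y (k + 1) = q ^ (m * (k : ℤ)) * y k := by
    intro y k
    induction y using Finsupp.induction_linear with
    | zero => simp
    | add y z hy hz => rw [LinearMap.map_add, Finsupp.add_apply, hy, hz, Finsupp.add_apply, mul_add]
    | single l c =>
      simp only [Module.End.mul_apply, qD_single, creation_single, Finsupp.single_apply,
        Nat.add_right_cancel_iff]
      split_ifs with h
      · rw [h, mul_comm]
      · simp
  have hg0 : ∀ y : Fock, (creation * qD q m) y 0 = 0 := by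
    intro y
    induction y using Finsupp.induction_linear with
    | zero => simp
    | add y z hy hz => rw [LinearMap.map_add, Finsupp.add_apply, hy, hz, add_zero]
    | single l c =>
      rw [Module.End.mul_apply, qD_single, creation_single, Finsupp.single_eq_of_ne (by simp)]
  have h := HasContinuedSum.of_succ (f := diagElem (creation * qD q m * x))
    (hg0 _) (fun k => ?_) hv
  · refine ⟨⟨_, h⟩, ?_⟩
    rw [weightedTrace, weightedTrace, h.continuedSum_eq, hv.continuedSum_eq]
  · rw [diagElem, diagElem, Module.End.mul_apply, hg, Module.End.mul_apply, Module.End.mul_apply,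
      qD_single, creation_single, one_mul]
    conv_rhs => rw [← mul_one (q ^ _), ← smul_eq_mul, ← Finsupp.smul_single, map_smul]
    simp

end Tau

/-! ### Residues as limits of integrals over small circles. -/

section Residue

/-- The normalised integrals over small circles around `c` converge to `v`. -/
def HasRes (f : ℂ → ℂ) (c v : ℂ) : Prop :=
  Tendsto (fun r : ℝ => (2 * (Real.pi : ℂ) * Complex.I)⁻¹ * ∮ ζ in C(c, r), f ζ) (𝓝[>] 0) (𝓝 v)

lemma HasRes.residueAt_eq {f : ℂ → ℂ} {c v : ℂ} (h : HasRes f c v) : residueAt f c = v :=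
  h.limUnder_eq

lemma eventually_sphere {p : ℂ → Prop} {c : ℂ} (h : ∀ᶠ ζ in 𝓝[≠] c, p ζ) :
    ∀ᶠ r : ℝ in 𝓝[>] 0, 0 < r ∧ ∀ ζ ∈ Metric.sphere c r, p ζ := by
  obtain ⟨ε, hε, hp⟩ := Metric.mem_nhdsWithin_iff.1 h
  filter_upwards [Ioo_mem_nhdsGT hε] with r hr
  refine ⟨hr.1, fun ζ hζ => hp ⟨?_, ?_⟩⟩
  · rw [Metric.mem_ball, Metric.mem_sphere.1 hζ]
    exact hr.2
  · rintro rfl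
    exact hr.1.ne (by simpa using hζ)

lemma HasRes.congr {f g : ℂ → ℂ} {c v : ℂ} (h : HasRes f c v) (hfg : f =ᶠ[𝓝[≠] c] g) :
    HasRes g c v := by
  refine Tendsto.congr' ?_ h
  filter_upwards [eventually_sphere hfg] with r hr
  rw [circleIntegral.integral_congr hr.1.le hr.2]

/-- The circle integrals agree for all small radii, so the limits agree without any knowledge that
they exist. -/
lemma residueAt_congr {f g : ℂ → ℂ} {c : ℂ} (hfg : f =ᶠ[𝓝[≠] c] g) :
    residueAt f c = residueAt g c := by
  rw [residueAt, residueAt, limUnder, limUnder, Filter.map_congr]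
  filter_upwards [eventually_sphere hfg] with r hr
  rw [circleIntegral.integral_congr hr.1.le hr.2]

lemma eventually_circleIntegrable {f : ℂ → ℂ} {c : ℂ} (hf : MeromorphicAt f c) :
    ∀ᶠ r : ℝ in 𝓝[>] 0, CircleIntegrable f c r := by
  filter_upwards [eventually_sphere hf.eventually_analyticAt] with r hr
  exact ContinuousOn.circleIntegrable hr.1.le fun ζ hζ =>
    (hr.2 ζ hζ).continuousAt.continuousWithinAt

lemma HasRes.add {f g : ℂ → ℂ} {c v w : ℂ} (hf : MeromorphicAt f c) (hg : MeromorphicAt g c)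
    (h : HasRes f c v) (h' : HasRes g c w) : HasRes (f + g) c (v + w) := by
  refine (Tendsto.add h h').congr' ?_
  filter_upwards [eventually_circleIntegrable hf, eventually_circleIntegrable hg] with r hr hr'
  rw [← mul_add, ← circleIntegral.integral_add hr hr']
  rfl

lemma HasRes.const_mul {f : ℂ → ℂ} {c v : ℂ} (a : ℂ) (h : HasRes f c v) :
    HasRes (fun ζ => a * f ζ) c (a * v) := by
  refine (Tendsto.const_mul a h).congr fun r => ?_
  rw [circleIntegral.integral_const_mul]
  ring

lemma hasRes_zero_of_analyticAt {f : ℂ → ℂ} {c : ℂ} (hf : AnalyticAt ℂ f c) : HasRes f c 0 := by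
  obtain ⟨ε, hε, hp⟩ := Metric.eventually_nhds_iff_ball.1 hf.eventually_analyticAt
  refine (tendsto_const_nhds (x := (0 : ℂ))).congr' ?_
  filter_upwards [Ioo_mem_nhdsGT hε] with r hr
  have hsub : Metric.closedBall c r ⊆ Metric.ball c ε := Metric.closedBall_subset_ball hr.2
  rw [Complex.circleIntegral_eq_zero_of_differentiable_on_off_countable hr.1.le
    Set.countable_empty (fun ζ hζ => (hp ζ (hsub hζ)).continuousAt.continuousWithinAt)
    (fun ζ hζ => (hp ζ (hsub (Metric.ball_subset_closedBall hζ.1))).differentiableAt), mul_zero]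

lemma exists_hasRes_zpow (c : ℂ) (m : ℤ) : ∃ v, HasRes (fun ζ => (ζ - c) ^ m) c v := by
  by_cases hm : m = -1
  · refine ⟨1, (tendsto_const_nhds (x := (1 : ℂ))).congr' ?_⟩
    filter_upwards [self_mem_nhdsWithin] with r hr
    subst hm
    simp only [zpow_neg_one]
    rw [circleIntegral.integral_sub_center_inv c (ne_of_gt hr), inv_mul_cancel₀]
    simp [Real.pi_ne_zero]
  · refine ⟨0, (tendsto_const_nhds (x := (0 : ℂ))).congr fun r => ?_⟩
    rw [circleIntegral.integral_sub_zpow_of_ne hm, mul_zero]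

/-- Pole orders are removed one at a time: g = g(c) + (ζ - c) · `dslope g c` splits off a pure
power, whose circle integral is explicit, and leaves a pole of lower order. -/
lemma exists_hasRes {f : ℂ → ℂ} {c : ℂ} (hf : MeromorphicAt f c) : ∃ v, HasRes f c v := by
  obtain ⟨n, hn⟩ := hf
  have key : ∀ (n : ℕ) (g : ℂ → ℂ), AnalyticAt ℂ g c →
      ∃ v, HasRes (fun ζ => (ζ - c) ^ (-n : ℤ) * g ζ) c v := by
    intro n
    induction n with
    | zero => exact fun g hg => ⟨0, by simpa using hasRes_zero_of_analyticAt hg⟩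
    | succ n ih =>
      intro g hg
      have hd : AnalyticAt ℂ (dslope g c) c := by
        obtain ⟨p, hp⟩ := hg
        exact hp.has_fpower_series_dslope_fslope.analyticAt
      obtain ⟨v, hv⟩ := ih _ hd
      obtain ⟨w, hw⟩ := exists_hasRes_zpow c (-(n + 1 : ℕ) : ℤ)
      have hz : ∀ m : ℤ, MeromorphicAt (fun ζ : ℂ => (ζ - c) ^ m) c := fun m =>
        ((MeromorphicAt.id c).sub (MeromorphicAt.const c c)).zpow m
      have h := HasRes.add ((MeromorphicAt.const (g c) c).mul (hz _))
        ((hz _).mul hd.meromorphicAt) (hw.const_mul (g c)) hv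
      refine ⟨_, h.congr ?_⟩
      filter_upwards [self_mem_nhdsWithin] with ζ hζ
      have hne : ζ - c ≠ 0 := sub_ne_zero.2 hζ
      have h1 : g ζ = g c + (ζ - c) * dslope g c ζ := by
        have := sub_smul_dslope g c ζ
        rw [smul_eq_mul] at this
        rw [this]; ring
      have h2 : (ζ - c) ^ (-n : ℤ) = (ζ - c) ^ (-(n + 1 : ℕ) : ℤ) * (ζ - c) := by
        rw [← zpow_add_one₀ hne]
        congr 1
        push_cast
        ring
      simp only [Pi.add_apply, Pi.mul_apply]
      rw [h1, h2]
      ring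
  obtain ⟨v, hv⟩ := key n _ hn
  refine ⟨v, hv.congr ?_⟩
  filter_upwards [self_mem_nhdsWithin] with ζ hζ
  have hne : ζ - c ≠ 0 := sub_ne_zero.2 hζ
  rw [smul_eq_mul, ← mul_assoc, zpow_neg, zpow_natCast, inv_mul_cancel₀ (pow_ne_zero _ hne),
    one_mul]

lemma hasRes_residueAt {f : ℂ → ℂ} {c : ℂ} (hf : MeromorphicAt f c) :
    HasRes f c (residueAt f c) := by
  obtain ⟨v, hv⟩ := exists_hasRes hf
  rwa [hv.residueAt_eq]

lemma hasRes_sum {ι : Type*} (s : Finset ι) (f : ι → ℂ → ℂ) (a : ι → ℂ) {c : ℂ}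
    (hf : ∀ i ∈ s, MeromorphicAt (f i) c) :
    HasRes (fun ζ => ∑ i ∈ s, f i ζ * a i) c (∑ i ∈ s, residueAt (f i) c * a i) := by
  classical
  induction s using Finset.induction_on with
  | empty => simpa using hasRes_zero_of_analyticAt (analyticAt_const (v := (0 : ℂ)) (x := c))
  | insert i s hi ih =>
    have h := fun j hj => hf j (Finset.mem_insert_of_mem hj)
    have hi' := hf i (Finset.mem_insert_self _ _)
    simp only [Finset.sum_insert hi]
    have h1 := (hasRes_residueAt hi').const_mul (a i)
    simp only [mul_comm (a i)] at h1
    refine HasRes.add ?_ ?_ h1 (ih h)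
    · exact hi'.mul (.const _ _)
    · exact MeromorphicAt.fun_sum fun j hj => (h j hj).mul (.const _ _)

end Residue

/-! ### Operator families with scalar dependence on the spectral parameter. -/

section Families

/-- The functions that are analytic at `c`. -/
def analyticFns (c : ℂ) : Subalgebra ℂ (ℂ → ℂ) where
  carrier := {f | AnalyticAt ℂ f c}
  mul_mem' := fun hf hg => AnalyticAt.mul hf hg
  add_mem' := fun hf hg => AnalyticAt.add hf hg
  algebraMap_mem' := fun _ => analyticAt_const

/-- The functions that are meromorphic at `c`. -/
def meromorphicFns (c : ℂ) : Subalgebra ℂ (ℂ → ℂ) where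
  carrier := {f | MeromorphicAt f c}
  mul_mem' := fun hf hg => MeromorphicAt.mul hf hg
  add_mem' := fun hf hg => MeromorphicAt.add hf hg
  algebraMap_mem' := fun _ => MeromorphicAt.const _ _

lemma analyticFns_le (c : ℂ) : analyticFns c ≤ meromorphicFns c :=
  fun _ hf => AnalyticAt.meromorphicAt hf

variable {q : ℂ} {S : Subalgebra ℂ (ℂ → ℂ)}

/-- Subalgebras of the algebra of `𝒜`-valued functions. -/
abbrev FnAlgebra (𝒜 : Type*) [Ring 𝒜] [Algebra ℂ 𝒜] : Type _ := Subalgebra ℂ (ℂ → 𝒜)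

/-- Families of operators on the Fock space, depending on the spectral parameter through
coefficients in `S`. -/
def families (q : ℂ) (hq : q ≠ 0) (S : Subalgebra ℂ (ℂ → ℂ)) :
    FnAlgebra (Module.End ℂ Fock) :=
  (Submodule.span ℂ {x | ∃ f ∈ S, ∃ d p, ∃ w ∈ homOp q d p, x = fun ζ => f ζ • w}).toSubalgebra
    (Submodule.subset_span ⟨1, one_mem _, 0, 0, 1, one_mem_homOp, by simp; rfl⟩)
    (by
      intro x y hx hy
      induction hx, hy using Submodule.span_induction₂ with
      | mem_mem x y hx hy =>
        obtain ⟨f, hf, d, p, w, hw, rfl⟩ := hx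
        obtain ⟨g, hg, e, r, u, hu, rfl⟩ := hy
        refine Submodule.subset_span ⟨f * g, mul_mem hf hg, _, _, _, homOp_mul hq hw hu, ?_⟩
        funext ζ
        simp [smul_smul, mul_comm]
      | zero_left y hy => simp
      | zero_right x hx => simp
      | add_left x x' y _ _ _ h h' => rw [add_mul]; exact add_mem h h'
      | add_right x x' y _ _ _ h h' => rw [mul_add]; exact add_mem h h'
      | smul_left c x y _ _ h => rw [smul_mul_assoc]; exact Submodule.smul_mem _ _ h
      | smul_right c x y _ _ h => rw [mul_smul_comm]; exact Submodule.smul_mem _ _ h)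

lemma smul_mem_families {hq : q ≠ 0} {f : ℂ → ℂ} (hf : f ∈ S) {d p : ℤ}
    {w : Module.End ℂ Fock} (hw : w ∈ homOp q d p) : (fun ζ => f ζ • w) ∈ families q hq S :=
  Submodule.subset_span ⟨f, hf, d, p, w, hw, rfl⟩

lemma exists_of_mem_families {hq : q ≠ 0} {x : ℂ → Module.End ℂ Fock} (hx : x ∈ families q hq S) :
    ∃ (n : ℕ) (f : Fin n → ℂ → ℂ) (w : Fin n → Module.End ℂ Fock), (∀ i, f i ∈ S) ∧
      (∀ i, w i ∈ bandOps q) ∧ x = fun ζ => ∑ i, f i ζ • w i := by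
  obtain ⟨n, c, g, rfl⟩ := Submodule.mem_span_set'.1 hx
  choose f hf d p w hw hg using fun i => (g i).2
  refine ⟨n, fun i => c i • f i, w, fun i => Subalgebra.smul_mem _ (hf i) _,
    fun i => mem_bandOps (hw i), ?_⟩
  funext ζ
  rw [Finset.sum_apply]
  refine Finset.sum_congr rfl fun i _ => ?_
  rw [Pi.smul_apply, hg i]
  exact (smul_assoc (c i) (f i ζ) (w i)).symm

lemma families_mono {hq : q ≠ 0} {S' : Subalgebra ℂ (ℂ → ℂ)} (h : S ≤ S') :
    families q hq S ≤ families q hq S' :=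
  Submodule.span_mono fun _ ⟨f, hf, hx⟩ => ⟨f, h hf, hx⟩

variable {η : ℂ}

lemma tau_mem_of_mem_families (hη : NotRootOfUnity η) {x : ℂ → Module.End ℂ Fock}
    (hx : x ∈ families _ (Complex.exp_ne_zero η) S) : (fun ζ => tau η (x ζ)) ∈ S := by
  obtain ⟨n, f, w, hf, hw, rfl⟩ := exists_of_mem_families hx
  have : (fun ζ => tau η (∑ i, f i ζ • w i)) = ∑ i, tau η (w i) • f i := by
    funext ζ
    rw [tau_sum hη _ _ fun i _ => Submodule.smul_mem _ _ (hw i), Finset.sum_apply]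
    exact Finset.sum_congr rfl fun i _ => by rw [tau_smul hη _ (hw i), mul_comm]; rfl
  rw [this]
  exact Subalgebra.sum_mem _ fun i _ => Subalgebra.smul_mem _ (hf i) _

/-- A family involves only finitely many fixed operators, so a single punctured neighbourhood of α =
0 works for all ζ at once. -/
lemma eventually_families (hη : NotRootOfUnity η) {x : ℂ → Module.End ℂ Fock}
    (hx : x ∈ families _ (Complex.exp_ne_zero η) S) :
    ∀ᶠ α in 𝓝[≠] (0 : ℂ), (∀ ζ, x ζ ∈ Traceable η α) ∧ (fun ζ => weightedTrace η α (x ζ)) ∈ S := by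
  obtain ⟨n, f, w, hf, hw, rfl⟩ := exists_of_mem_families hx
  filter_upwards [eventually_all.2 fun i => eventually_traceable hη (hw i)] with α hα
  refine ⟨fun ζ => Submodule.sum_mem _ fun i _ => Submodule.smul_mem _ _ (hα i), ?_⟩
  have : (fun ζ => weightedTrace η α (∑ i, f i ζ • w i)) =
      ∑ i, weightedTrace η α (w i) • f i := by
    funext ζ
    rw [weightedTrace_sum _ _ fun i _ => Submodule.smul_mem _ _ (hα i), Finset.sum_apply]
    exact Finset.sum_congr rfl fun i _ => by rw [weightedTrace_smul _ (hα i), mul_comm]; rfl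
  rw [this]
  exact Subalgebra.sum_mem _ fun i _ => Subalgebra.smul_mem _ (hf i) _

/-- The limit in α and the residue in ζ act on different factors of a finite sum of f(ζ) tr(q^{2αD}
w), so they commute. The sign comes from q^{2α} - 1 in place of 1 - q^{2α}. -/
lemma tendsto_residueAt_weightedTrace (hη : NotRootOfUnity η) {c : ℂ}
    {x : ℂ → Module.End ℂ Fock} (hx : x ∈ families _ (Complex.exp_ne_zero η) (meromorphicFns c)) :
    Tendsto (fun α => residueAt (fun ζ => (Complex.exp (2 * α * η) - 1) * weightedTrace η α (x ζ))
      c)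
      (𝓝[≠] 0) (𝓝 (-residueAt (fun ζ => tau η (x ζ)) c)) := by
  obtain ⟨n, f, w, hf, hw, rfl⟩ := exists_of_mem_families hx
  have htau : (fun ζ => tau η (∑ i, f i ζ • w i)) = fun ζ => ∑ i, f i ζ * tau η (w i) := by
    funext ζ
    rw [tau_sum hη _ _ fun i _ => Submodule.smul_mem _ _ (hw i)]
    exact Finset.sum_congr rfl fun i _ => tau_smul hη _ (hw i)
  rw [htau, (hasRes_sum _ _ _ fun i _ => hf i).residueAt_eq, ← Finset.sum_neg_distrib]
  have hlim : Tendsto (fun α => ∑ i, residueAt (f i) c *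
      ((Complex.exp (2 * α * η) - 1) * weightedTrace η α (w i))) (𝓝[≠] 0)
      (𝓝 (∑ i, -(residueAt (f i) c * tau η (w i)))) := by
    refine tendsto_finsetSum _ fun i _ => ?_
    rw [← mul_neg]
    exact (tendsto_weightedTrace hη (hw i)).const_mul _
  refine hlim.congr' ?_
  filter_upwards [eventually_all.2 fun i => eventually_traceable hη (hw i)] with α hα
  rw [← (hasRes_sum Finset.univ f _ fun i _ => hf i).residueAt_eq]
  congr 1
  funext ζ
  rw [weightedTrace_sum _ _ fun i _ => Submodule.smul_mem _ _ (hα i), Finset.mul_sum]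
  refine Finset.sum_congr rfl fun i _ => ?_
  rw [weightedTrace_smul _ (hα i)]
  ring

end Families

/-! ### Closure of families under site products and conjugation. -/

section ProductFamilies

variable {𝒜 : Type*} [Ring 𝒜] [Algebra ℂ 𝒜] {n : ℕ} (F : FnAlgebra 𝒜)

lemma mono_mem (ℓ : ℂ → Fin n → Matrix (Fin 2) (Fin 2) 𝒜)
    (h : ∀ j s t, (fun ζ => ℓ ζ j s t) ∈ F) (s t : Conf n) : (fun ζ => mono (ℓ ζ) s t) ∈ F := by
  induction n with
  | zero =>
    obtain rfl := Subsingleton.elim s t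
    simp only [mono_zero, Matrix.one_apply_eq]
    exact one_mem F
  | succ n ih =>
    simp only [mono_succ]
    exact mul_mem (ih (fun ζ j => ℓ ζ j.succ) (fun j => h _) _ _) (h _ _ _)

lemma comono_mem (ℓ : ℂ → Fin n → Matrix (Fin 2) (Fin 2) 𝒜)
    (h : ∀ j s t, (fun ζ => ℓ ζ j s t) ∈ F) (s t : Conf n) : (fun ζ => comono (ℓ ζ) s t) ∈ F := by
  induction n with
  | zero =>
    obtain rfl := Subsingleton.elim s t
    simp only [comono_zero, Matrix.one_apply_eq]
    exact one_mem F
  | succ n ih =>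
    simp only [comono_succ]
    exact mul_mem (h _ _ _) (ih (fun ζ j => ℓ ζ j.succ) (fun j => h _) _ _)

lemma conjBy_mem (ℓ ℓ' : ℂ → Fin n → Matrix (Fin 2) (Fin 2) 𝒜)
    (h : ∀ j s t, (fun ζ => ℓ ζ j s t) ∈ F) (h' : ∀ j s t, (fun ζ => ℓ' ζ j s t) ∈ F)
    (X : SpinOp n) (s t : Conf n) : (fun ζ => conjBy (ℓ ζ) (ℓ' ζ) X s t) ∈ F := by
  have : (fun ζ => conjBy (ℓ ζ) (ℓ' ζ) X s t) = ∑ u, ∑ v, X u v •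
      ((fun ζ => comono (ℓ' ζ) s u) * fun ζ => mono (ℓ ζ) v t) := by
    funext ζ
    simp only [conjBy_apply, Finset.sum_apply, Pi.smul_apply, Pi.mul_apply]
  rw [this]
  exact Subalgebra.sum_mem _ fun u _ => Subalgebra.sum_mem _ fun v _ =>
    Subalgebra.smul_mem _ (mul_mem (comono_mem F _ h' _ _) (mono_mem F _ h _ _)) _

/-- Families of matrices, entry by entry. -/
def matrixFamilies : FnAlgebra (Matrix (Fin 2) (Fin 2) 𝒜) where
  carrier := {x | ∀ a b, (fun ζ => x ζ a b) ∈ F}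
  mul_mem' := by
    intro x y hx hy a b
    have : (fun ζ => (x * y) ζ a b) = ∑ c, (fun ζ => x ζ a c) * fun ζ => y ζ c b := by
      funext ζ
      simp [Matrix.mul_apply]
    rw [this]
    exact Subalgebra.sum_mem _ fun c _ => mul_mem (hx _ _) (hy _ _)
  add_mem' := fun hx hy a b => add_mem (hx a b) (hy a b)
  algebraMap_mem' := by
    intro c a b
    by_cases h : a = b
    · subst h
      convert F.algebraMap_mem c using 1
      funext ζ
      simp [Matrix.algebraMap_matrix_apply]
    · convert zero_mem F using 1
      funext ζ
      simp [Matrix.algebraMap_matrix_apply, h]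

end ProductFamilies

/-! ### Block lower triangular site matrices. -/

section LowerTriangular

variable {𝒜 : Type*} [Ring 𝒜]

/-- The block lower triangular matrix with diagonal blocks `A`, `B` and off-diagonal block `C`. -/
def lowerTri (A B C : Matrix (Fin 2) (Fin 2) 𝒜) :
    Matrix (Fin 2) (Fin 2) (Matrix (Fin 2) (Fin 2) 𝒜) :=
  Matrix.of fun s t => !![A s t, 0; C s t, B s t]

lemma lowerTri_mul (A B C A' B' C' : Matrix (Fin 2) (Fin 2) 𝒜) :
    lowerTri A B C * lowerTri A' B' C' = lowerTri (A * A') (B * B') (C * A' + B * C') := by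
  ext s t a b
  fin_cases a <;> fin_cases b <;> simp [lowerTri, Matrix.mul_apply, Fin.sum_univ_two]
  abel

lemma lowerTri_one : lowerTri (1 : Matrix (Fin 2) (Fin 2) 𝒜) 1 0 = 1 := by
  ext s t a b
  fin_cases s <;> fin_cases t <;> fin_cases a <;> fin_cases b <;> simp [lowerTri]

end LowerTriangular

/-! ### One-site matrices, their inverses, and the fusion identity. -/

section SiteMatrices

/-- Elements `a^*`, `a`, `q^{mD}` satisfying the relations of the `q`-oscillator algebra. -/
structure Oscillator (q : ℂ) (𝒜 : Type*) [Ring 𝒜] [Algebra ℂ 𝒜] where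
  cr : 𝒜
  an : 𝒜
  K : ℤ → 𝒜
  K_zero : K 0 = 1
  K_mul_K : ∀ m m', K m * K m' = K (m + m')
  K_mul_cr : ∀ m, K m * cr = q ^ m • (cr * K m)
  K_mul_an : ∀ m, K m * an = q ^ (-m) • (an * K m)
  an_mul_cr : an * cr = K 0 + (-q ^ 2) • K 2
  cr_mul_an : cr * an = K 0 + (-1 : ℂ) • K 2

/-- The `q`-oscillator algebra acting on the Fock space. -/
def fockOscillator {q : ℂ} (hq : q ≠ 0) : Oscillator q (Module.End ℂ Fock) where
  cr := creation
  an := annihilation q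
  K := qD q
  K_zero := qD_zero
  K_mul_K := qD_mul_qD hq
  K_mul_cr := qD_mul_creation hq
  K_mul_an := qD_mul_annihilation hq
  an_mul_cr := annihilation_mul_creation
  cr_mul_an := creation_mul_annihilation

variable {𝒜 : Type*} [Ring 𝒜] [Algebra ℂ 𝒜] {q w : ℂ} (O : Oscillator q 𝒜)

namespace Oscillator

lemma K_mul_cr_mul (m : ℤ) (x : 𝒜) : O.K m * (O.cr * x) = q ^ m • (O.cr * (O.K m * x)) := by
  rw [← mul_assoc, O.K_mul_cr, smul_mul_assoc, mul_assoc]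

lemma K_mul_an_mul (m : ℤ) (x : 𝒜) : O.K m * (O.an * x) = q ^ (-m) • (O.an * (O.K m * x)) := by
  rw [← mul_assoc, O.K_mul_an, smul_mul_assoc, mul_assoc]

lemma an_mul_cr_mul (x : 𝒜) : O.an * (O.cr * x) = O.K 0 * x + (-q ^ 2) • (O.K 2 * x) := by
  rw [← mul_assoc, O.an_mul_cr, add_mul, smul_mul_assoc]

lemma cr_mul_an_mul (x : 𝒜) : O.cr * (O.an * x) = O.K 0 * x + (-1 : ℂ) • (O.K 2 * x) := by
  rw [← mul_assoc, O.cr_mul_an, add_mul, smul_mul_assoc]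

end Oscillator

/-- The values of `ζ / ξ` at which the fused site matrix is regular. -/
structure Regular (q w : ℂ) : Prop where
  ne_zero : w ≠ 0
  sub_ne : q ^ 2 - w ^ 2 ≠ 0
  mul_sub_ne : q ^ 2 * w ^ 2 - 1 ≠ 0

/-- `L⁺` without its scalar prefactor. -/
def siteM (w : ℂ) : Matrix (Fin 2) (Fin 2) 𝒜 :=
  !![O.K 1, (-w) • (O.cr * O.K (-1));
    (-w) • (O.an * O.K 1), O.K (-1) + (-(w ^ 2 * q ^ 2)) • O.K 1]

/-- The inverse of `siteM`. -/
def siteMInv (w : ℂ) : Matrix (Fin 2) (Fin 2) 𝒜 :=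
  (1 - w ^ 2)⁻¹ • !![O.K (-1) + (-w ^ 2) • O.K 1, (w * q⁻¹) • (O.cr * O.K (-1));
    (w * q⁻¹) • (O.an * O.K 1), O.K 1]

/-- The upper diagonal block of the fused site matrix. -/
def siteA (w : ℂ) : Matrix (Fin 2) (Fin 2) 𝒜 :=
  (q * w - q⁻¹ * w⁻¹) • !![O.K 1, (-(w * q⁻¹)) • (O.cr * O.K (-1));
    (-w) • (O.an * O.K 1), q • O.K (-1) + (-(q * w ^ 2)) • O.K 1]

/-- The inverse of `siteA`. -/
def siteAInv (w : ℂ) : Matrix (Fin 2) (Fin 2) 𝒜 :=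
  (q ^ 3 * w * (q ^ 2 * w ^ 2 - 1)⁻¹ * (q ^ 2 - w ^ 2)⁻¹) •
    !![O.K (-1) + (-(w ^ 2 * q⁻¹ ^ 2)) • O.K 1, (w * q⁻¹ ^ 3) • (O.cr * O.K (-1));
      (w * q⁻¹ ^ 2) • (O.an * O.K 1), q⁻¹ • O.K 1]

/-- The lower diagonal block of the fused site matrix, divided by `w - w⁻¹`. -/
def siteB (w : ℂ) : Matrix (Fin 2) (Fin 2) 𝒜 :=
  !![O.K 1, (-(q * w)) • (O.cr * O.K (-1));
    (-w) • (O.an * O.K 1), q⁻¹ • O.K (-1) + (-(q ^ 3 * w ^ 2)) • O.K 1]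

/-- The inverse of `siteB`. -/
def siteBInv (w : ℂ) : Matrix (Fin 2) (Fin 2) 𝒜 :=
  (1 - q ^ 2 * w ^ 2)⁻¹ •
    !![O.K (-1) + (-(q ^ 2 * w ^ 2)) • O.K 1, (q * w) • (O.cr * O.K (-1));
      w • (O.an * O.K 1), q • O.K 1]

/-- The off-diagonal block of the fused site matrix. -/
def siteC (w : ℂ) : Matrix (Fin 2) (Fin 2) 𝒜 :=
  (q - q⁻¹) • !![0, O.K 1; 0, (-w) • (O.an * O.K 1)]

/-- The off-diagonal block of the inverse of the fused site matrix. -/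
def siteCInv (w : ℂ) : Matrix (Fin 2) (Fin 2) 𝒜 :=
  (-((q - q⁻¹) * (w - w⁻¹)⁻¹)) • !![siteAInv O w 1 0, siteAInv O w 1 1; 0, 0]

lemma siteM_mul_siteMInv (hq : q ≠ 0) (hw : w ^ 2 - 1 ≠ 0) : siteM O w * siteMInv O w = 1 := by
  have h1 : 1 - w ^ 2 ≠ 0 := fun h => hw (by linear_combination -h)
  ext i j : 1
  fin_cases i <;> fin_cases j <;>
  · simp [siteM, siteMInv, Matrix.mul_apply, Fin.sum_univ_two, mul_add, add_mul, smul_add,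
      smul_smul, mul_assoc, O.K_mul_K, O.K_mul_cr, O.K_mul_cr_mul, O.K_mul_an,
      O.K_mul_an_mul, O.an_mul_cr, O.cr_mul_an, O.an_mul_cr_mul, O.cr_mul_an_mul, ← O.K_zero,
      -mul_eq_mul_left_iff]
    try (match_scalars <;> field_simp <;> ring)

lemma siteMInv_mul_siteM (hq : q ≠ 0) (hw : w ^ 2 - 1 ≠ 0) : siteMInv O w * siteM O w = 1 := by
  have h1 : 1 - w ^ 2 ≠ 0 := fun h => hw (by linear_combination -h)
  ext i j : 1
  fin_cases i <;> fin_cases j <;>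
  · simp [siteMInv, siteM, Matrix.mul_apply, Fin.sum_univ_two, mul_add, add_mul, smul_add,
      smul_smul, mul_assoc, O.K_mul_K, O.K_mul_cr, O.K_mul_cr_mul, O.K_mul_an,
      O.K_mul_an_mul, O.an_mul_cr, O.cr_mul_an, O.an_mul_cr_mul, O.cr_mul_an_mul, ← O.K_zero,
      -mul_eq_mul_left_iff]
    try (match_scalars <;> field_simp <;> ring)

lemma siteA_mul_siteAInv (hq : q ≠ 0) (hw : Regular q w) : siteA O w * siteAInv O w = 1 := by
  obtain ⟨h0, h1, h2⟩ := hw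
  ext i j : 1
  fin_cases i <;> fin_cases j <;>
  · simp [siteA, siteAInv, Matrix.mul_apply, Fin.sum_univ_two, mul_add, add_mul, smul_add,
      smul_smul, mul_assoc, O.K_mul_K, O.K_mul_cr, O.K_mul_cr_mul, O.K_mul_an,
      O.K_mul_an_mul, O.an_mul_cr, O.cr_mul_an, O.an_mul_cr_mul, O.cr_mul_an_mul, ← O.K_zero,
      -mul_eq_mul_left_iff]
    try (match_scalars <;> field_simp <;> ring)

lemma siteAInv_mul_siteA (hq : q ≠ 0) (hw : Regular q w) : siteAInv O w * siteA O w = 1 := by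
  obtain ⟨h0, h1, h2⟩ := hw
  ext i j : 1
  fin_cases i <;> fin_cases j <;>
  · simp [siteAInv, siteA, Matrix.mul_apply, Fin.sum_univ_two, mul_add, add_mul, smul_add,
      smul_smul, mul_assoc, O.K_mul_K, O.K_mul_cr, O.K_mul_cr_mul, O.K_mul_an,
      O.K_mul_an_mul, O.an_mul_cr, O.cr_mul_an, O.an_mul_cr_mul, O.cr_mul_an_mul, ← O.K_zero,
      -mul_eq_mul_left_iff]
    try (match_scalars <;> field_simp <;> ring)

lemma siteB_mul_siteBInv (hq : q ≠ 0) (hw : Regular q w) : siteB O w * siteBInv O w = 1 := by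
  obtain ⟨h0, h1, h2⟩ := hw
  have h3 : 1 - q ^ 2 * w ^ 2 ≠ 0 := fun h => h2 (by linear_combination -h)
  ext i j : 1
  fin_cases i <;> fin_cases j <;>
  · simp [siteB, siteBInv, Matrix.mul_apply, Fin.sum_univ_two, mul_add, add_mul, smul_add,
      smul_smul, mul_assoc, O.K_mul_K, O.K_mul_cr, O.K_mul_cr_mul, O.K_mul_an,
      O.K_mul_an_mul, O.an_mul_cr, O.cr_mul_an, O.an_mul_cr_mul, O.cr_mul_an_mul, ← O.K_zero,
      -mul_eq_mul_left_iff]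
    try (match_scalars <;> field_simp <;> ring)

lemma siteBInv_mul_siteB (hq : q ≠ 0) (hw : Regular q w) : siteBInv O w * siteB O w = 1 := by
  obtain ⟨h0, h1, h2⟩ := hw
  have h3 : 1 - q ^ 2 * w ^ 2 ≠ 0 := fun h => h2 (by linear_combination -h)
  ext i j : 1
  fin_cases i <;> fin_cases j <;>
  · simp [siteBInv, siteB, Matrix.mul_apply, Fin.sum_univ_two, mul_add, add_mul, smul_add,
      smul_smul, mul_assoc, O.K_mul_K, O.K_mul_cr, O.K_mul_cr_mul, O.K_mul_an,
      O.K_mul_an_mul, O.an_mul_cr, O.cr_mul_an, O.an_mul_cr_mul, O.cr_mul_an_mul, ← O.K_zero,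
      -mul_eq_mul_left_iff]
    try (match_scalars <;> field_simp <;> ring)

/-- With E the matrix unit raising the spin, C = (q - q⁻¹) B E and the corner of the inverse is -(q
- q⁻¹)(w - w⁻¹)⁻¹ E A⁻¹. The corner equations for the two-sided inverse then reduce to those for A
and B. -/
lemma siteC_eq : siteC O w = (q - q⁻¹) • (siteB O w * !![0, 1; 0, 0]) := by
  ext i j
  fin_cases i <;> fin_cases j <;> simp [siteC, siteB, Matrix.mul_apply, Fin.sum_univ_two]

lemma siteCInv_eq :
    siteCInv O w = (-((q - q⁻¹) * (w - w⁻¹)⁻¹)) • (!![0, 1; 0, 0] * siteAInv O w) := by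
  ext i j
  fin_cases i <;> fin_cases j <;> simp [siteCInv, Matrix.vecMul, dotProduct, Fin.sum_univ_two]

/-- The fused site matrix, after the gauge transformation that makes it block triangular. -/
def siteF (w : ℂ) : Matrix (Fin 2) (Fin 2) (Matrix (Fin 2) (Fin 2) 𝒜) :=
  lowerTri (siteA O w) ((w - w⁻¹) • siteB O w) (siteC O w)

/-- The inverse of `siteF`. -/
def siteFInv (w : ℂ) : Matrix (Fin 2) (Fin 2) (Matrix (Fin 2) (Fin 2) 𝒜) :=
  lowerTri (siteAInv O w) ((w - w⁻¹)⁻¹ • siteBInv O w) (siteCInv O w)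

lemma sub_inv_ne_zero (hw : w ^ 2 - 1 ≠ 0) (h0 : w ≠ 0) : w - w⁻¹ ≠ 0 := by
  intro h
  apply hw
  rw [sub_eq_zero] at h ⊢
  rw [sq]
  nth_rewrite 1 [h]
  exact inv_mul_cancel₀ h0

lemma siteF_mul_siteFInv (hq : q ≠ 0) (hw : Regular q w) (hw' : w ^ 2 - 1 ≠ 0) :
    siteF O w * siteFInv O w = 1 := by
  have hb := sub_inv_ne_zero hw' hw.ne_zero
  rw [siteF, siteFInv, lowerTri_mul, siteA_mul_siteAInv O hq hw, smul_mul_smul_comm,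
    siteB_mul_siteBInv O hq hw, mul_inv_cancel₀ hb, one_smul, siteC_eq, siteCInv_eq,
    smul_mul_assoc, smul_mul_smul_comm, mul_assoc, ← add_smul, ← lowerTri_one,
    mul_neg, mul_left_comm, mul_inv_cancel₀ hb, mul_one, add_neg_cancel, zero_smul]

lemma siteFInv_mul_siteF (hq : q ≠ 0) (hw : Regular q w) (hw' : w ^ 2 - 1 ≠ 0) :
    siteFInv O w * siteF O w = 1 := by
  have hb := sub_inv_ne_zero hw' hw.ne_zero
  rw [siteF, siteFInv, lowerTri_mul, siteAInv_mul_siteA O hq hw, smul_mul_smul_comm,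
    siteBInv_mul_siteB O hq hw, inv_mul_cancel₀ hb, one_smul, siteC_eq, siteCInv_eq,
    smul_mul_assoc, smul_mul_smul_comm, mul_assoc, siteAInv_mul_siteA O hq hw, ← mul_assoc,
    siteBInv_mul_siteB O hq hw, one_mul, mul_one, ← add_smul, ← lowerTri_one,
    mul_comm (q - q⁻¹), neg_add_cancel, zero_smul]

/-- The off-diagonal entry of the gauge transformation. -/
def gaugeElem : 𝒜 := q⁻¹ • (O.cr * O.K (-2))

/-- The gauge transformation that makes the fused site matrix block triangular. -/
def gauge : Matrix (Fin 2) (Fin 2) 𝒜 := !![1, gaugeElem O; 0, 1]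

/-- The inverse of `gauge`. -/
def gaugeInv : Matrix (Fin 2) (Fin 2) 𝒜 := !![1, -gaugeElem O; 0, 1]

lemma gauge_mul_gaugeInv : gauge O * gaugeInv O = 1 := by
  ext i j
  fin_cases i <;> fin_cases j <;> simp [gauge, gaugeInv, Matrix.mul_apply, Fin.sum_univ_two]

lemma gaugeInv_mul_gauge : gaugeInv O * gauge O = 1 := by
  ext i j
  fin_cases i <;> fin_cases j <;> simp [gauge, gaugeInv, Matrix.mul_apply, Fin.sum_univ_two]

/-- The six-vertex site matrix, in explicit form. -/
def siteR (q w : ℂ) : Matrix (Fin 2) (Fin 2) (Matrix (Fin 2) (Fin 2) ℂ) :=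
  !![!![q * w - q⁻¹ * w⁻¹, 0; 0, w - w⁻¹], !![0, 0; q - q⁻¹, 0];
    !![0, q - q⁻¹; 0, 0], !![w - w⁻¹, 0; 0, q * w - q⁻¹ * w⁻¹]]

/-- The inverse of `siteR`. -/
def siteRInv (q w : ℂ) : Matrix (Fin 2) (Fin 2) (Matrix (Fin 2) (Fin 2) ℂ) :=
  ((q ^ 2 * w ^ 2 - 1)⁻¹ * (q ^ 2 - w ^ 2)⁻¹ * (q * w)) •
    !![!![q ^ 2 - w ^ 2, 0; 0, -(q * (w ^ 2 - 1))], !![0, 0; w * (q ^ 2 - 1), 0];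
      !![0, w * (q ^ 2 - 1); 0, 0], !![-(q * (w ^ 2 - 1)), 0; 0, q ^ 2 - w ^ 2]]

/-- The scalar qw - q⁻¹w⁻¹ cancels the denominator 1 - q²w² of the weights. Regularity excludes w =
0 and q²w² = 1, where division takes its default value. -/
lemma Lsix_eq_siteR (hq : q ≠ 0) (hw : Regular q w) : Lsix q w = siteR q w := by
  obtain ⟨h0, h1, h2⟩ := hw
  have h3 : 1 - q ^ 2 * w ^ 2 ≠ 0 := fun h => h2 (by linear_combination -h)
  ext s t a b
  fin_cases s <;> fin_cases t <;> fin_cases a <;> fin_cases b <;>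
  · simp [Lsix, Rmat, siteR]
    try (field_simp <;> ring)

lemma siteR_mul_siteRInv (hq : q ≠ 0) (hw : Regular q w) : siteR q w * siteRInv q w = 1 := by
  obtain ⟨h0, h1, h2⟩ := hw
  have h3 : w ^ 2 * q ^ 2 - 1 ≠ 0 := fun h => h2 (by linear_combination h)
  ext s t a b
  fin_cases s <;> fin_cases t <;> fin_cases a <;> fin_cases b <;>
  · simp [siteR, siteRInv, Matrix.mul_apply, Fin.sum_univ_two]
    try (field_simp <;> ring)

lemma siteRInv_mul_siteR (hq : q ≠ 0) (hw : Regular q w) : siteRInv q w * siteR q w = 1 := by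
  obtain ⟨h0, h1, h2⟩ := hw
  ext s t a b
  fin_cases s <;> fin_cases t <;> fin_cases a <;> fin_cases b <;>
  · simp [siteR, siteRInv, Matrix.mul_apply, Fin.sum_univ_two]
    try (field_simp <;> ring)

/-- The fusion identity at one site: in the common gauge, the product over both auxiliary spaces
preserves a flag. It is checked on all sixteen entries by normal ordering a^*, a and q^{mD}. -/
lemma siteM_mul_siteR (hq : q ≠ 0) (hw : Regular q w) :
    (siteM O w).map (Matrix.scalar (Fin 2)) * (siteR q w).map (algebraMap ℂ 𝒜).mapMatrix =
      (siteF O w).map fun x => gauge O * x * gaugeInv O := by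
  obtain ⟨h0, h1, h2⟩ := hw
  ext s t a b
  fin_cases s <;> fin_cases t <;> fin_cases a <;> fin_cases b <;>
  · simp [siteM, siteR, siteF, siteA, siteB, siteC, lowerTri, gauge, gaugeInv,
      gaugeElem, Algebra.algebraMap_eq_smul_one, Matrix.mul_apply, Fin.sum_univ_two, mul_add,
        add_mul, smul_add,
      smul_smul, mul_assoc, O.K_mul_K, O.K_mul_cr, O.K_mul_cr_mul, O.K_mul_an,
      O.K_mul_an_mul, O.an_mul_cr, O.cr_mul_an, O.an_mul_cr_mul, O.cr_mul_an_mul, ← O.K_zero,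
      -mul_eq_mul_left_iff]
    try (match_scalars <;> field_simp <;> ring)

end SiteMatrices

/-! ### Moving the first-site factors around the gauge element. -/

section Crossing

variable {𝒜 : Type*} [Ring 𝒜] [Algebra ℂ 𝒜] {q w : ℂ} (O : Oscillator q 𝒜)

/-- These sums arise when cyclicity carries the left-hand factor of the first site to the far right
of g. In all of them, each term with a pole at w² = 1 is a multiple of a^*, (a^*)² q^{-2D} or
q^{2D}; on the diagonal of the A sums the remaining part is exactly g. -/
lemma crossing_A_zero_zero (hq : q ≠ 0) (hw : Regular q w) (hw' : w ^ 2 - 1 ≠ 0) :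
    ∑ c, siteA O w c 0 * gaugeElem O * ((w - w⁻¹)⁻¹ • siteBInv O w 0 c) =
      gaugeElem O + ((q ^ 3 - q) * w ^ 2 / (1 - w ^ 2)) • (O.cr * O.K 0) := by
  obtain ⟨h0, h1, h2⟩ := hw
  have h3 : 1 - q ^ 2 * w ^ 2 ≠ 0 := fun h => h2 (by linear_combination -h)
  have h5 : 1 - w ^ 2 * q ^ 2 ≠ 0 := fun h => h2 (by linear_combination -h)
  have h4 : 1 - w ^ 2 ≠ 0 := fun h => hw' (by linear_combination -h)
  simp [siteA, siteAInv, siteB, siteBInv, siteC, siteCInv, gaugeElem, Matrix.mul_apply,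
    Fin.sum_univ_two, mul_add, add_mul, smul_add,
    smul_smul, mul_assoc, O.K_mul_K, O.K_mul_cr, O.K_mul_cr_mul, O.K_mul_an,
    O.K_mul_an_mul, O.an_mul_cr, O.cr_mul_an, O.an_mul_cr_mul, O.cr_mul_an_mul, ← O.K_zero,
    -mul_eq_mul_left_iff]
  match_scalars <;> field_simp <;> ring

lemma crossing_A_one_one (hq : q ≠ 0) (hw : Regular q w) (hw' : w ^ 2 - 1 ≠ 0) :
    ∑ c, siteA O w c 1 * gaugeElem O * ((w - w⁻¹)⁻¹ • siteBInv O w 1 c) =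
      gaugeElem O + (w ^ 2 * (1 - q ^ 2) / (q * (1 - w ^ 2))) • (O.cr * O.K 0) := by
  obtain ⟨h0, h1, h2⟩ := hw
  have h3 : 1 - q ^ 2 * w ^ 2 ≠ 0 := fun h => h2 (by linear_combination -h)
  have h5 : 1 - w ^ 2 * q ^ 2 ≠ 0 := fun h => h2 (by linear_combination -h)
  have h4 : 1 - w ^ 2 ≠ 0 := fun h => hw' (by linear_combination -h)
  simp [siteA, siteAInv, siteB, siteBInv, siteC, siteCInv, gaugeElem, Matrix.mul_apply,
    Fin.sum_univ_two, mul_add, add_mul, smul_add,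
    smul_smul, mul_assoc, O.K_mul_K, O.K_mul_cr, O.K_mul_cr_mul, O.K_mul_an,
    O.K_mul_an_mul, O.an_mul_cr, O.cr_mul_an, O.an_mul_cr_mul, O.cr_mul_an_mul, ← O.K_zero,
    -mul_eq_mul_left_iff]
  match_scalars <;> field_simp <;> ring

lemma crossing_A_zero_one (hq : q ≠ 0) (hw : Regular q w) (hw' : w ^ 2 - 1 ≠ 0) :
    ∑ c, siteA O w c 1 * gaugeElem O * ((w - w⁻¹)⁻¹ • siteBInv O w 0 c) =
      ((1 - q ^ 2) * w ^ 3 / (q ^ 2 * (1 - w ^ 2))) • (O.cr * O.cr * O.K (-2)) := by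
  obtain ⟨h0, h1, h2⟩ := hw
  have h3 : 1 - q ^ 2 * w ^ 2 ≠ 0 := fun h => h2 (by linear_combination -h)
  have h5 : 1 - w ^ 2 * q ^ 2 ≠ 0 := fun h => h2 (by linear_combination -h)
  have h4 : 1 - w ^ 2 ≠ 0 := fun h => hw' (by linear_combination -h)
  simp [siteA, siteAInv, siteB, siteBInv, siteC, siteCInv, gaugeElem, Matrix.mul_apply,
    Fin.sum_univ_two, mul_add, add_mul, smul_add,
    smul_smul, mul_assoc, O.K_mul_K, O.K_mul_cr, O.K_mul_cr_mul, O.K_mul_an,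
    O.K_mul_an_mul, O.an_mul_cr, O.cr_mul_an, O.an_mul_cr_mul, O.cr_mul_an_mul, ← O.K_zero,
    -mul_eq_mul_left_iff]
  match_scalars <;> field_simp <;> ring

lemma crossing_A_one_zero (hq : q ≠ 0) (hw : Regular q w) (hw' : w ^ 2 - 1 ≠ 0) :
    ∑ c, siteA O w c 0 * gaugeElem O * ((w - w⁻¹)⁻¹ • siteBInv O w 1 c) =
      (w * (q ^ 2 - 1) / (1 - w ^ 2)) • O.K 2 := by
  obtain ⟨h0, h1, h2⟩ := hw
  have h3 : 1 - q ^ 2 * w ^ 2 ≠ 0 := fun h => h2 (by linear_combination -h)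
  have h5 : 1 - w ^ 2 * q ^ 2 ≠ 0 := fun h => h2 (by linear_combination -h)
  have h4 : 1 - w ^ 2 ≠ 0 := fun h => hw' (by linear_combination -h)
  simp [siteA, siteAInv, siteB, siteBInv, siteC, siteCInv, gaugeElem, Matrix.mul_apply,
    Fin.sum_univ_two, mul_add, add_mul, smul_add,
    smul_smul, mul_assoc, O.K_mul_K, O.K_mul_cr, O.K_mul_cr_mul, O.K_mul_an,
    O.K_mul_an_mul, O.an_mul_cr, O.cr_mul_an, O.an_mul_cr_mul, O.cr_mul_an_mul, ← O.K_zero,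
    -mul_eq_mul_left_iff]
  match_scalars <;> field_simp <;> ring

/-- The term a^* q^{-2D} survives `tau`, but its coefficient is regular at w² = 1. -/
lemma crossing_C_zero_one (hq : q ≠ 0) (hw : Regular q w) (hw' : w ^ 2 - 1 ≠ 0) :
    ∑ c, siteC O w c 1 * gaugeElem O * ((w - w⁻¹)⁻¹ • siteBInv O w 0 c) =
      (-((q - q⁻¹) * w * (1 - q ^ 2 * w ^ 2)⁻¹)) • (O.cr * O.K (-2)) +
        ((q - q⁻¹) * (q ^ 4 - q ^ 2) * w ^ 3 / ((1 - q ^ 2 * w ^ 2) * (w ^ 2 - 1))) • (O.cr * O.K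
          0) := by
  obtain ⟨h0, h1, h2⟩ := hw
  have h3 : 1 - q ^ 2 * w ^ 2 ≠ 0 := fun h => h2 (by linear_combination -h)
  have h5 : 1 - w ^ 2 * q ^ 2 ≠ 0 := fun h => h2 (by linear_combination -h)
  have h4 : 1 - w ^ 2 ≠ 0 := fun h => hw' (by linear_combination -h)
  simp [siteA, siteAInv, siteB, siteBInv, siteC, siteCInv, gaugeElem, Matrix.mul_apply,
    Fin.sum_univ_two, mul_add, add_mul, smul_add,
    smul_smul, mul_assoc, O.K_mul_K, O.K_mul_cr, O.K_mul_cr_mul, O.K_mul_an,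
    O.K_mul_an_mul, O.an_mul_cr, O.cr_mul_an, O.an_mul_cr_mul, O.cr_mul_an_mul, ← O.K_zero,
    -mul_eq_mul_left_iff]
  match_scalars <;> field_simp <;> ring

lemma crossing_C_one_one (hq : q ≠ 0) (hw : Regular q w) (hw' : w ^ 2 - 1 ≠ 0) :
    ∑ c, siteC O w c 1 * gaugeElem O * ((w - w⁻¹)⁻¹ • siteBInv O w 1 c) =
      ((q - q⁻¹) * q * w ^ 2 * (q ^ 2 - 1) / ((1 - q ^ 2 * w ^ 2) * (w ^ 2 - 1))) • O.K 2 := by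
  obtain ⟨h0, h1, h2⟩ := hw
  have h3 : 1 - q ^ 2 * w ^ 2 ≠ 0 := fun h => h2 (by linear_combination -h)
  have h5 : 1 - w ^ 2 * q ^ 2 ≠ 0 := fun h => h2 (by linear_combination -h)
  have h4 : 1 - w ^ 2 ≠ 0 := fun h => hw' (by linear_combination -h)
  simp [siteA, siteAInv, siteB, siteBInv, siteC, siteCInv, gaugeElem, Matrix.mul_apply,
    Fin.sum_univ_two, mul_add, add_mul, smul_add,
    smul_smul, mul_assoc, O.K_mul_K, O.K_mul_cr, O.K_mul_cr_mul, O.K_mul_an,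
    O.K_mul_an_mul, O.an_mul_cr, O.cr_mul_an, O.an_mul_cr_mul, O.cr_mul_an_mul, ← O.K_zero,
    -mul_eq_mul_left_iff]
  match_scalars <;> field_simp <;> ring

/-- Here too only a^* q^{-2D} survives, and the explicit pole of the inverse corner at w² = 1 has
dropped out of its coefficient. -/
lemma crossing_CInv_zero_one (hq : q ≠ 0) (hw : Regular q w) (hw' : w ^ 2 - 1 ≠ 0) :
    ∑ c, siteA O w c 1 * gaugeElem O * siteCInv O w 0 c =
      ((q - q⁻¹) * w * (q ^ 2 - w ^ 2)⁻¹) • (O.cr * O.K (-2)) +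
        (-((q - q⁻¹) * w ^ 3 * (1 - q ^ 2) / ((q ^ 2 - w ^ 2) * (w ^ 2 - 1)))) • (O.cr * O.K 0) :=
          by
  obtain ⟨h0, h1, h2⟩ := hw
  have h3 : 1 - q ^ 2 * w ^ 2 ≠ 0 := fun h => h2 (by linear_combination -h)
  have h5 : 1 - w ^ 2 * q ^ 2 ≠ 0 := fun h => h2 (by linear_combination -h)
  have h4 : 1 - w ^ 2 ≠ 0 := fun h => hw' (by linear_combination -h)
  simp [siteA, siteAInv, siteB, siteBInv, siteC, siteCInv, gaugeElem, Matrix.mul_apply,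
    Fin.sum_univ_two, mul_add, add_mul, smul_add,
    smul_smul, mul_assoc, O.K_mul_K, O.K_mul_cr, O.K_mul_cr_mul, O.K_mul_an,
    O.K_mul_an_mul, O.an_mul_cr, O.cr_mul_an, O.an_mul_cr_mul, O.cr_mul_an_mul, ← O.K_zero,
    -mul_eq_mul_left_iff]
  match_scalars <;> field_simp <;> ring

lemma crossing_CInv_zero_zero (hq : q ≠ 0) (hw : Regular q w) (hw' : w ^ 2 - 1 ≠ 0) :
    ∑ c, siteA O w c 0 * gaugeElem O * siteCInv O w 0 c =
      (-((q - q⁻¹) * w ^ 2 * q * (q ^ 2 - 1) / ((q ^ 2 - w ^ 2) * (w ^ 2 - 1)))) • O.K 2 := by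
  obtain ⟨h0, h1, h2⟩ := hw
  have h3 : 1 - q ^ 2 * w ^ 2 ≠ 0 := fun h => h2 (by linear_combination -h)
  have h5 : 1 - w ^ 2 * q ^ 2 ≠ 0 := fun h => h2 (by linear_combination -h)
  have h4 : 1 - w ^ 2 ≠ 0 := fun h => hw' (by linear_combination -h)
  simp [siteA, siteAInv, siteB, siteBInv, siteC, siteCInv, gaugeElem, Matrix.mul_apply,
    Fin.sum_univ_two, mul_add, add_mul, smul_add,
    smul_smul, mul_assoc, O.K_mul_K, O.K_mul_cr, O.K_mul_cr_mul, O.K_mul_an,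
    O.K_mul_an_mul, O.an_mul_cr, O.cr_mul_an, O.an_mul_cr_mul, O.cr_mul_an_mul, ← O.K_zero,
    -mul_eq_mul_left_iff]
  match_scalars <;> field_simp <;> ring

end Crossing

/-! ### Spin conservation and the selection rule for the trace functional. -/

section Grading

variable {q : ℂ} (hq : q ≠ 0) {n : ℕ}

/-- The number of up spins at one site. -/
def up : Fin 2 → ℤ := ![1, 0]

/-- The number of up spins of a configuration. -/
def upCount (s : Conf n) : ℤ := ∑ i, up (s i)

lemma upCount_succ (s : Conf (n + 1)) : upCount s = up (s 0) + upCount fun i : Fin n => s i.succ :=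
  Fin.sum_univ_succ _

lemma homOp_cast {d p d' p' : ℤ} {x : Module.End ℂ Fock} (hx : x ∈ homOp q d p) (hd : d = d')
    (hp : p = p') : x ∈ homOp q d' p' := by
  subst hd hp
  exact hx

lemma K_mem {p m : ℤ} (h : p ≤ m) : (fockOscillator hq).K m ∈ homOp q 0 p :=
  homOp_anti h (qD_mem_homOp m)

lemma cr_K_mem {p m : ℤ} (h : p ≤ m) :
    (fockOscillator hq).cr * (fockOscillator hq).K m ∈ homOp q 1 p := by
  have := homOp_mul hq creation_mem_homOp (qD_mem_homOp (q := q) m)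
  rw [zero_add, add_zero] at this
  exact homOp_anti h this

lemma an_K_mem {p m : ℤ} (h : p ≤ m) :
    (fockOscillator hq).an * (fockOscillator hq).K m ∈ homOp q (-1) p := by
  have := homOp_mul hq annihilation_mem_homOp (qD_mem_homOp (q := q) m)
  rw [zero_add, add_zero] at this
  exact homOp_anti h this

/-- Since a^* accompanies σ⁺ and a accompanies σ⁻, the degree is the gain in up spins. The lowest
exponent depends only on the incoming spin, and for the inverse matrices only on the outgoing one.
-/
lemma siteA_mem_homOp (w : ℂ) (s t : Fin 2) :
    siteA (fockOscillator hq) w s t ∈ homOp q (up s - up t) (2 * up t - 1) := by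
  rw [siteA, Matrix.smul_apply]
  refine Submodule.smul_mem _ _ ?_
  fin_cases s <;> fin_cases t
  · exact K_mem hq le_rfl
  · exact Submodule.smul_mem _ _ (cr_K_mem hq le_rfl)
  · exact Submodule.smul_mem _ _ (an_K_mem hq le_rfl)
  · exact add_mem (Submodule.smul_mem _ _ (K_mem hq le_rfl))
      (Submodule.smul_mem _ _ (K_mem hq (by decide)))

lemma siteB_mem_homOp (w : ℂ) (s t : Fin 2) :
    siteB (fockOscillator hq) w s t ∈ homOp q (up s - up t) (2 * up t - 1) := by
  fin_cases s <;> fin_cases t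
  · exact K_mem hq le_rfl
  · exact Submodule.smul_mem _ _ (cr_K_mem hq le_rfl)
  · exact Submodule.smul_mem _ _ (an_K_mem hq le_rfl)
  · exact add_mem (Submodule.smul_mem _ _ (K_mem hq le_rfl))
      (Submodule.smul_mem _ _ (K_mem hq (by decide)))

lemma siteAInv_mem_homOp (w : ℂ) (s t : Fin 2) :
    siteAInv (fockOscillator hq) w s t ∈ homOp q (up s - up t) (1 - 2 * up s) := by
  rw [siteAInv, Matrix.smul_apply]
  refine Submodule.smul_mem _ _ ?_
  fin_cases s <;> fin_cases t
  · exact add_mem (K_mem hq le_rfl) (Submodule.smul_mem _ _ (K_mem hq (by decide)))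
  · exact Submodule.smul_mem _ _ (cr_K_mem hq le_rfl)
  · exact Submodule.smul_mem _ _ (an_K_mem hq le_rfl)
  · exact Submodule.smul_mem _ _ (K_mem hq le_rfl)

lemma siteBInv_mem_homOp (w : ℂ) (s t : Fin 2) :
    siteBInv (fockOscillator hq) w s t ∈ homOp q (up s - up t) (1 - 2 * up s) := by
  rw [siteBInv, Matrix.smul_apply]
  refine Submodule.smul_mem _ _ ?_
  fin_cases s <;> fin_cases t
  · exact add_mem (K_mem hq le_rfl) (Submodule.smul_mem _ _ (K_mem hq (by decide)))
  · exact Submodule.smul_mem _ _ (cr_K_mem hq le_rfl)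
  · exact Submodule.smul_mem _ _ (an_K_mem hq le_rfl)
  · exact Submodule.smul_mem _ _ (K_mem hq le_rfl)

lemma siteC_mem_homOp (w : ℂ) (s t : Fin 2) :
    siteC (fockOscillator hq) w s t ∈ homOp q (up s - up t - 1) (2 * up t + 1) := by
  rw [siteC, Matrix.smul_apply]
  refine Submodule.smul_mem _ _ ?_
  fin_cases s <;> fin_cases t
  · exact zero_mem _
  · exact K_mem hq le_rfl
  · exact zero_mem _
  · exact Submodule.smul_mem _ _ (an_K_mem hq le_rfl)

lemma siteCInv_mem_homOp (w : ℂ) (s t : Fin 2) :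
    siteCInv (fockOscillator hq) w s t ∈ homOp q (up s - up t - 1) (3 - 2 * up s) := by
  rw [siteCInv, Matrix.smul_apply]
  refine Submodule.smul_mem _ _ ?_
  fin_cases s <;> fin_cases t
  · exact siteAInv_mem_homOp hq w 1 0
  · exact siteAInv_mem_homOp hq w 1 1
  · exact zero_mem _
  · exact zero_mem _

/-- Matrices whose entries are homogeneous, with the degrees shifted by those of the
two-dimensional auxiliary space. -/
def gradedMat (q : ℂ) (d p : ℤ) : Submodule ℂ (Matrix (Fin 2) (Fin 2) (Module.End ℂ Fock)) where
  carrier := {x | ∀ a b, x a b ∈ homOp q (d + (up a - up b)) (p - 2 * (up a - up b))}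
  zero_mem' := fun _ _ => zero_mem _
  add_mem' := fun hx hy a b => add_mem (hx a b) (hy a b)
  smul_mem' := fun c _ hx a b => Submodule.smul_mem _ c (hx a b)

lemma gradedMat_cast {d p d' p' : ℤ} {x : Matrix (Fin 2) (Fin 2) (Module.End ℂ Fock)}
    (hx : x ∈ gradedMat q d p) (hd : d = d') (hp : p = p') : x ∈ gradedMat q d' p' := by
  subst hd hp
  exact hx

/-- The shifts attached to the auxiliary indices telescope through the intermediate index; they
leave the weight p + 2d unchanged. -/
lemma gradedMat_mul (hq : q ≠ 0) {d p e r : ℤ} {x y : Matrix (Fin 2) (Fin 2) (Module.End ℂ Fock)}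
    (hx : x ∈ gradedMat q d p) (hy : y ∈ gradedMat q e r) : x * y ∈ gradedMat q (d + e) (p + r) :=
      by
  intro a b
  rw [Matrix.mul_apply]
  refine Submodule.sum_mem _ fun c _ => ?_
  exact homOp_cast (homOp_mul hq (hx a c) (hy c b)) (by ring) (by ring)

lemma one_mem_gradedMat : (1 : Matrix (Fin 2) (Fin 2) (Module.End ℂ Fock)) ∈ gradedMat q 0 0 := by
  intro a b
  by_cases h : a = b
  · subst h
    simpa using one_mem_homOp
  · rw [Matrix.one_apply_ne h]
    exact zero_mem _

lemma siteF_mem_gradedMat (w : ℂ) (s t : Fin 2) :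
    siteF (fockOscillator hq) w s t ∈ gradedMat q (up s - up t) (2 * up t - 1) := by
  intro a b
  fin_cases a <;> fin_cases b
  · exact homOp_cast (siteA_mem_homOp hq w s t) (by simp) (by simp)
  · exact zero_mem _
  · exact homOp_cast (siteC_mem_homOp hq w s t) (by simp [up]; ring) (by simp [up]; ring)
  · exact homOp_cast (Submodule.smul_mem _ (w - w⁻¹) (siteB_mem_homOp hq w s t)) (by simp) (by simp)

lemma siteFInv_mem_gradedMat (w : ℂ) (s t : Fin 2) :
    siteFInv (fockOscillator hq) w s t ∈ gradedMat q (up s - up t) (1 - 2 * up s) := by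
  intro a b
  fin_cases a <;> fin_cases b
  · exact homOp_cast (siteAInv_mem_homOp hq w s t) (by simp) (by simp)
  · exact zero_mem _
  · exact homOp_cast (siteCInv_mem_homOp hq w s t) (by simp [up]; ring) (by simp [up]; ring)
  · exact homOp_cast (Submodule.smul_mem _ (w - w⁻¹)⁻¹ (siteBInv_mem_homOp hq w s t)) (by simp)
      (by simp)

lemma mono_mem_gradedMat (hq : q ≠ 0)
    (ℓ : Fin n → Matrix (Fin 2) (Fin 2) (Matrix (Fin 2) (Fin 2) (Module.End ℂ Fock)))
    (h : ∀ j s t, ℓ j s t ∈ gradedMat q (up s - up t) (2 * up t - 1)) (s t : Conf n) :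
    mono ℓ s t ∈ gradedMat q (upCount s - upCount t) (2 * upCount t - n) := by
  induction n with
  | zero =>
    obtain rfl := Subsingleton.elim s t
    rw [mono_zero, Matrix.one_apply_eq]
    simpa [upCount] using one_mem_gradedMat
  | succ n ih =>
    rw [mono_succ]
    have := gradedMat_mul hq (ih (fun j => ℓ j.succ) (fun j => h _) (fun i => s i.succ)
      (fun i => t i.succ)) (h 0 (s 0) (t 0))
    refine gradedMat_cast this ?_ ?_
    · rw [upCount_succ, upCount_succ]; ring
    · rw [upCount_succ]; push_cast; ring

lemma comono_mem_gradedMat (hq : q ≠ 0)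
    (ℓ : Fin n → Matrix (Fin 2) (Fin 2) (Matrix (Fin 2) (Fin 2) (Module.End ℂ Fock)))
    (h : ∀ j s t, ℓ j s t ∈ gradedMat q (up s - up t) (1 - 2 * up s)) (s t : Conf n) :
    comono ℓ s t ∈ gradedMat q (upCount s - upCount t) (n - 2 * upCount s) := by
  induction n with
  | zero =>
    obtain rfl := Subsingleton.elim s t
    rw [comono_zero, Matrix.one_apply_eq]
    simpa [upCount] using one_mem_gradedMat
  | succ n ih =>
    rw [comono_succ]
    have := gradedMat_mul hq (h 0 (s 0) (t 0)) (ih (fun j => ℓ j.succ) (fun j => h _)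
      (fun i => s i.succ) (fun i => t i.succ))
    refine gradedMat_cast this ?_ ?_
    · rw [upCount_succ, upCount_succ]; ring
    · rw [upCount_succ]; push_cast; ring

/-- The total spin is diagonal with eigenvalue equal to the number of up spins minus n/2. -/
lemma upCount_eq_of_commute {X : SpinOp n} (hX : Commute (totalSpin n) X) {u v : Conf n}
    (h : X u v ≠ 0) : upCount u = upCount v := by
  have hs : ∀ s : Conf n, (∑ i, if s i = 0 then (1 / 2 : ℂ) else -(1 / 2)) =
      (upCount s : ℂ) - n / 2 := by
    intro s
    have : ∀ i, (if s i = 0 then (1 / 2 : ℂ) else -(1 / 2)) = (up (s i) : ℂ) - 1 / 2 := by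
      intro i
      generalize s i = a
      fin_cases a <;> norm_num [up]
    simp only [this, upCount, Int.cast_sum, Finset.sum_sub_distrib]
    simp
    ring
  have := congrFun (congrFun hX.eq u) v
  rw [totalSpin, Matrix.diagonal_mul, Matrix.mul_diagonal, hs, hs, mul_comm] at this
  have := mul_left_cancel₀ h this
  exact_mod_cast sub_left_injective this

/-- The fused monodromy conjugation, in the block triangular gauge. -/
def fused (hq : q ≠ 0) (ξ : Fin n → ℂ) (ζ : ℂ) (X : SpinOp n) :
    Matrix (Conf n) (Conf n) (Matrix (Fin 2) (Fin 2) (Module.End ℂ Fock)) :=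
  conjBy (fun j => siteF (fockOscillator hq) (ζ / ξ j))
    (fun j => siteFInv (fockOscillator hq) (ζ / ξ j)) X

/-- The inverse monodromy contributes exponent n - 2·up(s) and the monodromy 2·up(t) - n. Spin
conservation makes the intermediate counts cancel in the degree, leaving exponent -2d at degree d.
-/
lemma fused_mem_gradedMat (ξ : Fin n → ℂ) (ζ : ℂ) {X : SpinOp n}
    (hX : Commute (totalSpin n) X) (s t : Conf n) :
    fused hq ξ ζ X s t ∈
      gradedMat q (upCount s - upCount t) (-2 * (upCount s - upCount t)) := by
  rw [fused, conjBy_apply]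
  refine Submodule.sum_mem _ fun u _ => Submodule.sum_mem _ fun v _ => ?_
  by_cases h : X u v = 0
  · rw [h, zero_smul]
    exact zero_mem _
  · refine Submodule.smul_mem _ _ ?_
    have := gradedMat_mul hq
      (comono_mem_gradedMat hq _ (fun j => siteFInv_mem_gradedMat hq (ζ / ξ j)) s u)
      (mono_mem_gradedMat hq _ (fun j => siteF_mem_gradedMat hq (ζ / ξ j)) v t)
    rw [upCount_eq_of_commute hX h] at this
    exact gradedMat_cast this (by ring) (by ring)

lemma fused_apply_mem_homOp (ξ : Fin n → ℂ) (ζ : ℂ) {X : SpinOp n}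
    (hX : Commute (totalSpin n) X) (s t : Conf n) (a b : Fin 2) :
    ∃ d, fused hq ξ ζ X s t a b ∈ homOp q d (-2 * d) := by
  exact ⟨_, homOp_cast (fused_mem_gradedMat hq ξ ζ hX s t a b) rfl (by ring)⟩

/-- A nonzero trace needs total degree zero, that is d = -e; the exponents are then at least -2d + p
= p + 2e. The element g has weight exactly 0 and is the borderline case. -/
lemma tau_mul_eq_zero {η : ℂ} (hη : NotRootOfUnity η) {d e p : ℤ} {y w : Module.End ℂ Fock}
    (hy : y ∈ homOp (Complex.exp η) d (-2 * d)) (hw : w ∈ homOp (Complex.exp η) e p)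
    (h : 0 < p + 2 * e) : tau η (y * w) = 0 :=
  tau_of_mem_homOp hη (by omega) (homOp_mul (Complex.exp_ne_zero η) hy hw)

end Grading

/-! ### Analytic dependence of the site matrices on ζ. -/

section SiteFamilies

variable {q : ℂ} {hq : q ≠ 0} {S : Subalgebra ℂ (ℂ → ℂ)}

lemma families_add {x y : ℂ → Module.End ℂ Fock} (hx : x ∈ families q hq S)
    (hy : y ∈ families q hq S) : (fun ζ => x ζ + y ζ) ∈ families q hq S :=
  add_mem hx hy

lemma families_const {d p : ℤ} {w : Module.End ℂ Fock} (hw : w ∈ homOp q d p) :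
    (fun _ => w) ∈ families q hq S := by
  have := smul_mem_families (hq := hq) (one_mem S) hw
  simpa using this

lemma families_smul {f : ℂ → ℂ} (hf : f ∈ S) {x : ℂ → Module.End ℂ Fock}
    (hx : x ∈ families q hq S) : (fun ζ => f ζ • x ζ) ∈ families q hq S := by
  have := mul_mem (smul_mem_families (hq := hq) hf one_mem_homOp) hx
  convert this using 1
  funext ζ
  simp

lemma K_families (m : ℤ) : (fun _ => (fockOscillator hq).K m) ∈ families q hq S :=
  families_const (K_mem hq le_rfl)

lemma cr_K_families (m : ℤ) :
    (fun _ => (fockOscillator hq).cr * (fockOscillator hq).K m) ∈ families q hq S :=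
  families_const (cr_K_mem hq le_rfl)

lemma an_K_families (m : ℤ) :
    (fun _ => (fockOscillator hq).an * (fockOscillator hq).K m) ∈ families q hq S :=
  families_const (an_K_mem hq le_rfl)

variable {ξ c : ℂ}

lemma siteM_families (s t : Fin 2) :
    (fun ζ => siteM (fockOscillator hq) (ζ / ξ) s t) ∈ families q hq ⊤ := by
  fin_cases s <;> fin_cases t
  · exact K_families 1
  · exact families_smul (f := fun ζ => -(ζ / ξ)) Algebra.mem_top (cr_K_families _)
  · exact families_smul (f := fun ζ => -(ζ / ξ)) Algebra.mem_top (an_K_families _)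
  · exact families_add (K_families _)
      (families_smul (f := fun ζ => -((ζ / ξ) ^ 2 * q ^ 2)) Algebra.mem_top (K_families _))

lemma siteMInv_families (s t : Fin 2) :
    (fun ζ => siteMInv (fockOscillator hq) (ζ / ξ) s t) ∈ families q hq ⊤ := by
  simp only [siteMInv, Matrix.smul_apply]
  refine families_smul (f := fun ζ => (1 - (ζ / ξ) ^ 2)⁻¹) Algebra.mem_top ?_
  fin_cases s <;> fin_cases t
  · exact families_add (K_families _)
      (families_smul (f := fun ζ => -(ζ / ξ) ^ 2) Algebra.mem_top (K_families _))
  · exact families_smul (f := fun ζ => ζ / ξ * q⁻¹) Algebra.mem_top (cr_K_families _)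
  · exact families_smul (f := fun ζ => ζ / ξ * q⁻¹) Algebra.mem_top (an_K_families _)
  · exact K_families _

lemma analyticAt_div : AnalyticAt ℂ (fun ζ => ζ / ξ) c := by fun_prop

lemma siteA_families (hc : Regular q (c / ξ)) (s t : Fin 2) :
    (fun ζ => siteA (fockOscillator hq) (ζ / ξ) s t) ∈ families q hq (analyticFns c) := by
  have h0 := hc.ne_zero
  simp only [siteA, Matrix.smul_apply]
  refine families_smul (f := fun ζ => q * (ζ / ξ) - q⁻¹ * (ζ / ξ)⁻¹)
    ((analyticAt_const.mul analyticAt_div).sub (analyticAt_const.mul (analyticAt_div.inv h0))) ?_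
  fin_cases s <;> fin_cases t
  · exact K_families _
  · exact families_smul (f := fun ζ => -(ζ / ξ * q⁻¹))
      (analyticAt_div.mul analyticAt_const).neg (cr_K_families _)
  · exact families_smul (f := fun ζ => -(ζ / ξ)) analyticAt_div.neg (an_K_families _)
  · exact families_add (families_smul (f := fun _ => q) analyticAt_const (K_families _))
      (families_smul (f := fun ζ => -(q * (ζ / ξ) ^ 2))
        (analyticAt_const.mul (analyticAt_div.pow 2)).neg (K_families _))

lemma siteAInv_families (hc : Regular q (c / ξ)) (s t : Fin 2) :
    (fun ζ => siteAInv (fockOscillator hq) (ζ / ξ) s t) ∈ families q hq (analyticFns c) := by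
  obtain ⟨h0, h1, h2⟩ := hc
  simp only [siteAInv, Matrix.smul_apply]
  refine families_smul (f := fun ζ => q ^ 3 * (ζ / ξ) * (q ^ 2 * (ζ / ξ) ^ 2 - 1)⁻¹ *
    (q ^ 2 - (ζ / ξ) ^ 2)⁻¹) (((analyticAt_const.mul analyticAt_div).mul
      (((analyticAt_const.mul (analyticAt_div.pow 2)).sub analyticAt_const).inv h2)).mul
      ((analyticAt_const.sub (analyticAt_div.pow 2)).inv h1)) ?_
  fin_cases s <;> fin_cases t
  · exact families_add (K_families _) (families_smul (f := fun ζ => -((ζ / ξ) ^ 2 * q⁻¹ ^ 2))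
      ((analyticAt_div.pow 2).mul analyticAt_const).neg (K_families _))
  · exact families_smul (f := fun ζ => ζ / ξ * q⁻¹ ^ 3)
      (analyticAt_div.mul analyticAt_const) (cr_K_families _)
  · exact families_smul (f := fun ζ => ζ / ξ * q⁻¹ ^ 2)
      (analyticAt_div.mul analyticAt_const) (an_K_families _)
  · exact families_smul (f := fun _ => q⁻¹) analyticAt_const (K_families _)

lemma siteB_families (s t : Fin 2) :
    (fun ζ => siteB (fockOscillator hq) (ζ / ξ) s t) ∈ families q hq (analyticFns c) := by
  fin_cases s <;> fin_cases t
  · exact K_families _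
  · exact families_smul (f := fun ζ => -(q * (ζ / ξ)))
      (analyticAt_const.mul analyticAt_div).neg (cr_K_families _)
  · exact families_smul (f := fun ζ => -(ζ / ξ)) analyticAt_div.neg (an_K_families _)
  · exact families_add (families_smul (f := fun _ => q⁻¹) analyticAt_const (K_families _))
      (families_smul (f := fun ζ => -(q ^ 3 * (ζ / ξ) ^ 2))
        (analyticAt_const.mul (analyticAt_div.pow 2)).neg (K_families _))

lemma siteBInv_families (hc : Regular q (c / ξ)) (s t : Fin 2) :
    (fun ζ => siteBInv (fockOscillator hq) (ζ / ξ) s t) ∈ families q hq (analyticFns c) := by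
  have h2 : 1 - q ^ 2 * (c / ξ) ^ 2 ≠ 0 := fun h => hc.mul_sub_ne (by linear_combination -h)
  simp only [siteBInv, Matrix.smul_apply]
  refine families_smul (f := fun ζ => (1 - q ^ 2 * (ζ / ξ) ^ 2)⁻¹)
    ((analyticAt_const.sub (analyticAt_const.mul (analyticAt_div.pow 2))).inv h2) ?_
  fin_cases s <;> fin_cases t
  · exact families_add (K_families _) (families_smul (f := fun ζ => -(q ^ 2 * (ζ / ξ) ^ 2))
      (analyticAt_const.mul (analyticAt_div.pow 2)).neg (K_families _))
  · exact families_smul (f := fun ζ => q * (ζ / ξ))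
      (analyticAt_const.mul analyticAt_div) (cr_K_families _)
  · exact families_smul (f := fun ζ => ζ / ξ) analyticAt_div (an_K_families _)
  · exact families_smul (f := fun _ => q) analyticAt_const (K_families _)

lemma siteC_families (s t : Fin 2) :
    (fun ζ => siteC (fockOscillator hq) (ζ / ξ) s t) ∈ families q hq (analyticFns c) := by
  simp only [siteC, Matrix.smul_apply]
  refine families_smul (f := fun _ => q - q⁻¹) analyticAt_const ?_
  fin_cases s <;> fin_cases t
  · exact zero_mem _
  · exact K_families _
  · exact zero_mem _
  · exact families_smul (f := fun ζ => -(ζ / ξ)) analyticAt_div.neg (an_K_families _)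

lemma siteCInv_families (hS : analyticFns c ≤ S)
    (hb : (fun ζ => (ζ / ξ - (ζ / ξ)⁻¹)⁻¹) ∈ S) (hc : Regular q (c / ξ)) (s t : Fin 2) :
    (fun ζ => siteCInv (fockOscillator hq) (ζ / ξ) s t) ∈ families q hq S := by
  have hf : (fun ζ => -((q - q⁻¹) * (ζ / ξ - (ζ / ξ)⁻¹)⁻¹)) ∈ S :=
    neg_mem (mul_mem (S.algebraMap_mem (q - q⁻¹)) hb)
  have h0 := families_smul hf (families_mono hS (siteAInv_families (hq := hq) hc 1 0))
  have h1 := families_smul hf (families_mono hS (siteAInv_families (hq := hq) hc 1 1))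
  have h2 := families_smul hf (zero_mem (families q hq S))
  simp only [siteCInv, Matrix.smul_apply]
  fin_cases s <;> fin_cases t
  · exact h0
  · exact h1
  · exact h2
  · exact h2

lemma mem_matrixFamilies {A B C : ℂ → Module.End ℂ Fock} (hA : A ∈ families q hq S)
    (hB : B ∈ families q hq S) (hC : C ∈ families q hq S) :
    (fun ζ => !![A ζ, 0; C ζ, B ζ]) ∈ matrixFamilies (families q hq S) := by
  intro a b
  fin_cases a <;> fin_cases b
  · exact hA
  · exact zero_mem _
  · exact hC
  · exact hB

lemma siteF_families (hS : analyticFns c ≤ S) (hc : Regular q (c / ξ)) (s t : Fin 2) :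
    (fun ζ => siteF (fockOscillator hq) (ζ / ξ) s t) ∈ matrixFamilies (families q hq S) := by
  have hB := families_smul (f := fun ζ => ζ / ξ - (ζ / ξ)⁻¹)
      (hS (analyticAt_div.sub (analyticAt_div.inv hc.ne_zero)))
      (families_mono hS (siteB_families (hq := hq) (ξ := ξ) (c := c) s t))
  simp only [siteF, lowerTri, Matrix.of_apply, Matrix.smul_apply]
  exact mem_matrixFamilies (families_mono hS (siteA_families hc s t)) hB
    (families_mono hS (siteC_families s t))

lemma siteFInv_families (hS : analyticFns c ≤ S)
    (hb : (fun ζ => (ζ / ξ - (ζ / ξ)⁻¹)⁻¹) ∈ S) (hc : Regular q (c / ξ)) (s t : Fin 2) :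
    (fun ζ => siteFInv (fockOscillator hq) (ζ / ξ) s t) ∈ matrixFamilies (families q hq S) := by
  have hB := families_smul hb (families_mono hS (siteBInv_families (hq := hq) hc s t))
  simp only [siteFInv, lowerTri, Matrix.of_apply, Matrix.smul_apply]
  exact mem_matrixFamilies (families_mono hS (siteAInv_families hc s t)) hB
    (siteCInv_families hS hb hc s t)

end SiteFamilies

/-! ### Analyticity of the blocks of the fused conjugation. -/

section FusedFamilies

variable {q : ℂ} {hq : q ≠ 0} {S : Subalgebra ℂ (ℂ → ℂ)} {n : ℕ} {ξ : Fin n → ℂ} {c : ℂ}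

lemma fused_families (hS : analyticFns c ≤ S)
    (hb : ∀ j, (fun ζ => (ζ / ξ j - (ζ / ξ j)⁻¹)⁻¹) ∈ S) (hc : ∀ j, Regular q (c / ξ j))
    (X : SpinOp n) (s t : Conf n) (a b : Fin 2) :
    (fun ζ => fused hq ξ ζ X s t a b) ∈ families q hq S :=
  conjBy_mem (matrixFamilies (families q hq S))
    (fun ζ j => siteF (fockOscillator hq) (ζ / ξ j))
    (fun ζ j => siteFInv (fockOscillator hq) (ζ / ξ j)) (fun j => siteF_families hS (hc j)) (fun j
      => siteFInv_families hS (hb j) (hc j)) X s t a b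

lemma meromorphic_inv_sub (ξ c : ℂ) :
    (fun ζ => (ζ / ξ - (ζ / ξ)⁻¹)⁻¹) ∈ meromorphicFns c := by
  have h : MeromorphicAt (fun ζ => ζ / ξ) c := analyticAt_div.meromorphicAt
  exact (h.sub h.inv).inv

/-- The fused monodromy matrix is regular and invertible at `ζ`. -/
def Generic (q : ℂ) (ξ : Fin n → ℂ) (ζ : ℂ) : Prop :=
  ∀ j, Regular q (ζ / ξ j) ∧ (ζ / ξ j) ^ 2 - 1 ≠ 0

lemma eventually_regular {ξ : ℂ} (hc : Regular q (c / ξ)) : ∀ᶠ ζ in 𝓝 c, Regular q (ζ / ξ) := by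
  have h0 : ContinuousAt (fun ζ : ℂ => ζ / ξ) c := by fun_prop
  have h1 : ContinuousAt (fun ζ : ℂ => q ^ 2 - (ζ / ξ) ^ 2) c := by fun_prop
  have h2 : ContinuousAt (fun ζ : ℂ => q ^ 2 * (ζ / ξ) ^ 2 - 1) c := by fun_prop
  filter_upwards [h0.eventually_ne hc.ne_zero, h1.eventually_ne hc.sub_ne,
    h2.eventually_ne hc.mul_sub_ne] with ζ h0 h1 h2 using ⟨h0, h1, h2⟩

lemma eventually_ne_punctured (c a : ℂ) : ∀ᶠ ζ in 𝓝[≠] c, ζ ≠ a := by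
  by_cases h : c = a
  · subst h
    exact self_mem_nhdsWithin
  · exact eventually_nhdsWithin_of_eventually_nhds (eventually_ne_nhds h)

lemma eventually_generic (hc : ∀ j, Regular q (c / ξ j)) : ∀ᶠ ζ in 𝓝[≠] c, Generic q ξ ζ := by
  refine eventually_all.2 fun j => ?_
  have hξ : ξ j ≠ 0 := fun h => (hc j).ne_zero (by simp [h])
  filter_upwards [eventually_nhdsWithin_of_eventually_nhds (eventually_regular (hc j)),
    eventually_ne_punctured c (ξ j), eventually_ne_punctured c (-ξ j)] with ζ h h1 h2
  refine ⟨h, fun h3 => ?_⟩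
  -- The condition w² = 1 holds only at ζ = ±ξ_j, two points that a punctured neighbourhood avoids.
  have : (ζ - ξ j) * (ζ - -ξ j) = 0 := by
    field_simp at h3
    linear_combination h3
  rcases mul_eq_zero.1 this with h | h
  · exact h1 (sub_eq_zero.1 h)
  · exact h2 (sub_eq_zero.1 h)

lemma mono_lowerTri {𝒜 : Type*} [Ring 𝒜] (A B C : Fin n → Matrix (Fin 2) (Fin 2) 𝒜) (s t : Conf n) :
    mono (fun j => lowerTri (A j) (B j) (C j)) s t 0 0 = mono A s t ∧
    mono (fun j => lowerTri (A j) (B j) (C j)) s t 0 1 = 0 ∧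
    mono (fun j => lowerTri (A j) (B j) (C j)) s t 1 1 = mono B s t := by
  induction n with
  | zero =>
    obtain rfl := Subsingleton.elim s t
    simp [mono_zero]
  | succ n ih =>
    obtain ⟨h1, h2, h3⟩ := ih (fun j => A j.succ) (fun j => B j.succ) (fun j => C j.succ)
      (fun i => s i.succ) (fun i => t i.succ)
    simp only [mono_succ, Matrix.mul_apply, Fin.sum_univ_two, h1, h2, h3]
    simp [lowerTri]

lemma comono_lowerTri {𝒜 : Type*} [Ring 𝒜] (A B C : Fin n → Matrix (Fin 2) (Fin 2) 𝒜)
    (s t : Conf n) :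
    comono (fun j => lowerTri (A j) (B j) (C j)) s t 0 0 = comono A s t ∧
    comono (fun j => lowerTri (A j) (B j) (C j)) s t 0 1 = 0 ∧
    comono (fun j => lowerTri (A j) (B j) (C j)) s t 1 1 = comono B s t := by
  induction n with
  | zero =>
    obtain rfl := Subsingleton.elim s t
    simp [comono_zero]
  | succ n ih =>
    obtain ⟨h1, h2, h3⟩ := ih (fun j => A j.succ) (fun j => B j.succ) (fun j => C j.succ)
      (fun i => s i.succ) (fun i => t i.succ)
    simp only [comono_succ, Matrix.mul_apply, Fin.sum_univ_two, h1, h2, h3]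
    simp [lowerTri]

lemma fused_zero_zero (ζ : ℂ) (X : SpinOp n) (s t : Conf n) :
    fused hq ξ ζ X s t 0 0 = conjBy (fun j => siteA (fockOscillator hq) (ζ / ξ j))
      (fun j => siteAInv (fockOscillator hq) (ζ / ξ j)) X s t := by
  rw [fused, conjBy_apply, conjBy_apply]
  simp only [Matrix.sum_apply, Matrix.smul_apply, Matrix.mul_apply, Fin.sum_univ_two]
  simp only [siteF, siteFInv, mono_lowerTri, comono_lowerTri, zero_mul, add_zero]

lemma fused_zero_one (ζ : ℂ) (X : SpinOp n) (s t : Conf n) : fused hq ξ ζ X s t 0 1 = 0 := by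
  rw [fused, conjBy_apply]
  simp only [Matrix.sum_apply, Matrix.smul_apply, Matrix.mul_apply, Fin.sum_univ_two]
  simp only [siteF, siteFInv, mono_lowerTri, comono_lowerTri, zero_mul, mul_zero, add_zero,
    smul_zero, Finset.sum_const_zero]

/-- The scalars w - w⁻¹ and their inverses cancel, so the lower diagonal block agrees, away from the
singular points, with an expression analytic there. -/
lemma fused_one_one {ζ : ℂ} (hζ : Generic q ξ ζ) (X : SpinOp n) (s t : Conf n) :
    fused hq ξ ζ X s t 1 1 = conjBy (fun j => siteB (fockOscillator hq) (ζ / ξ j))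
      (fun j => siteBInv (fockOscillator hq) (ζ / ξ j)) X s t := by
  rw [← conjBy_smul (fun j => ζ / ξ j - (ζ / ξ j)⁻¹)
    (fun j => sub_inv_ne_zero (hζ j).2 (hζ j).1.ne_zero), fused, conjBy_apply, conjBy_apply]
  simp only [Matrix.sum_apply, Matrix.smul_apply, Matrix.mul_apply, Fin.sum_univ_two]
  simp only [siteF, siteFInv, mono_lowerTri, comono_lowerTri, mul_zero, zero_add]

lemma fused_zero_zero_families (hc : ∀ j, Regular q (c / ξ j)) (X : SpinOp n) (s t : Conf n) :
    (fun ζ => fused hq ξ ζ X s t 0 0) ∈ families q hq (analyticFns c) := by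
  simp only [fused_zero_zero]
  exact conjBy_mem (families q hq (analyticFns c))
    (fun ζ j => siteA (fockOscillator hq) (ζ / ξ j))
    (fun ζ j => siteAInv (fockOscillator hq) (ζ / ξ j)) (fun j => siteA_families (hc j)) (fun j =>
      siteAInv_families (hc j)) X s t

lemma conjBy_siteB_families (hc : ∀ j, Regular q (c / ξ j)) (X : SpinOp n) (s t : Conf n) :
    (fun ζ => conjBy (fun j => siteB (fockOscillator hq) (ζ / ξ j))
      (fun j => siteBInv (fockOscillator hq) (ζ / ξ j)) X s t) ∈ families q hq (analyticFns c) :=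
  conjBy_mem (families q hq (analyticFns c))
    (fun ζ j => siteB (fockOscillator hq) (ζ / ξ j))
    (fun ζ j => siteBInv (fockOscillator hq) (ζ / ξ j)) (fun _ => siteB_families) (fun j =>
      siteBInv_families (hc j)) X s t

end FusedFamilies

/-! ### Fusion of the two monodromy matrices. -/

section Fusion

variable {𝒜 : Type*} [Ring 𝒜] [Algebra ℂ 𝒜] {q : ℂ} (O : Oscillator q 𝒜) {n : ℕ}
  {ξ : Fin n → ℂ} {ζ : ℂ}

lemma map_conj_mul {ι ℬ : Type*} [Fintype ι] [Ring ℬ] {G G' : ℬ} (h : G' * G = 1)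
    (M N : Matrix ι ι ℬ) :
    (M.map fun x => G * x * G') * (N.map fun x => G * x * G') =
      (M * N).map fun x => G * x * G' := by
  ext s t
  simp only [Matrix.mul_apply, Matrix.map_apply, Finset.mul_sum, Finset.sum_mul]
  refine Finset.sum_congr rfl fun u _ => ?_
  calc G * M s u * G' * (G * N u t * G') = G * M s u * (G' * G) * N u t * G' := by
        simp only [mul_assoc]
    _ = G * (M s u * N u t) * G' := by rw [h]; simp only [mul_assoc, one_mul]

lemma commute_scalar_mapMatrix (y : 𝒜) (r : Matrix (Fin 2) (Fin 2) ℂ) :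
    Commute (Matrix.scalar (Fin 2) y) ((algebraMap ℂ 𝒜).mapMatrix r) := by
  ext a b
  simp only [Matrix.scalar_apply, RingHom.mapMatrix_apply, Matrix.diagonal_mul,
    Matrix.mul_diagonal, Matrix.map_apply]
  exact (Algebra.commutes _ _).symm

/-- The site-by-site fusion identity lifts to the chain: conjugating by the oscillator monodromy and
then by the six-vertex one is, up to the gauge, conjugation by the triangular monodromy. -/
lemma conjBy_siteF_gauge (hq : q ≠ 0) (hζ : Generic q ξ ζ) (X : SpinOp n) :
    (comono fun j => siteRInv q (ζ / ξ j)).map (algebraMap ℂ 𝒜).mapMatrix *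
      (conjBy (fun j => siteM O (ζ / ξ j)) (fun j => siteMInv O (ζ / ξ j)) X).map
        (Matrix.scalar (Fin 2)) *
      (mono fun j => siteR q (ζ / ξ j)).map (algebraMap ℂ 𝒜).mapMatrix =
    (conjBy (fun j => siteF O (ζ / ξ j)) (fun j => siteFInv O (ζ / ξ j)) X).map
      fun x => gauge O * x * gaugeInv O := by
  set ιA : 𝒜 →+* Matrix (Fin 2) (Fin 2) 𝒜 := Matrix.scalar (Fin 2)
  set ιa : Matrix (Fin 2) (Fin 2) ℂ →+* Matrix (Fin 2) (Fin 2) 𝒜 := (algebraMap ℂ 𝒜).mapMatrix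
  set M := fun j => siteM O (ζ / ξ j)
  set M' := fun j => siteMInv O (ζ / ξ j)
  set R := fun j => siteR q (ζ / ξ j)
  set R' := fun j => siteRInv q (ζ / ξ j)
  set F := fun j => siteF O (ζ / ξ j)
  set F' := fun j => siteFInv O (ζ / ξ j)
  have hP : (mono M).map ιA * (mono R).map ιa = (mono F).map fun x => gauge O * x * gaugeInv O := by
    rw [← mono_map, ← mono_map, ← mono_mul_of_commute, ← mono_conj _ _ (gaugeInv_mul_gauge O)
      (gauge_mul_gaugeInv O)]
    · congr 1
      funext j
      exact siteM_mul_siteR O hq (hζ j).1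
    · exact fun i j a b c d => commute_scalar_mapMatrix _ _
  have hQ : (comono R').map ιa * (comono M').map ιA =
      (comono F').map fun x => gauge O * x * gaugeInv O := by
    -- Both sides invert the same fused monodromy, so no separate fusion computation for the
    -- inverses is needed.
    refine left_inv_eq_right_inv (a := (mono M).map ιA * (mono R).map ιa) ?_ ?_
    · rw [mul_assoc, ← mul_assoc (Matrix.map (comono M') ιA), ← Matrix.map_mul,
        comono_mul_mono _ _ fun j => siteMInv_mul_siteM O hq (hζ j).2,
        Matrix.map_one _ (map_zero _) (map_one _), one_mul, ← Matrix.map_mul,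
        comono_mul_mono _ _ fun j => siteRInv_mul_siteR hq (hζ j).1,
        Matrix.map_one _ (map_zero _) (map_one _)]
    · rw [hP, map_conj_mul (gaugeInv_mul_gauge O),
        mono_mul_comono _ _ fun j => siteF_mul_siteFInv O hq (hζ j).1 (hζ j).2]
      exact Matrix.map_one _ (by simp) (by simpa using gauge_mul_gaugeInv O)
  -- The entries of X are scalars and hence invariant under the gauge.
  have hX : (X.map (algebraMap ℂ 𝒜)).map ιA =
      (X.map (algebraMap ℂ (Matrix (Fin 2) (Fin 2) 𝒜))).map fun x => gauge O * x * gaugeInv O := by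
    ext1 s t
    rw [Matrix.map_apply, Matrix.map_apply, Matrix.map_apply, Matrix.map_apply,
      ← Algebra.commutes, mul_assoc, gauge_mul_gaugeInv, mul_one]
    ext a b
    simp [ιA, Matrix.diagonal_apply, Matrix.algebraMap_matrix_apply]
  rw [conjBy, conjBy, Matrix.map_mul, Matrix.map_mul, ← map_conj_mul (gaugeInv_mul_gauge O),
    ← map_conj_mul (gaugeInv_mul_gauge O), ← hP, ← hQ, ← hX]
  simp only [mul_assoc]

/-- The matrix trace over noncommuting entries is not invariant under the gauge; the defect is the
commutator of g with the corner of f. -/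
lemma gauge_trace (f : Matrix (Fin 2) (Fin 2) 𝒜) :
    (gauge O * f * gaugeInv O) 0 0 + (gauge O * f * gaugeInv O) 1 1 =
      f 0 0 + f 1 1 + gaugeElem O * f 1 0 + (-1 : ℂ) • (f 1 0 * gaugeElem O) := by
  simp only [gauge, gaugeInv, Matrix.mul_apply, Fin.sum_univ_two]
  simp
  abel

lemma sandwich_trace (P N : Matrix (Conf n) (Conf n) (Matrix (Fin 2) (Fin 2) ℂ))
    (Y : Matrix (Conf n) (Conf n) 𝒜) (s t : Conf n) (a : Fin 2) :
    (P.map (algebraMap ℂ 𝒜).mapMatrix * Y.map (Matrix.scalar (Fin 2)) *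
      N.map (algebraMap ℂ 𝒜).mapMatrix) s t a a =
      ∑ u, ∑ v, (P s u * N v t) a a • Y u v := by
  have h : (P.map (algebraMap ℂ 𝒜).mapMatrix * Y.map (Matrix.scalar (Fin 2)) *
      N.map (algebraMap ℂ 𝒜).mapMatrix) s t =
      ∑ u, ∑ v, Matrix.scalar (Fin 2) (Y u v) * (algebraMap ℂ 𝒜).mapMatrix (P s u * N v t) := by
    rw [Finset.sum_comm]
    simp only [Matrix.mul_apply, Matrix.map_apply, Finset.sum_mul]
    refine Finset.sum_congr rfl fun v _ => Finset.sum_congr rfl fun u _ => ?_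
    rw [← (commute_scalar_mapMatrix _ _).eq, mul_assoc, ← map_mul]
  rw [h]
  simp only [Matrix.sum_apply]
  refine Finset.sum_congr rfl fun u _ => Finset.sum_congr rfl fun v _ => ?_
  rw [Matrix.scalar_apply, Matrix.diagonal_mul, RingHom.mapMatrix_apply, Matrix.map_apply,
    ← Algebra.commutes, Algebra.smul_def]

lemma fusion_trace (hq : q ≠ 0) (hζ : Generic q ξ ζ) (X : SpinOp n) (s t : Conf n)
    {f : Matrix (Fin 2) (Fin 2) 𝒜}
    (hf : f = conjBy (fun j => siteF O (ζ / ξ j)) (fun j => siteFInv O (ζ / ξ j)) X s t) :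
    ∑ u, ∑ v, (comono (fun j => siteRInv q (ζ / ξ j)) s u *
        mono (fun j => siteR q (ζ / ξ j)) v t).trace •
        conjBy (fun j => siteM O (ζ / ξ j)) (fun j => siteMInv O (ζ / ξ j)) X u v =
      f 0 0 + f 1 1 + gaugeElem O * f 1 0 + (-1 : ℂ) • (f 1 0 * gaugeElem O) := by
  have key := congrFun (congrFun (conjBy_siteF_gauge O hq hζ X) s) t
  rw [Matrix.map_apply, ← hf] at key
  rw [← gauge_trace, ← congrFun (congrFun key 0) 0, ← congrFun (congrFun key 1) 1,
    sandwich_trace, sandwich_trace, ← Finset.sum_add_distrib]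
  simp only [← Finset.sum_add_distrib, ← add_smul]
  simp only [Matrix.trace_fin_two]

end Fusion

/-! ### From the operator H(ζ;α) to traces of the fused blocks. -/

section Transfer

variable {q : ℂ}

/-- The scalar prefactor of `L⁺`. -/
def prefactor (q w : ℂ) : ℂ := Complex.I * w ^ (-(1 / 2) : ℂ) * q ^ (-(1 / 4) : ℂ)

lemma prefactor_ne_zero {w : ℂ} (hq : q ≠ 0) (hw : w ≠ 0) : prefactor q w ≠ 0 := by
  simp [prefactor, Complex.cpow_eq_zero_iff, hq, hw]

lemma Lplus_eq (hq : q ≠ 0) (w : ℂ) : Lplus q w = prefactor q w • siteM (fockOscillator hq) w := by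
  rw [Lplus, prefactor]
  congr 1
  ext1 s t
  fin_cases s <;> fin_cases t
  · simp [Matrix.mul_apply, siteM, fockOscillator]
  · refine LinearMap.ext fun x => ?_
    simp [Matrix.mul_apply, siteM, fockOscillator]
  · refine LinearMap.ext fun x => ?_
    simp [Matrix.mul_apply, siteM, fockOscillator]
  · refine LinearMap.ext fun x => ?_
    have : qD q 2 (qD q (-1) x) = qD q 1 x := by
      rw [← Module.End.mul_apply, qD_mul_qD hq]
      rfl
    simp [Matrix.mul_apply, siteM, fockOscillator, this]
    exact sub_eq_add_neg _ _

variable {n : ℕ} {ξ : Fin n → ℂ} {ζ : ℂ}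

lemma monodromy_Lplus (hq : q ≠ 0) (hζ : Generic q ξ ζ) :
    IsUnit (monodromy (Lplus q) ξ ζ) ∧ ∀ X, invAdjoint (monodromy (Lplus q) ξ ζ) X =
      conjBy (fun j => siteM (fockOscillator hq) (ζ / ξ j))
        (fun j => siteMInv (fockOscillator hq) (ζ / ξ j)) X := by
  have hp : ∀ j, prefactor q (ζ / ξ j) ≠ 0 := fun j => prefactor_ne_zero hq (hζ j).1.ne_zero
  rw [monodromy_eq_mono]
  simp only [Lplus_eq hq]
  have h : ∀ j, (prefactor q (ζ / ξ j) • siteM (fockOscillator hq) (ζ / ξ j)) *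
      ((prefactor q (ζ / ξ j))⁻¹ • siteMInv (fockOscillator hq) (ζ / ξ j)) = 1 := by
    intro j
    rw [smul_mul_smul_comm, mul_inv_cancel₀ (hp j), one_smul, siteM_mul_siteMInv _ hq (hζ j).2]
  have h' : ∀ j, ((prefactor q (ζ / ξ j))⁻¹ • siteMInv (fockOscillator hq) (ζ / ξ j)) *
      (prefactor q (ζ / ξ j) • siteM (fockOscillator hq) (ζ / ξ j)) = 1 := by
    intro j
    rw [smul_mul_smul_comm, inv_mul_cancel₀ (hp j), one_smul, siteMInv_mul_siteM _ hq (hζ j).2]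
  exact ⟨isUnit_mono _ _ h h', fun X => by
    rw [invAdjoint_mono _ _ h h', conjBy_smul _ hp]⟩

lemma monodromy_Lsix (hq : q ≠ 0) (hζ : Generic q ξ ζ) :
    IsUnit (monodromy (Lsix q) ξ ζ) ∧ ∀ X, invAdjoint (monodromy (Lsix q) ξ ζ) X =
      conjBy (fun j => siteR q (ζ / ξ j)) (fun j => siteRInv q (ζ / ξ j)) X := by
  have hR : (fun j => Lsix q (ζ / ξ j)) = fun j => siteR q (ζ / ξ j) :=
    funext fun j => Lsix_eq_siteR hq (hζ j).1
  rw [monodromy_eq_mono, hR]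
  have h := fun j => siteR_mul_siteRInv hq (hζ j).1
  have h' := fun j => siteRInv_mul_siteR hq (hζ j).1
  exact ⟨isUnit_mono _ _ h h', fun X => invAdjoint_mono _ _ h h' X⟩

/-- Twisted cyclicity turns the commutator defect into (q^{2α} - 1) tr(q^{2αD} f₁₀ g). The
traceability hypotheses allow the continued trace to be split term by term. -/
lemma HOp_eq {η α : ℂ} (hζ : Generic (Complex.exp η) ξ ζ) (X : SpinOp n) (s t : Conf n)
    (hY : ∀ u v, conjBy (fun j => siteM (fockOscillator (Complex.exp_ne_zero η)) (ζ / ξ j))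
      (fun j => siteMInv (fockOscillator (Complex.exp_ne_zero η)) (ζ / ξ j)) X u v ∈ Traceable η α)
    (h00 : fused (Complex.exp_ne_zero η) ξ ζ X s t 0 0 ∈ Traceable η α)
    (h11 : fused (Complex.exp_ne_zero η) ξ ζ X s t 1 1 ∈ Traceable η α)
    (h10 : fused (Complex.exp_ne_zero η) ξ ζ X s t 1 0 *
      gaugeElem (fockOscillator (Complex.exp_ne_zero η)) ∈ Traceable η α) :
    HOp η ξ ζ α X s t =
      weightedTrace η α (fused (Complex.exp_ne_zero η) ξ ζ X s t 0 0) +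
      weightedTrace η α (fused (Complex.exp_ne_zero η) ξ ζ X s t 1 1) +
      (Complex.exp (2 * α * η) - 1) * weightedTrace η α
        (fused (Complex.exp_ne_zero η) ξ ζ X s t 1 0 *
          gaugeElem (fockOscillator (Complex.exp_ne_zero η))) := by
  set q := Complex.exp η
  set hq := Complex.exp_ne_zero η
  set f := fused hq ξ ζ X s t with hf
  have hg : gaugeElem (fockOscillator hq) * f 1 0 ∈ Traceable η α ∧
      weightedTrace η α (gaugeElem (fockOscillator hq) * f 1 0) =
        Complex.exp (2 * α * η) * weightedTrace η α (f 1 0 * gaugeElem (fockOscillator hq)) := by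
    -- Multiplying by q removes the normalisation q⁻¹ of the gauge element.
    have h : f 1 0 * (creation * qD q (-2)) ∈ Traceable η α := by
      have := Submodule.smul_mem _ q h10
      rwa [gaugeElem, mul_smul_comm, smul_smul, mul_inv_cancel₀ hq, one_smul] at this
    obtain ⟨h1, h2⟩ := creation_qD_mul (-2) h
    refine ⟨?_, ?_⟩
    · rw [gaugeElem, smul_mul_assoc]
      exact Submodule.smul_mem _ _ h1
    · rw [gaugeElem, smul_mul_assoc, mul_smul_comm]
      refine (weightedTrace_smul _ h1).trans ?_
      rw [h2]
      refine Eq.trans ?_ (congrArg _ (weightedTrace_smul _ h).symm)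
      ring
  rw [HOp, tOp, QOp, (monodromy_Lplus hq hζ).2, (monodromy_Lsix hq hζ).2, Matrix.map_apply,
    conjBy_apply]
  have hs : ∀ u v : Conf n, (comono (fun j => siteRInv q (ζ / ξ j)) s u *
      mono (fun j => siteR q (ζ / ξ j)) v t).trace •
      conjBy (fun j => siteM (fockOscillator hq) (ζ / ξ j))
        (fun j => siteMInv (fockOscillator hq) (ζ / ξ j)) X u v ∈ Traceable η α :=
    fun u v => Submodule.smul_mem _ _ (hY u v)
  have key := congrArg (weightedTrace η α) (fusion_trace (fockOscillator hq) hq hζ X s t (f := f)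
    rfl)
  rw [weightedTrace_sum _ _ fun u _ => Submodule.sum_mem _ fun v _ => hs u v] at key
  simp only [weightedTrace_sum _ _ fun v _ => hs _ v, weightedTrace_smul _ (hY _ _)] at key
  rw [weightedTrace_add (add_mem (add_mem h00 h11) hg.1) (Submodule.smul_mem _ _ h10),
    weightedTrace_add (add_mem h00 h11) hg.1, weightedTrace_add h00 h11,
    weightedTrace_smul _ h10] at key
  simp only [Matrix.trace_sum, Matrix.trace_smul, Matrix.map_apply, smul_eq_mul]
  refine Eq.trans ?_ (key.trans ?_)
  · exact Finset.sum_congr rfl fun u _ => Finset.sum_congr rfl fun v _ => mul_comm _ _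
  · rw [hg.2]
    ring

end Transfer

/-! ### The residue formula for H_j and well-definedness. -/

section Residues

lemma gaugeElem_families {q : ℂ} {hq : q ≠ 0} {S : Subalgebra ℂ (ℂ → ℂ)} :
    (fun _ => gaugeElem (fockOscillator hq)) ∈ families q hq S := by
  have h : (fun _ => q⁻¹) ∈ S := S.algebraMap_mem q⁻¹
  exact families_smul h (cr_K_families (-2))

variable {η : ℂ} {n : ℕ} {ξ : Fin n → ℂ} {c : ℂ}

/-- The trace functional of the off-diagonal block of the fused conjugation of `X`. -/
def fusedTau (η : ℂ) (ξ : Fin n → ℂ) (X : SpinOp n) (s t : Conf n) (ζ : ℂ) : ℂ :=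
  tau η (fused (Complex.exp_ne_zero η) ξ ζ X s t 1 0 *
    gaugeElem (fockOscillator (Complex.exp_ne_zero η)))

lemma fused_mul_gaugeElem_families {S : Subalgebra ℂ (ℂ → ℂ)} (hS : analyticFns c ≤ S)
    (hb : ∀ j, (fun ζ => (ζ / ξ j - (ζ / ξ j)⁻¹)⁻¹) ∈ S)
    (hc : ∀ j, Regular (Complex.exp η) (c / ξ j)) (X : SpinOp n) (s t : Conf n) :
    (fun ζ => fused (Complex.exp_ne_zero η) ξ ζ X s t 1 0 *
      gaugeElem (fockOscillator (Complex.exp_ne_zero η))) ∈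
        families _ (Complex.exp_ne_zero η) S :=
  mul_mem (fused_families hS hb hc X s t 1 0) gaugeElem_families

lemma fusedTau_mem (hη : NotRootOfUnity η) {S : Subalgebra ℂ (ℂ → ℂ)} (hS : analyticFns c ≤ S)
    (hb : ∀ j, (fun ζ => (ζ / ξ j - (ζ / ξ j)⁻¹)⁻¹) ∈ S)
    (hc : ∀ j, Regular (Complex.exp η) (c / ξ j)) (X : SpinOp n) (s t : Conf n) :
    fusedTau η ξ X s t ∈ S :=
  tau_mem_of_mem_families hη (fused_mul_gaugeElem_families hS hb hc X s t)

lemma conjBy_siteM_families {q : ℂ} {hq : q ≠ 0} (X : SpinOp n) (s t : Conf n) :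
    (fun ζ => conjBy (fun j => siteM (fockOscillator hq) (ζ / ξ j))
      (fun j => siteMInv (fockOscillator hq) (ζ / ξ j)) X s t) ∈ families q hq ⊤ :=
  conjBy_mem (families q hq ⊤) (fun ζ j => siteM (fockOscillator hq) (ζ / ξ j))
    (fun ζ j => siteMInv (fockOscillator hq) (ζ / ξ j)) (fun _ => siteM_families)
    (fun _ => siteMInv_families) X s t

lemma eventually_traceable_conjBy_siteM (hη : NotRootOfUnity η) (X : SpinOp n) :
    ∀ᶠ α in 𝓝[≠] (0 : ℂ), ∀ s t ζ,
      conjBy (fun j => siteM (fockOscillator (Complex.exp_ne_zero η)) (ζ / ξ j))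
        (fun j => siteMInv (fockOscillator (Complex.exp_ne_zero η)) (ζ / ξ j)) X s t ∈
          Traceable η α :=
  eventually_all.2 fun s => eventually_all.2 fun t =>
    (eventually_families hη (conjBy_siteM_families X s t)).mono fun _ h => h.1

/-- The analytic part g collects the two diagonal blocks, so a residue can come only from the gauge
term. -/
lemma eventually_HOp_eq (hη : NotRootOfUnity η) (hc : ∀ j, Regular (Complex.exp η) (c / ξ j))
    (X : SpinOp n) (s t : Conf n) :
    ∀ᶠ α in 𝓝[≠] (0 : ℂ), ∃ g : ℂ → ℂ, AnalyticAt ℂ g c ∧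
      MeromorphicAt (fun ζ => (Complex.exp (2 * α * η) - 1) * weightedTrace η α
        (fused (Complex.exp_ne_zero η) ξ ζ X s t 1 0 *
          gaugeElem (fockOscillator (Complex.exp_ne_zero η)))) c ∧
      (g + fun ζ => (Complex.exp (2 * α * η) - 1) * weightedTrace η α
        (fused (Complex.exp_ne_zero η) ξ ζ X s t 1 0 *
          gaugeElem (fockOscillator (Complex.exp_ne_zero η)))) =ᶠ[𝓝[≠] c]
        fun ζ => HOp η ξ ζ α X s t := by
  filter_upwards [eventually_traceable_conjBy_siteM (ξ := ξ) hη X,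
    eventually_families hη (fused_zero_zero_families hc X s t),
    eventually_families hη (conjBy_siteB_families hc X s t),
    eventually_families hη (fused_mul_gaugeElem_families (analyticFns_le c)
      (fun j => meromorphic_inv_sub (ξ j) c) hc X s t)] with α hY h00 h11 h10
  refine ⟨_, add_mem h00.2 h11.2, ?_, ?_⟩
  · exact mul_mem ((meromorphicFns c).algebraMap_mem (Complex.exp (2 * α * η) - 1)) h10.2
  · filter_upwards [eventually_generic hc] with ζ hζ
    have hB := fused_one_one (hq := Complex.exp_ne_zero η) hζ X s t
    rw [HOp_eq hζ X s t (fun u v => hY u v ζ) (h00.1 ζ) (hB ▸ h11.1 ζ) (h10.1 ζ), hB]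
    rfl

/-- Discarding the analytic part leaves the residue of the gauge term, in which the vanishing factor
q^{2α} - 1 meets the pole of the trace at α = 0. -/
lemma tendsto_resH (hη : NotRootOfUnity η) (j : Fin n)
    (hc : ∀ i, Regular (Complex.exp η) (ξ j / ξ i)) (X : SpinOp n) (s t : Conf n) :
    Tendsto (fun α => resH η ξ j X α s t) (𝓝[≠] 0)
      (𝓝 (-residueAt (fusedTau η ξ X s t) (ξ j))) := by
  refine (tendsto_residueAt_weightedTrace hη (fused_mul_gaugeElem_families
    (analyticFns_le _) (fun i => meromorphic_inv_sub (ξ i) _) hc X s t)).congr' ?_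
  filter_upwards [eventually_HOp_eq hη hc X s t] with α ⟨g, hg, hm, h⟩
  have := ((hasRes_zero_of_analyticAt hg).add hg.meromorphicAt hm (hasRes_residueAt hm)).congr h
  rw [zero_add] at this
  exact this.residueAt_eq.symm

lemma Hj_apply (hη : NotRootOfUnity η) (j : Fin n)
    (hc : ∀ i, Regular (Complex.exp η) (ξ j / ξ i)) (X : SpinOp n) (s t : Conf n) :
    Hj η ξ j X s t = -residueAt (fusedTau η ξ X s t) (ξ j) :=
  (tendsto_resH hη j hc X s t).limUnder_eq

lemma hjWellDefined (hη : NotRootOfUnity η) (j : Fin n)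
    (hc : ∀ i, Regular (Complex.exp η) (ξ j / ξ i)) (X : SpinOp n) : HjWellDefined η ξ j X := by
  refine ⟨?_, ?_, fun s t => ⟨_, tendsto_resH hη j hc X s t⟩⟩
  · filter_upwards [eventually_traceable_conjBy_siteM (ξ := ξ) hη X] with α hY
    filter_upwards [eventually_generic hc] with ζ hζ
    refine ⟨(monodromy_Lsix (Complex.exp_ne_zero η) hζ).1,
      (monodromy_Lplus (Complex.exp_ne_zero η) hζ).1, fun s t => ?_⟩
    rw [(monodromy_Lplus (Complex.exp_ne_zero η) hζ).2]
    exact hY s t ζ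
  · refine eventually_all.2 fun s => eventually_all.2 fun t => ?_
    filter_upwards [eventually_HOp_eq hη hc X s t] with α ⟨g, hg, hm, h⟩
    exact (hg.meromorphicAt.add hm).congr h

end Residues

/-! ### Reduction at the last site. -/

section Reduction

variable {η : ℂ} {n : ℕ} {ξ : Fin (n + 1) → ℂ} {c : ℂ}

lemma Generic.succ {q ζ : ℂ} (h : Generic q ξ ζ) : Generic q (fun i : Fin n => ξ i.succ) ζ :=
  fun j => h j.succ

lemma fusedTau_rightId (hc : ∀ j, Regular (Complex.exp η) (c / ξ j)) (X : SpinOp n)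
    (s t : Conf (n + 1)) :
    fusedTau η ξ (rightId X) s t =ᶠ[𝓝[≠] c] fun ζ =>
      if s (Fin.last n) = t (Fin.last n) then
        fusedTau η (fun i : Fin n => ξ i.castSucc) X (fun i => s i.castSucc)
          (fun i => t i.castSucc) ζ
      else 0 := by
  filter_upwards [eventually_generic hc] with ζ hζ
  rw [fusedTau, fused, conjBy_rightId _ _ (siteFInv_mul_siteF _ (Complex.exp_ne_zero η)
    (hζ (Fin.last n)).1 (hζ (Fin.last n)).2)]
  split_ifs with h
  · rfl
  · simp [tau_zero]

lemma residueAt_zero (c : ℂ) : residueAt (fun _ => 0) c = 0 :=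
  (hasRes_zero_of_analyticAt analyticAt_const).residueAt_eq

lemma Hj_castSucc_rightId (hη : NotRootOfUnity η) (j : Fin n)
    (hc : ∀ i, Regular (Complex.exp η) (ξ j.castSucc / ξ i)) (X : SpinOp n) :
    Hj η ξ j.castSucc (rightId X) = rightId (Hj η (fun i => ξ i.castSucc) j X) := by
  ext s t
  rw [Hj_apply hη _ hc, residueAt_congr (fusedTau_rightId hc X s t), rightId, Matrix.of_apply]
  split_ifs with h
  · exact (Hj_apply hη j (fun i => hc i.castSucc) X _ _).symm
  · rw [residueAt_zero, neg_zero]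

lemma analyticAt_inv_sub {x : ℂ} (h0 : c / x ≠ 0) (h : (c / x) ^ 2 - 1 ≠ 0) :
    AnalyticAt ℂ (fun ζ => (ζ / x - (ζ / x)⁻¹)⁻¹) c :=
  (analyticAt_div.sub (analyticAt_div.inv h0)).inv (sub_inv_ne_zero h h0)

/-- After the last site has cancelled, only the factors w_i - w_i⁻¹ with i < n are inverted, and
these do not vanish at ξ_n. The function is analytic there and its residue is zero. -/
lemma Hj_last_rightId (hη : NotRootOfUnity η)
    (hc : ∀ i, Regular (Complex.exp η) (ξ (Fin.last n) / ξ i))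
    (hne : ∀ i : Fin n, (ξ (Fin.last n) / ξ i.castSucc) ^ 2 - 1 ≠ 0) (X : SpinOp n) :
    Hj η ξ (Fin.last n) (rightId X) = 0 := by
  ext s t
  rw [Hj_apply hη _ hc, residueAt_congr (fusedTau_rightId hc X s t), Matrix.zero_apply, neg_eq_zero]
  split_ifs with h
  · refine (hasRes_zero_of_analyticAt ?_).residueAt_eq
    exact fusedTau_mem hη le_rfl (fun i => analyticAt_inv_sub (hc i.castSucc).ne_zero (hne i))
      (fun i => hc i.castSucc) X _ _
  · exact residueAt_zero _

end Reduction

/-! ### Reduction at the first site, and the genericity conditions. -/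

section LeftReduction

variable {η : ℂ} {n : ℕ} {ξ : Fin (n + 1) → ℂ} {ζ c : ℂ}

lemma tau_sum_sandwich (hη : NotRootOfUnity η) {P Q : Fin 2 → Module.End ℂ Fock}
    {y g : Module.End ℂ Fock} (hP : ∀ c, P c ∈ bandOps (Complex.exp η))
    (hQ : ∀ c, Q c ∈ bandOps (Complex.exp η)) (hy : y ∈ bandOps (Complex.exp η))
    (hg : g ∈ bandOps (Complex.exp η)) :
    tau η ((∑ c, P c * y * Q c) * g) = tau η (y * ∑ c, Q c * g * P c) := by
  have hm {a b : Module.End ℂ Fock} (ha : a ∈ bandOps (Complex.exp η))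
    (hb : b ∈ bandOps (Complex.exp η)) := bandOps_mul (Complex.exp_ne_zero η) ha hb
  rw [Finset.sum_mul, Finset.mul_sum,
    tau_sum hη _ _ fun c _ => hm (hm (hm (hP c) hy) (hQ c)) hg,
    tau_sum hη _ _ fun c _ => hm hy (hm (hm (hQ c) hg) (hP c))]
  refine Finset.sum_congr rfl fun c _ => ?_
  have h := tau_mul_comm hη (hP c) (hm hy (hm (hQ c) hg))
  simpa only [mul_assoc] using h

lemma tau_mul_smul_eq_zero (hη : NotRootOfUnity η) {d e p : ℤ} {y w : Module.End ℂ Fock}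
    (hy : y ∈ homOp (Complex.exp η) d (-2 * d)) (κ : ℂ) (hw : w ∈ homOp (Complex.exp η) e p)
    (h : 0 < p + 2 * e) : tau η (y * (κ • w)) = 0 :=
  tau_mul_eq_zero hη hy (Submodule.smul_mem _ κ hw) h

lemma tau_mul_add_smul (hη : NotRootOfUnity η) {d e p : ℤ} {y u w : Module.End ℂ Fock}
    (hy : y ∈ homOp (Complex.exp η) d (-2 * d)) (hu : u ∈ bandOps (Complex.exp η)) (κ : ℂ)
    (hw : w ∈ homOp (Complex.exp η) e p) (h : 0 < p + 2 * e) :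
    tau η (y * (u + κ • w)) = tau η (y * u) := by
  have hq := Complex.exp_ne_zero η
  have hw' := Submodule.smul_mem _ κ hw
  rw [mul_add, tau_add hη (bandOps_mul hq (mem_bandOps hy) hu)
    (bandOps_mul hq (mem_bandOps hy) (mem_bandOps hw')), tau_mul_smul_eq_zero hη hy κ hw h,
    add_zero]

/-- Of the four terms in the corner of a product of three block matrices, the one through y₀₁ is
absent because y is lower triangular. -/
lemma fused_leftId {q : ℂ} (hq : q ≠ 0) (X : SpinOp n) (s t : Conf (n + 1)) {O}
    (hO : O = fockOscillator hq) {y : Matrix (Fin 2) (Fin 2) (Module.End ℂ Fock)}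
    (hy : y = fused hq (fun i : Fin n => ξ i.succ) ζ X (fun i => s i.succ) fun i => t i.succ)
    {w : ℂ} (hw : w = ζ / ξ 0) :
    fused hq ξ ζ (leftId X) s t 1 0 =
      ∑ c, ((w - w⁻¹)⁻¹ • siteBInv O w (s 0) c) * y 1 0 * siteA O w c (t 0) +
      ∑ c, ((w - w⁻¹)⁻¹ • siteBInv O w (s 0) c) * y 1 1 * siteC O w c (t 0) +
      ∑ c, siteCInv O w (s 0) c * y 0 0 * siteA O w c (t 0) := by
  have h01 : y 0 1 = 0 := hy ▸ fused_zero_one _ _ _ _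
  have : fused hq ξ ζ (leftId X) s t = ∑ c, siteFInv O w (s 0) c * y * siteF O w c (t 0) := by
    rw [hO, hy, hw, fused, conjBy_leftId]
    rfl
  rw [this, Matrix.sum_apply, ← Finset.sum_add_distrib, ← Finset.sum_add_distrib]
  refine Finset.sum_congr rfl fun c _ => ?_
  simp only [Matrix.mul_apply, Fin.sum_univ_two, h01]
  simp only [siteF, siteFInv, lowerTri, Matrix.of_apply, Matrix.cons_val', Matrix.cons_val_zero,
    Matrix.cons_val_one, Matrix.cons_val_fin_one, Matrix.smul_apply]
  rw [mul_zero, zero_add, add_mul]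
  abel

/-- After cyclicity and the crossing relations, the weight rule removes every term of positive
weight. The diagonal part reproduces the shorter chain; one off-diagonal spin pair leaves a
contribution with regular coefficients. -/
lemma fusedTau_leftId_eq (hη : NotRootOfUnity η) (hζ : Generic (Complex.exp η) ξ ζ)
    {X : SpinOp n} (hX : Commute (totalSpin n) X) (s t : Conf (n + 1)) {O}
    (hO : O = fockOscillator (Complex.exp_ne_zero η))
    {y : Matrix (Fin 2) (Fin 2) (Module.End ℂ Fock)}
    (hy : y = fused (Complex.exp_ne_zero η) (fun i : Fin n => ξ i.succ) ζ X (fun i => s i.succ)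
      fun i => t i.succ) {q w : ℂ} (hq : q = Complex.exp η) (hw : w = ζ / ξ 0) :
    fusedTau η ξ (leftId X) s t ζ =
      (if s 0 = t 0 then tau η (y 1 0 * gaugeElem O) else 0) +
      if s 0 = 0 ∧ t 0 = 1 then
        -((q - q⁻¹) * w * (1 - q ^ 2 * w ^ 2)⁻¹) * tau η (y 1 1 * (O.cr * O.K (-2))) +
        (q - q⁻¹) * w * (q ^ 2 - w ^ 2)⁻¹ * tau η (y 0 0 * (O.cr * O.K (-2)))
      else 0 := by
  subst hq
  have hq := Complex.exp_ne_zero η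
  have hdeg : ∀ a b, ∃ d, y a b ∈ homOp (Complex.exp η) d (-2 * d) := fun a b =>
    hy ▸ fused_apply_mem_homOp hq _ ζ hX _ _ a b
  have hyb : ∀ a b, y a b ∈ bandOps (Complex.exp η) := fun a b =>
    (hdeg a b).elim fun _ h => mem_bandOps h
  obtain ⟨d10, h10⟩ := hdeg 1 0
  obtain ⟨d11, h11⟩ := hdeg 1 1
  obtain ⟨d00, h00⟩ := hdeg 0 0
  have hgen := hζ 0
  rw [← hw] at hgen
  obtain ⟨hr, hr'⟩ := hgen
  have hA : ∀ a b, siteA O w a b ∈ bandOps (Complex.exp η) := fun a b =>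
    hO ▸ mem_bandOps (siteA_mem_homOp hq w a b)
  have hC : ∀ a b, siteC O w a b ∈ bandOps (Complex.exp η) := fun a b =>
    hO ▸ mem_bandOps (siteC_mem_homOp hq w a b)
  have hC' : ∀ a b, siteCInv O w a b ∈ bandOps (Complex.exp η) := fun a b =>
    hO ▸ mem_bandOps (siteCInv_mem_homOp hq w a b)
  have hB' : ∀ a b, (w - w⁻¹)⁻¹ • siteBInv O w a b ∈ bandOps (Complex.exp η) := fun a b =>
    hO ▸ mem_bandOps (Submodule.smul_mem _ _ (siteBInv_mem_homOp hq w a b))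
  have hcK2 : O.cr * O.K (-2) ∈ homOp (Complex.exp η) 1 (-2) := hO ▸ cr_K_mem hq le_rfl
  have hcK0 : O.cr * O.K 0 ∈ homOp (Complex.exp η) 1 0 := hO ▸ cr_K_mem hq le_rfl
  have hK2 : O.K 2 ∈ homOp (Complex.exp η) 0 2 := hO ▸ K_mem hq le_rfl
  have hccK : O.cr * O.cr * O.K (-2) ∈ homOp (Complex.exp η) 2 (-2) := by
    have h1 : O.cr * O.K 0 ∈ homOp (Complex.exp η) 1 0 := hcK0
    have h2 := homOp_mul hq h1 hcK2
    rw [O.K_zero, mul_one, ← mul_assoc] at h2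
    exact homOp_cast h2 (by norm_num) (by norm_num)
  have hg : gaugeElem O ∈ bandOps (Complex.exp η) :=
    mem_bandOps (Submodule.smul_mem _ _ hcK2)
  have hm {a b : Module.End ℂ Fock} (ha : a ∈ bandOps (Complex.exp η))
    (hb : b ∈ bandOps (Complex.exp η)) := bandOps_mul hq ha hb
  have hsum : ∀ P Q : Fin 2 → Module.End ℂ Fock, (∀ c, P c ∈ bandOps (Complex.exp η)) →
      (∀ c, Q c ∈ bandOps (Complex.exp η)) → ∀ a b, (∑ c, P c * y a b * Q c) * gaugeElem O ∈
        bandOps (Complex.exp η) := fun P Q hP hQ a b =>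
    hm (Submodule.sum_mem _ fun c _ => hm (hm (hP c) (hyb a b)) (hQ c)) hg
  rw [fusedTau, fused_leftId hq X s t hO hy hw, ← hO, add_mul, add_mul,
    tau_add hη (add_mem (hsum _ _ (hB' _) (fun c => hA c _) _ _)
      (hsum _ _ (hB' _) (fun c => hC c _) _ _)) (hsum _ _ (hC' _) (fun c => hA c _) _ _),
    tau_add hη (hsum _ _ (hB' _) (fun c => hA c _) _ _) (hsum _ _ (hB' _) (fun c => hC c _) _ _),
    tau_sum_sandwich hη (hB' _) (fun c => hA c _) (hyb _ _) hg,
    tau_sum_sandwich hη (hB' _) (fun c => hC c _) (hyb _ _) hg,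
    tau_sum_sandwich hη (hC' _) (fun c => hA c _) (hyb _ _) hg]
  have hC0 : ∀ c, siteC O w c 0 = 0 := fun c => by fin_cases c <;> simp [siteC]
  have hC1 : ∀ c, siteCInv O w 1 c = 0 := fun c => by fin_cases c <;> simp [siteCInv]
  generalize s 0 = a
  generalize t 0 = b
  -- In all four cases the discarded remainders a^*, (a^*)² q^{-2D} and q^{2D} have weight 2.
  fin_cases a <;> fin_cases b
  · simp only [Fin.zero_eta, hC0, crossing_A_zero_zero O hq hr hr',
      crossing_CInv_zero_zero O hq hr hr']
    rw [tau_mul_add_smul hη h10 hg _ hcK0 (by norm_num),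
      tau_mul_smul_eq_zero hη h00 _ hK2 (by norm_num)]
    simp [tau_zero]
  · simp only [Fin.zero_eta, Fin.mk_one, crossing_A_zero_one O hq hr hr',
      crossing_C_zero_one O hq hr hr', crossing_CInv_zero_one O hq hr hr']
    rw [tau_mul_smul_eq_zero hη h10 _ hccK (by norm_num),
      tau_mul_add_smul hη h11 (mem_bandOps (Submodule.smul_mem _ _ hcK2)) _ hcK0 (by norm_num),
      tau_mul_add_smul hη h00 (mem_bandOps (Submodule.smul_mem _ _ hcK2)) _ hcK0 (by norm_num),
      mul_smul_comm, mul_smul_comm, tau_smul hη _ (hm (hyb _ _) (mem_bandOps hcK2)),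
      tau_smul hη _ (hm (hyb _ _) (mem_bandOps hcK2))]
    simp
  · simp only [Fin.zero_eta, Fin.mk_one, hC0, hC1, crossing_A_one_zero O hq hr hr']
    rw [tau_mul_smul_eq_zero hη h10 _ hK2 (by norm_num)]
    simp [tau_zero]
  · simp only [Fin.mk_one, hC1, crossing_A_one_one O hq hr hr',
      crossing_C_one_one O hq hr hr']
    rw [tau_mul_add_smul hη h10 hg _ hcK0 (by norm_num),
      tau_mul_smul_eq_zero hη h11 _ hK2 (by norm_num)]
    simp [tau_zero]

/-- The extra off-diagonal contribution involves only the diagonal blocks of the shorter chain and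
coefficients singular at q²w² = 1 or w² = q², so it is analytic at c and does not affect residues.
-/
lemma fusedTau_leftId (hη : NotRootOfUnity η) (hc : ∀ j, Regular (Complex.exp η) (c / ξ j))
    {X : SpinOp n} (hX : Commute (totalSpin n) X) (s t : Conf (n + 1)) :
    ∃ g, AnalyticAt ℂ g c ∧ ((fun ζ => if s 0 = t 0 then
        fusedTau η (fun i : Fin n => ξ i.succ) X (fun i => s i.succ) (fun i => t i.succ) ζ
      else 0) + g) =ᶠ[𝓝[≠] c] fusedTau η ξ (leftId X) s t := by
  have hq := Complex.exp_ne_zero η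
  have hw : AnalyticAt ℂ (fun ζ => ζ / ξ 0) c := analyticAt_div
  have h1 : 1 - Complex.exp η ^ 2 * (c / ξ 0) ^ 2 ≠ 0 := fun h =>
    (hc 0).mul_sub_ne (by linear_combination -h)
  have h11 : AnalyticAt ℂ _ c := tau_mem_of_mem_families hη (mul_mem
    (conjBy_siteB_families (ξ := fun i : Fin n => ξ i.succ) (fun i => hc i.succ) X
      (fun i => s i.succ) fun i => t i.succ) (cr_K_families (-2)))
  have h00 : AnalyticAt ℂ _ c := tau_mem_of_mem_families hη (mul_mem
    (fused_zero_zero_families (ξ := fun i : Fin n => ξ i.succ) (fun i => hc i.succ) X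
      (fun i => s i.succ) fun i => t i.succ) (cr_K_families (-2)))
  set q := Complex.exp η
  by_cases hst : s 0 = 0 ∧ t 0 = 1
  · refine ⟨_, AnalyticAt.add
      ((((analyticAt_const (v := q - q⁻¹)).mul hw).mul ((analyticAt_const.sub
        (analyticAt_const.mul (hw.pow 2))).inv h1)).neg.mul h11)
      ((((analyticAt_const (v := q - q⁻¹)).mul hw).mul ((analyticAt_const.sub
        (hw.pow 2)).inv (hc 0).sub_ne)).mul h00), ?_⟩
    filter_upwards [eventually_generic hc] with ζ hζ
    rw [fusedTau_leftId_eq hη hζ hX s t rfl rfl rfl rfl, if_pos hst, fused_one_one hζ.succ]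
    rfl
  · refine ⟨0, analyticAt_const, ?_⟩
    filter_upwards [eventually_generic hc] with ζ hζ
    rw [fusedTau_leftId_eq hη hζ hX s t rfl rfl rfl rfl, if_neg hst]
    rfl

lemma Hj_leftId_apply (hη : NotRootOfUnity η) (j : Fin (n + 1))
    (hc : ∀ i, Regular (Complex.exp η) (ξ j / ξ i)) {X : SpinOp n}
    (hX : Commute (totalSpin n) X) (s t : Conf (n + 1)) :
    Hj η ξ j (leftId X) s t = if s 0 = t 0 then
      -residueAt (fusedTau η (fun i : Fin n => ξ i.succ) X (fun i => s i.succ)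
        fun i => t i.succ) (ξ j) else 0 := by
  obtain ⟨g, hg, h⟩ := fusedTau_leftId hη hc hX s t
  rw [Hj_apply hη _ hc, ← residueAt_congr h]
  split_ifs with hst
  · have hm : MeromorphicAt (fusedTau η (fun i : Fin n => ξ i.succ) X (fun i => s i.succ)
        fun i => t i.succ) (ξ j) :=
      fusedTau_mem hη (analyticFns_le _) (fun i => meromorphic_inv_sub _ _) (fun i => hc i.succ)
        X _ _
    have := (hasRes_residueAt hm).add hm hg.meromorphicAt (hasRes_zero_of_analyticAt hg)
    rw [add_zero] at this
    exact congrArg _ this.residueAt_eq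
  · rw [neg_eq_zero]
    refine (hasRes_zero_of_analyticAt ?_).residueAt_eq
    exact analyticAt_const.add hg

lemma Hj_succ_leftId (hη : NotRootOfUnity η) (j : Fin n)
    (hc : ∀ i, Regular (Complex.exp η) (ξ j.succ / ξ i)) {X : SpinOp n}
    (hX : Commute (totalSpin n) X) :
    Hj η ξ j.succ (leftId X) = leftId (Hj η (fun i => ξ i.succ) j X) := by
  ext s t
  rw [Hj_leftId_apply hη _ hc hX, leftId, Matrix.of_apply,
    Hj_apply hη j (fun i => hc i.succ)]

/-- The shorter chain does not contain ξ₁, so its trace functional is analytic there. -/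
lemma Hj_zero_leftId (hη : NotRootOfUnity η) (hc : ∀ i, Regular (Complex.exp η) (ξ 0 / ξ i))
    (hne : ∀ i : Fin n, (ξ 0 / ξ i.succ) ^ 2 - 1 ≠ 0) {X : SpinOp n}
    (hX : Commute (totalSpin n) X) : Hj η ξ 0 (leftId X) = 0 := by
  ext s t
  have h : AnalyticAt ℂ (fusedTau η (fun i : Fin n => ξ i.succ) X (fun i => s i.succ)
      fun i => t i.succ) (ξ 0) :=
    fusedTau_mem hη le_rfl (fun i => analyticAt_inv_sub (hc i.succ).ne_zero (hne i))
      (fun i => hc i.succ) X _ _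
  rw [Hj_leftId_apply hη _ hc hX, (hasRes_zero_of_analyticAt h).residueAt_eq, neg_zero, ite_self,
    Matrix.zero_apply]

lemma div_sq_sub_one_ne_zero {x y : ℂ} (hy : y ≠ 0) (h : x ^ 2 ≠ y ^ 2) : (x / y) ^ 2 - 1 ≠ 0 := by
  intro h'
  field_simp at h'
  exact h (by linear_combination h')

lemma regular_div (hη : NotRootOfUnity η) {ξ : Fin n → ℂ} (hξ : ∀ i, ξ i ≠ 0)
    (hgen : ∀ i j, i ≠ j → ξ i ^ 2 ≠ ξ j ^ 2 ∧ ξ i ^ 2 ≠ Complex.exp η ^ 2 * ξ j ^ 2)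
    (j i : Fin n) : Regular (Complex.exp η) (ξ j / ξ i) := by
  have hi := hξ i
  -- For i = j the ratio is 1 and regularity amounts to q² ≠ 1; for i ≠ j the two orderings of the
  -- genericity hypothesis give the two nonvanishing conditions.
  have h2 : Complex.exp η ^ 2 - 1 ≠ 0 := sub_ne_zero.2 (hη 2 two_pos)
  refine ⟨div_ne_zero (hξ j) hi, ?_, ?_⟩
  · rcases eq_or_ne j i with rfl | h
    · rwa [div_self hi, one_pow]
    · intro h'
      field_simp at h'
      exact (hgen j i h).2 (by linear_combination -h')
  · rcases eq_or_ne j i with rfl | h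
    · rwa [div_self hi, one_pow, mul_one]
    · intro h'
      field_simp at h'
      exact (hgen i j h.symm).2 (by linear_combination -h')

end LeftReduction

end XXZ

end

theorem mainTheorem2 (η : ℂ) (hη : ∀ m : ℕ, 0 < m → Complex.exp η ^ m ≠ 1)
    (n : ℕ) (ξ : Fin (n + 1) → ℂ) (hξ : ∀ i, ξ i ≠ 0)
    (hgen : ∀ i j, i ≠ j →
      ξ i ^ 2 ≠ ξ j ^ 2 ∧ ξ i ^ 2 ≠ Complex.exp η ^ 2 * ξ j ^ 2) :
    (∀ (j : Fin (n + 1)) (X : XXZ.SpinOp (n + 1)), XXZ.HjWellDefined η ξ j X) ∧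
    (∀ X : XXZ.SpinOp n, Commute (XXZ.totalSpin n) X →
      XXZ.Hj η ξ 0 (XXZ.leftId X) = 0) ∧
    (∀ (j : Fin n) (X : XXZ.SpinOp n), Commute (XXZ.totalSpin n) X →
      XXZ.Hj η ξ j.succ (XXZ.leftId X) =
        XXZ.leftId (XXZ.Hj η (fun i => ξ i.succ) j X)) ∧
    (∀ (j : Fin n) (X : XXZ.SpinOp n),
      XXZ.Hj η ξ j.castSucc (XXZ.rightId X) =
        XXZ.rightId (XXZ.Hj η (fun i => ξ i.castSucc) j X)) ∧
    (∀ X : XXZ.SpinOp n, XXZ.Hj η ξ (Fin.last n) (XXZ.rightId X) = 0) := by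
  have hc := XXZ.regular_div hη hξ hgen
  have hne : ∀ i j, i ≠ j → (ξ i / ξ j) ^ 2 - 1 ≠ 0 := fun i j h =>
    XXZ.div_sq_sub_one_ne_zero (hξ j) (hgen i j h).1
  exact ⟨fun j X => XXZ.hjWellDefined hη j (hc j) X,
    fun X hX => XXZ.Hj_zero_leftId hη (hc 0) (fun i => hne _ _ (Fin.succ_ne_zero i).symm) hX,
    fun j X hX => XXZ.Hj_succ_leftId hη j (hc j.succ) hX,
    fun j X => XXZ.Hj_castSucc_rightId hη j (hc j.castSucc) X,
    fun X => XXZ.Hj_last_rightId hη (hc (Fin.last n))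
      (fun i => hne _ _ (Fin.castSucc_lt_last i).ne') X⟩
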